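/- A *(host) graph* is a triple $(\Sigma,V,E)$ with $\Sigma$ (symbols) and $V$ (nodes) finite sets and $E\subseteq V\times\Sigma\times V$; $\mathrm{out}(v)$ is the set of edges with source $v$. A *guest* $G=(\Sigma_G,V_G,E_G,\mathcal M,\mathcal U,\mathcal X,\mathcal C)$ is a graph $(\Sigma_G,V_G,E_G)$ together with sets $\mathcal M,\mathcal U,\mathcal X\subseteq V_G$ (must, unique, exclusive) and a choice function $\mathcal C:V_G\to\mathcal P(\mathcal P(E_G))$ with $\bigcup\mathcal C(v)=\mathrm{out}(v)$ for all $v\in V_G$. For a host $H=(\Sigma_H,V_H,E_H)$, the tensor product $G\times H$ is the graph $(\Sigma_G\cap\Sigma_H,\,V_G\times V_H,\,E^\times)$ with $E^\times=\{((u,u'),a,(v,v'))\mid (u,a,v)\in E_G,\ (u',a,v')\in E_H\}$. A *path* from $v$ to $v'$ in a graph is a nonempty finite sequence of edges, each starting where the previous one ends, whose first edge has source $v$ and whose last edge has target $v'$. A *loose graph simulation* (LGS) of $G$ in $H$ is a subgraph $S=(\Sigma_G\cap\Sigma_H,V_S,E_S)$ of $G\times H$ such that: 1. (LGS1) for each $u\in\mathcal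 M$ there is $u'\in V_H$ with $(u,u')\in V_S$; 2. (LGS2) for each $u\in\mathcal U$ and $u',v'\in V_H$, if $(u,u'),(u,v')\in V_S$ then $u'=v'$; 3. (LGS3) for each $u\in\mathcal X$, $v\in V_G$ and $u'\in V_H$, if $(u,u'),(v,u')\in V_S$ then $u=v$; 4. (LGS4) for each $(u,u')\in V_S$ there is $\gamma\in\mathcal C(u)$ such that for every $(u,a,v)\in\gamma$ there is $v'\in V_H$ with $((u,u'),a,(v,v'))\in E_S$; and for each $((u,u'),a,(v,v'))\in E_S$ there is $\gamma\in\mathcal C(u)$ with $(u,a,v)\in\gamma$ such that for every $(u,b,w)\in\gamma$ there is $w'\in V_H$ with $((u,u'),b,(w,w'))\in E_S$; 5. (LGS5) for each $(u,u')\in V_S$ and $v\in\mathcal M$, if $G$ has a path from $u$ to $v$, then for some $v'\in V_H$ there is a path in $S$ from $(u,u')$ to $(v,v')$. Guests, hosts and candidate graphs $S$ are given as words over a finite alphabet, by explicit lists of their symbols, nodes and edges, of the elements of $\mathcal M,\mathcal U,\mathcal X$, and of all pairs $(v,\gamma)$ with $\gamma\in\mathcal C(v)$, where nodes and symbols are named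 by binary strings and the lists for $S$ have no repetitions. Then: (a) given $G$, $H$ and $S$, it can be checked by a Turing machine in polynomial time whether $S$ is a subgraph of $G\times H$ that satisfies LGS1–LGS5; (b) computing LGSs is an NP search problem: the relation "$S$ is an LGS of $G$ in $H$" is decidable in polynomial time, and the size of every such $S$ is bounded by a polynomial in the size of $(G,H)$; (c) the decision problem "given $G$ and $H$, is the set of LGSs of $G$ in $H$ nonempty?" is in NP. -/

import Mathlib

open scoped Classical in
/-- A language over `Γ` is in P: its characteristic function is computed by a (multi-stack) Turing
machine whose number of steps is bounded by a polynomial in the length of the input word. -/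
def InP {Γ : Type} (L : Language Γ) : Prop :=
  Nonempty (Turing.TM2ComputableInPolyTime (id : List Γ → List Γ) Computability.encodeBool
    (fun w => decide (w ∈ L)))

/-- The language of all pairs `(x, y)` with `R x y`; the pair is written as `x` followed by `y`,
over the disjoint union of the two alphabets. -/
def pairLanguage {Γ Δ : Type} (R : List Γ → List Δ → Prop) : Language (Γ ⊕ Δ) :=
  {w | ∃ x y, w = x.map Sum.inl ++ y.map Sum.inr ∧ R x y}

/-- The search problem "given `x`, find `y` with `R x y`" is an NP search problem (is in FNP):
solutions have polynomially bounded length and can be recognized in polynomial time. -/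
def InFNP {Γ Δ : Type} (R : List Γ → List Δ → Prop) : Prop :=
  InP (pairLanguage R) ∧
    ∃ p : Polynomial ℕ, ∀ x y, R x y → y.length ≤ p.eval x.length

/-- A language is in NP: membership means that a certificate exists, where certificates (over some
finite alphabet) have polynomially bounded length and are verified in polynomial time. -/
def InNP {Γ : Type} (L : Language Γ) : Prop :=
  ∃ (Δ : Type) (_ : Fintype Δ) (R : List Γ → List Δ → Prop),
    InFNP R ∧ ∀ x, x ∈ L ↔ ∃ y, R x y

/-- A (host) graph: finite alphabet, finite set of nodes, labelled edges `(source, label, target)`. -/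
structure HostGraph (A N : Type*) where
  alphabet : Finset A
  nodes : Finset N
  edges : Finset (N × A × N)
  edges_mem : ∀ e ∈ edges, e.1 ∈ nodes ∧ e.2.1 ∈ alphabet ∧ e.2.2 ∈ nodes

namespace HostGraph

variable {A N N' : Type*} [DecidableEq A] [DecidableEq N] [DecidableEq N']

/-- The outgoing edges of a node. -/
def out (M : HostGraph A N) (v : N) : Finset (N × A × N) :=
  M.edges.filter (fun e => e.1 = v)

/-- The paths from `v` to `v'`: nonempty sequences of consecutive edges. -/
def paths (M : HostGraph A N) (v v' : N) : Set (List (N × A × N)) :=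
  {ρ | (∀ e ∈ ρ, e ∈ M.edges) ∧ ρ.IsChain (fun e f => e.2.2 = f.1) ∧
    (∃ e ∈ ρ.head?, e.1 = v) ∧ (∃ e ∈ ρ.getLast?, e.2.2 = v')}

/-- The tensor product graph. -/
def tensor (M₁ : HostGraph A N) (M₂ : HostGraph A N') : HostGraph A (N × N') where
  alphabet := M₁.alphabet ∩ M₂.alphabet
  nodes := M₁.nodes ×ˢ M₂.nodes
  edges :=
    ((M₁.nodes ×ˢ M₂.nodes) ×ˢ (M₁.alphabet ∩ M₂.alphabet) ×ˢ (M₁.nodes ×ˢ M₂.nodes)).filter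
      (fun e => (e.1.1, e.2.1, e.2.2.1) ∈ M₁.edges ∧ (e.1.2, e.2.1, e.2.2.2) ∈ M₂.edges)
  edges_mem := by
    intro e he
    simpa only [Finset.mem_product] using (Finset.mem_filter.1 he).1

/-- The edges of the tensor product are exactly the pairs of equally labelled edges. -/
theorem mem_tensor_edges (M₁ : HostGraph A N) (M₂ : HostGraph A N') (u v : N) (u' v' : N') (a : A) :
    ((u, u'), a, (v, v')) ∈ (M₁.tensor M₂).edges ↔
      (u, a, v) ∈ M₁.edges ∧ (u', a, v') ∈ M₂.edges := by
  constructor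
  · intro h
    exact (Finset.mem_filter.1 h).2
  · rintro ⟨h, h'⟩
    have h1 := M₁.edges_mem _ h
    have h2 := M₂.edges_mem _ h'
    simp only at h1 h2
    refine Finset.mem_filter.2 ⟨?_, h, h'⟩
    simp only [Finset.mem_product, Finset.mem_inter]
    tauto

/-- `S` is a subgraph of `M` over the same alphabet. -/
def IsSubgraph (S M : HostGraph A N) : Prop :=
  S.alphabet = M.alphabet ∧ S.nodes ⊆ M.nodes ∧ S.edges ⊆ M.edges

end HostGraph

/-- A guest. The choice function is defined on the nodes; it is extended by `∅` to the whole type. -/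
structure Guest (A N : Type*) [DecidableEq A] [DecidableEq N] extends HostGraph A N where
  must : Finset N
  unique : Finset N
  exclusive : Finset N
  must_subset : must ⊆ nodes
  unique_subset : unique ⊆ nodes
  exclusive_subset : exclusive ⊆ nodes
  choice : N → Finset (Finset (N × A × N))
  biUnion_choice : ∀ v ∈ nodes, (choice v).biUnion id = toHostGraph.out v
  choice_of_notMem : ∀ v, v ∉ nodes → choice v = ∅

section LGS

variable {A N N' : Type*} [DecidableEq A] [DecidableEq N] [DecidableEq N']
  (G : Guest A N) (H : HostGraph A N') (S : HostGraph A (N × N'))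

/-- Must nodes occur. -/
def LGS1 : Prop :=
  ∀ u ∈ G.must, ∃ u' ∈ H.nodes, (u, u') ∈ S.nodes

/-- Unique nodes are assigned to at most one host node. -/
def LGS2 : Prop :=
  ∀ u ∈ G.unique, ∀ u' ∈ H.nodes, ∀ v' ∈ H.nodes,
    (u, u') ∈ S.nodes → (u, v') ∈ S.nodes → u' = v'

/-- Host nodes assigned to an exclusive node are assigned to no other node. -/
def LGS3 : Prop :=
  ∀ u ∈ G.exclusive, ∀ v ∈ G.nodes, ∀ u' ∈ H.nodes,
    (u, u') ∈ S.nodes → (v, u') ∈ S.nodes → u = v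

/-- Outgoing edges follow the choice function. -/
def LGS4 : Prop :=
  (∀ u u', (u, u') ∈ S.nodes →
    ∃ γ ∈ G.choice u, ∀ a v, (u, a, v) ∈ γ →
      ∃ v' ∈ H.nodes, ((u, u'), a, (v, v')) ∈ S.edges) ∧
  (∀ u u' a v v', ((u, u'), a, (v, v')) ∈ S.edges →
    ∃ γ ∈ G.choice u, (u, a, v) ∈ γ ∧ ∀ b w, (u, b, w) ∈ γ →
      ∃ w' ∈ H.nodes, ((u, u'), b, (w, w')) ∈ S.edges)

/-- Reachability of must nodes is preserved. -/
def LGS5 : Prop :=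
  ∀ u u', (u, u') ∈ S.nodes → ∀ v ∈ G.must, (G.paths u v).Nonempty →
    ∃ v' ∈ H.nodes, (S.paths (u, u') (v, v')).Nonempty

/-- The set of all loose graph simulations of `G` in `H`. -/
def looseGraphSimulations : Set (HostGraph A (N × N')) :=
  {S | S.IsSubgraph (G.toHostGraph.tensor H) ∧
    LGS1 G H S ∧ LGS2 G H S ∧ LGS3 G H S ∧ LGS4 G H S ∧ LGS5 G H S}

end LGS

namespace LGSCode

/-- Nodes and symbols of input graphs are named by binary strings. -/
abbrev Name := List Bool

/-- Input alphabet: the two bits, and four end markers `0, 1, 2, 3`. An item closed by the marker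
`k` contains only bits and markers smaller than `k`, so that words can be parsed uniquely. -/
abbrev Token := Bool ⊕ Fin 4

/-- A list of items, each closed by the end marker `k`. -/
def closed {α : Type*} (k : Fin 4) (f : α → List Token) (l : List α) : List Token :=
  l.flatMap (fun x => f x ++ [Sum.inr k])

/-- A list of names. -/
def names (l : List Name) : List Token := closed 0 (List.map Sum.inl) l

/-- A list of edges. -/
def edges (l : List (Name × Name × Name)) : List Token :=
  closed 1 (fun e => names [e.1, e.2.1, e.2.2]) l

/-- A list of pairs `(v, γ)` with `γ` a choice set of the node `v`. -/
def choices (l : List (Name × List (Name × Name × Name))) : List Token :=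
  closed 2 (fun c => closed 1 names [[c.1]] ++ edges c.2) l

/-- A list of nodes of a product graph. -/
def pairNodes (l : List (Name × Name)) : List Token :=
  closed 1 (fun p => names [p.1, p.2]) l

/-- A list of edges of a product graph. -/
def pairEdges (l : List ((Name × Name) × Name × (Name × Name))) : List Token :=
  closed 1 (fun e => names [e.1.1, e.1.2, e.2.1, e.2.2.1, e.2.2.2]) l

/-- The word describes the host `H`: its symbols, nodes and edges are listed, in any order. -/
def DescribesHost (w : List Token) (H : HostGraph Name Name) : Prop :=
  ∃ (lA lV : List Name) (lE : List (Name × Name × Name)),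
    lA.toFinset = H.alphabet ∧ lV.toFinset = H.nodes ∧ lE.toFinset = H.edges ∧
    w = closed 3 id [names lA, names lV, edges lE]

/-- The word describes the guest `G`: the underlying graph, then the three node sets, then all pairs
`(v, γ)` with `γ` in the choice of `v`. -/
def DescribesGuest (w : List Token) (G : Guest Name Name) : Prop :=
  ∃ (w₀ : List Token) (lM lU lX : List Name)
    (lC : List (Name × List (Name × Name × Name))),
    DescribesHost w₀ G.toHostGraph ∧
    lM.toFinset = G.must ∧ lU.toFinset = G.unique ∧ lX.toFinset = G.exclusive ∧
    (∀ v γ, γ ∈ G.choice v ↔ ∃ l, (v, l) ∈ lC ∧ l.toFinset = γ) ∧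
    w = w₀ ++ closed 3 id [names lM, names lU, names lX, choices lC]

/-- The word describes the instance consisting of the guest `G` and the host `H`. -/
def DescribesInstance (w : List Token) (G : Guest Name Name) (H : HostGraph Name Name) : Prop :=
  ∃ w₁ w₂, DescribesGuest w₁ G ∧ DescribesHost w₂ H ∧ w = w₁ ++ w₂

/-- The word describes the candidate `S`: its nodes and edges are listed, in any order and without
repetition. The alphabet of a subgraph of `G × H` is determined by `G` and `H`. -/
def DescribesCandidate (w : List Token) (S : HostGraph Name (Name × Name)) : Prop :=
  ∃ (lV : List (Name × Name)) (lE : List ((Name × Name) × Name × (Name × Name))),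
    lV.Nodup ∧ lE.Nodup ∧ lV.toFinset = S.nodes ∧ lE.toFinset = S.edges ∧
    w = closed 3 id [pairNodes lV, pairEdges lE]

end LGSCode

/-- `x` describes a guest `G` and a host `H`, and `y` describes a loose graph simulation of `G`
in `H`. -/
def LGSRelation (x y : List LGSCode.Token) : Prop :=
  ∃ G H S, LGSCode.DescribesInstance x G H ∧ LGSCode.DescribesCandidate y S ∧
    S ∈ looseGraphSimulations G H

/-- The decision problem attached to emptiness: the words that describe a guest `G` and a host `H`
such that the set of loose graph simulations of `G` in `H` is not empty. -/
def LGSNonemptiness : Language LGSCode.Token :=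
  {x | ∃ G H, LGSCode.DescribesInstance x G H ∧ (looseGraphSimulations G H).Nonempty}

/-! Apart from LGS5, every condition is a first-order statement whose quantifiers range over the
listed nodes, edges and choice sets, so exhaustive evaluation takes polynomial time. LGS5 asks for
reachability in two finite graphs, which a saturation computation decides in polynomially many
rounds. A simulation is a subgraph of the product: its repetition-free description has polynomially
many entries, each a tuple of names that already occur in the input. Hence solutions are short, and
they serve as certificates for nonemptiness.

The work lies in making "polynomial time" literal. A small imperative language `Prog`, whose
registers are stacks, is compiled step for step into a `TM2` machine (`Run.steps`, `Prog.inP`).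
Above it, `PolyPred` and `PolyFun` speak of predicates and word functions on values stored as tuples
of words. The program may depend on the placement of the variables, but one exists for every
placement, and it leaves the variables intact. This makes the two notions compose: they are closed
under Boolean connectives, equality, quantification over an encoded list (`PolyPred.exists_split`),
filtering, bounded iteration, and so reachability (`PolyPred.reach`). Time stays polynomial because
each loop runs at most once per symbol of a polynomially bounded word, and all intermediate words
are polynomially bounded too.

Inputs must also be recognized as well formed. `PolyRange` handles this for nested lists with end
markers, and `PolyPred.exists_preimage` allows all further tests to be stated on the parsed lists
`Data` instead of on words. `Data.valid_iff_exists` identifies the conditions on lists with the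
definition of a simulation, and `Data.length_candidateCode_le` gives the size bound. -/

/-! ### Structured programs and their compilation to Turing machines -/

/-- Structured programs acting on a read-only-once input stack with alphabet `Γ`, on registers
(stackContents with alphabet `T`, indexed by the natural numbers) and on a finite memory `V`. -/
inductive Prog (Γ T V : Type)
  | pop (r : ℕ) (f : V → Option T → V)
  | push (r : ℕ) (f : V → T)
  | load (f : V → V)
  | read (f : V → Option Γ → V)
  | seq (c d : Prog Γ T V)
  | ite (b : V → Bool) (c d : Prog Γ T V)
  | loop (b : V → Bool) (c : Prog Γ T V)

namespace Prog

/-- The state of a computation: memory, unread input, contents of the registers. -/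
structure State (Γ T V : Type) where
  var : V
  inp : List Γ
  reg : ℕ → List T

variable {Γ T V : Type}

/-- `Run c s s' t`: the program `c` started in the state `s` ends in the state `s'` after `t`
steps. -/
inductive Run : Prog Γ T V → State Γ T V → State Γ T V → ℕ → Prop
  | pop (r f v i e) :
      Run (pop r f) ⟨v, i, e⟩ ⟨f v (e r).head?, i, Function.update e r (e r).tail⟩ 1
  | push (r f v i e) :
      Run (push r f) ⟨v, i, e⟩ ⟨v, i, Function.update e r (f v :: e r)⟩ 1
  | load (f v i e) : Run (load f) ⟨v, i, e⟩ ⟨f v, i, e⟩ 1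
  | read (f v i e) : Run (read f) ⟨v, i, e⟩ ⟨f v i.head?, i.tail, e⟩ 1
  | seq {c d s s' s'' t t'} : Run c s s' t → Run d s' s'' t' → Run (seq c d) s s'' (t + t')
  | ite_true {b c d s s' t} : b s.var = true → Run c s s' t → Run (ite b c d) s s' (1 + t)
  | ite_false {b c d s s' t} : b s.var = false → Run d s s' t → Run (ite b c d) s s' (1 + t)
  | loop_false {b c s} : b s.var = false → Run (loop b c) s s 1
  | loop_true {b c s s' s'' t t'} : b s.var = true → Run c s s' t →
      Run (loop b c) s' s'' t' → Run (loop b c) s s'' (1 + t + t')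

/-- All registers that occur in a program are smaller than its bound. -/
def bound : Prog Γ T V → ℕ
  | pop r _ => r + 1
  | push r _ => r + 1
  | load _ => 0
  | read _ => 0
  | seq c d => max c.bound d.bound
  | ite _ c d => max c.bound d.bound
  | loop _ c => c.bound

/-- The control points of a program. -/
def Lab : Prog Γ T V → Type
  | pop _ _ => Unit
  | push _ _ => Unit
  | load _ => Unit
  | read _ => Unit
  | seq c d => Lab c ⊕ Lab d
  | ite _ c d => Option (Lab c ⊕ Lab d)
  | loop _ c => Option (Lab c)

/-- A program has finitely many control points. -/
theorem finite_lab (c : Prog Γ T V) : Finite (Lab c) := by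
  induction c with
  | pop | push | load | read => exact inferInstanceAs (Finite Unit)
  | seq c d => exact inferInstanceAs (Finite (Lab c ⊕ Lab d))
  | ite _ c d => exact inferInstanceAs (Finite (Option (Lab c ⊕ Lab d)))
  | loop _ c => exact inferInstanceAs (Finite (Option (Lab c)))

/-- The control point at which a program starts. -/
def entry : (c : Prog Γ T V) → Lab c
  | pop _ _ => ()
  | push _ _ => ()
  | load _ => ()
  | read _ => ()
  | seq c _ => Sum.inl (entry c)
  | ite _ _ _ => none
  | loop _ _ => none

/-- Stacks of the machine: input, output, and `N` registers. -/
abbrev Stk (N : ℕ) : Type := Option (Option (Fin N))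

/-- Alphabets of the stackContents. -/
def Alph (Γ T : Type) (N : ℕ) : Stk N → Type
  | none => Γ
  | some none => Bool
  | some (some _) => T

/-- The machine code of a program inside a machine with labels `Λ`. -/
def code {Λ : Type} (N : ℕ) : (c : Prog Γ T V) → (Lab c → Λ) → Λ → Lab c →
    Turing.TM2.Stmt (Alph Γ T N) Λ V
  | pop r f, _, next, _ =>
      if h : r < N then
        .pop (some (some ⟨r, h⟩)) f (.goto fun _ => next) else .goto fun _ => next
  | push r f, _, next, _ =>
      if h : r < N then
        .push (some (some ⟨r, h⟩)) f (.goto fun _ => next) else .goto fun _ => next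
  | load f, _, next, _ => .load f (.goto fun _ => next)
  | read f, _, next, _ => .pop none f (.goto fun _ => next)
  | seq c d, emb, next, l =>
      match (l : Lab c ⊕ Lab d) with
      | .inl l => code N c (fun x => emb (Sum.inl x)) (emb (Sum.inr (entry d))) l
      | .inr l => code N d (fun x => emb (Sum.inr x)) next l
  | ite b c d, emb, next, l =>
      match (l : Option (Lab c ⊕ Lab d)) with
      | none => .goto fun v => bif b v then emb (some (Sum.inl (entry c)))
          else emb (some (Sum.inr (entry d)))
      | some (.inl l) => code N c (fun x => emb (some (Sum.inl x))) next l
      | some (.inr l) => code N d (fun x => emb (some (Sum.inr x))) next l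
  | loop b c, emb, next, l =>
      match (l : Option (Lab c)) with
      | none => .goto fun v => bif b v then emb (some (entry c)) else next
      | some l => code N c (fun x => emb (some x)) (emb none) l

/-- The stacks of the machine in a given state of the program. -/
def stackContents (N : ℕ) (i : List Γ) (e : ℕ → List T) : (k : Stk N) → List (Alph Γ T N k)
  | none => i
  | some none => []
  | some (some r) => e r

theorem stackContents_update {N : ℕ} (i : List Γ) (e : ℕ → List T) (r : ℕ) (h : r < N)
    (l : List T) :
    Function.update (stackContents N i e) (some (some ⟨r, h⟩)) l =
      stackContents N i (Function.update e r l) := by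
  funext k
  rcases k with _ | _ | k
  · exact Function.update_of_ne (by simp) _ _
  · exact Function.update_of_ne (by simp) _ _
  · by_cases hk : k = ⟨r, h⟩
    · subst hk
      exact (Function.update_self _ _ _).trans
        (Function.update_self (β := fun _ => List T) r l e).symm
    · have : (k : ℕ) ≠ r := fun hr => hk (Fin.ext hr)
      exact (Function.update_of_ne (by simpa using hk) _ _).trans
        (Function.update_of_ne (β := fun _ => List T) this l e).symm

theorem stackContents_update_input {N : ℕ} (i j : List Γ) (e : ℕ → List T) :
    Function.update (stackContents N i e) none j = stackContents N j e := by
  funext k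
  rcases k with _ | _ | k
  · exact Function.update_self _ _ _
  · exact Function.update_of_ne (by simp) _ _
  · exact Function.update_of_ne (by simp) _ _

/-- The machine code of a program performs the runs of the program. -/
theorem Run.steps {Λ : Type} {N : ℕ} {M : Λ → Turing.TM2.Stmt (Alph Γ T N) Λ V}
    {c : Prog Γ T V} {s s' : State Γ T V} {t : ℕ} (h : Run c s s' t) (hN : c.bound ≤ N)
    (emb : Lab c → Λ) (next : Λ) (hM : ∀ l, M (emb l) = code N c emb next l) :
    (flip bind (Turing.TM2.step M))^[t]
        (some ⟨some (emb (entry c)), s.var, stackContents N s.inp s.reg⟩) =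
      some ⟨some next, s'.var, stackContents N s'.inp s'.reg⟩ := by
  induction h generalizing next with
  | pop r f v i e =>
    have hr : r < N := hN
    simp only [Function.iterate_one, flip, Option.bind_eq_bind, Option.bind_some,
      Turing.TM2.step, hM, code, dif_pos hr, Turing.TM2.stepAux]
    rw [← stackContents_update i e r hr]
    rfl
  | push r f v i e =>
    have hr : r < N := hN
    simp only [Function.iterate_one, flip, Option.bind_eq_bind, Option.bind_some,
      Turing.TM2.step, hM, code, dif_pos hr, Turing.TM2.stepAux]
    rw [← stackContents_update i e r hr]
    rfl
  | load f v i e =>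
    simp only [Function.iterate_one, flip, Option.bind_eq_bind, Option.bind_some,
      Turing.TM2.step, hM, code, Turing.TM2.stepAux]
  | read f v i e =>
    simp only [Function.iterate_one, flip, Option.bind_eq_bind, Option.bind_some,
      Turing.TM2.step, hM, code, Turing.TM2.stepAux]
    rw [← stackContents_update_input i i.tail e]
    rfl
  -- The exit label of `c` is the entry label of `d`. The summands are swapped because
  -- `iterate_add_apply` performs the right summand first.
  | @seq c d s s' s'' t t' _ _ ih₁ ih₂ =>
    rw [add_comm, Function.iterate_add_apply]
    have h1 := ih₁ (le_trans (le_max_left _ _) hN) (fun x => emb (Sum.inl x))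
      (emb (Sum.inr (entry d))) (fun l => hM (Sum.inl l))
    have h2 := ih₂ (le_trans (le_max_right _ _) hN) (fun x => emb (Sum.inr x)) next
      (fun l => hM (Sum.inr l))
    exact (congrArg _ h1).trans h2
  | @ite_true b c d s s' t hb _ ih =>
    rw [add_comm, Function.iterate_add_apply]
    have h1 := ih (le_trans (le_max_left _ _) hN) (fun x => emb (some (Sum.inl x))) next
      (fun l => hM (some (Sum.inl l)))
    refine (congrArg _ ?_).trans h1
    have h0 := hM none
    simp only [Function.iterate_one, flip, Option.bind_eq_bind, Option.bind_some,
      Turing.TM2.step, entry]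
    rw [h0]
    simp only [code, Turing.TM2.stepAux, hb, cond_true]
  | @ite_false b c d s s' t hb _ ih =>
    rw [add_comm, Function.iterate_add_apply]
    have h1 := ih (le_trans (le_max_right _ _) hN) (fun x => emb (some (Sum.inr x))) next
      (fun l => hM (some (Sum.inr l)))
    refine (congrArg _ ?_).trans h1
    have h0 := hM none
    simp only [Function.iterate_one, flip, Option.bind_eq_bind, Option.bind_some,
      Turing.TM2.step, entry]
    rw [h0]
    simp only [code, Turing.TM2.stepAux, hb, cond_false]
  | @loop_false b c s hb =>
    have h0 := hM none
    simp only [Function.iterate_one, flip, Option.bind_eq_bind, Option.bind_some,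
      Turing.TM2.step, entry]
    rw [h0]
    simp only [code, Turing.TM2.stepAux, hb, cond_false]
  | @loop_true b c s s' s'' t t' hb _ _ ih₁ ih₂ =>
    rw [add_comm, Function.iterate_add_apply, add_comm 1 t, Function.iterate_add_apply]
    have h1 := ih₁ hN (fun x => emb (some x)) (emb none) (fun l => hM (some l))
    have h2 := ih₂ hN emb next hM
    refine (congrArg _ ((congrArg _ ?_).trans h1)).trans h2
    have h0 := hM none
    simp only [Function.iterate_one, flip, Option.bind_eq_bind, Option.bind_some,
      Turing.TM2.step, entry]
    rw [h0]
    simp only [code, Turing.TM2.stepAux, hb, cond_true]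

/-- The Turing machine that runs the program and then writes one bit of its memory. -/
noncomputable def toFinTM2 [Fintype Γ] [Fintype V] (c : Prog Γ T V) (v₀ : V) (out : V → Bool) :
    Turing.FinTM2 where
  K := Stk c.bound
  k₀ := none
  k₁ := some none
  Γ := Alph Γ T c.bound
  Λ := Option (Lab c)
  main := some (entry c)
  ΛFin := by have := finite_lab c; exact Fintype.ofFinite _
  σ := V
  initialState := v₀
  Γk₀Fin := inferInstanceAs (Fintype Γ)
  m := fun l => match l with
    | none => .push (some none) out (.load (fun _ => v₀) .halt)
    | some l => code c.bound c some none l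

/-- A language is in P if it is decided by a program in polynomial time. -/
theorem inP [Fintype Γ] [Fintype V] (c : Prog Γ T V) (v₀ : V) (out : V → Bool)
    (p : Polynomial ℕ) (L : Language Γ)
    (h : ∀ w, ∃ v t, Run c ⟨v₀, w, fun _ => []⟩ ⟨v, [], fun _ => []⟩ t ∧
      t ≤ p.eval w.length ∧ (out v = true ↔ w ∈ L)) : InP L := by
  classical
  -- The extra step is the exit label: in one machine step it writes the answer and resets the
  -- memory to `v₀`, as `haltList` requires.
  refine ⟨⟨⟨c.toFinTM2 v₀ out, Equiv.refl _, Equiv.refl _⟩, p + 1, fun w => ?_⟩⟩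
  have hw : ∃ t, t ≤ p.eval w.length ∧
      (flip bind (c.toFinTM2 v₀ out).step)^[t + 1]
        (some (Turing.initList (c.toFinTM2 v₀ out) w)) =
      some (Turing.haltList (c.toFinTM2 v₀ out) [decide (w ∈ L)]) := by
    obtain ⟨v, t, hr, ht, hv⟩ := h w
    refine ⟨t, ht, ?_⟩
    rw [add_comm, Function.iterate_add_apply]
    have h1 := hr.steps (M := (c.toFinTM2 v₀ out).m) le_rfl some none (fun l => rfl)
    have hi : Turing.initList (c.toFinTM2 v₀ out) w =
        (⟨some (some (entry c)), v₀, stackContents c.bound w (fun _ => [])⟩ :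
          Turing.TM2.Cfg (Alph Γ T c.bound) (Option (Lab c)) V) := by
      unfold Turing.initList
      congr 1
      funext k
      rcases k with _ | _ | k <;> rfl
    rw [hi]
    refine (congrArg _ h1).trans ?_
    have hb : out v = decide (w ∈ L) := by
      rw [Bool.eq_iff_iff, hv, decide_eq_true_iff]
    have hh : Turing.haltList (c.toFinTM2 v₀ out) [decide (w ∈ L)] =
        (⟨none, v₀, Function.update (stackContents c.bound [] (fun _ => []))
          (some none) [decide (w ∈ L)]⟩ :
          Turing.TM2.Cfg (Alph Γ T c.bound) (Option (Lab c)) V) := by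
      unfold Turing.haltList
      congr 1
      funext k
      rcases k with _ | _ | k <;> rfl
    rw [hh, ← hb]
    rfl
  have hid {α : Type} (l : List α) : List.map (Equiv.refl α).invFun l = l := List.map_id l
  refine ⟨⟨hw.choose + 1, ?_⟩, ?_⟩
  · refine Eq.trans ?_ (hw.choose_spec.2.trans ?_)
    · exact congrArg (fun l => (flip bind (c.toFinTM2 v₀ out).step)^[hw.choose + 1]
        (some (Turing.initList (c.toFinTM2 v₀ out) l))) (hid w)
    · exact congrArg (fun l => some (Turing.haltList (c.toFinTM2 v₀ out) l))
        (hid [decide (w ∈ L)]).symm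
  · simpa using hw.choose_spec.1

end Prog

/-! ### Elementary programs with step bounds -/

namespace Prog

variable {Γ T : Type}

/-- Memory of the programs below: a flag, the symbol read last, and an auxiliary bit. -/
abbrev Mem (T : Type) : Type := Bool × Option T × Bool

/-- Started with flag `b` and registers `e`, the program `c` stops with flag `b'` and registers `e'`
after at most `N` steps, whatever the rest of the memory and the input are. -/
def Does (c : Prog Γ T (Mem T)) (b : Bool) (e : ℕ → List T) (b' : Bool) (e' : ℕ → List T)
    (N : ℕ) : Prop :=
  ∀ (i : List Γ) (v : Mem T), v.1 = b →
    ∃ v' : Mem T, v'.1 = b' ∧ ∃ t ≤ N, Run c ⟨v, i, e⟩ ⟨v', i, e'⟩ t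

section Basic

variable {c d : Prog Γ T (Mem T)} {b b₁ b₂ : Bool} {e e₁ e₂ : ℕ → List T} {N N₁ N₂ : ℕ}

theorem Does.mono (h : Does c b e b₁ e₁ N₁) (hN : N₁ ≤ N) : Does c b e b₁ e₁ N := by
  intro i v hv
  obtain ⟨v', hv', t, ht, hr⟩ := h i v hv
  exact ⟨v', hv', t, ht.trans hN, hr⟩

theorem Does.of_eq (h : Does c b e b₁ e₁ N₁) (he : e₁ = e₂) (hN : N₁ ≤ N) :
    Does c b e b₁ e₂ N :=
  he ▸ h.mono hN

theorem Does.seq (h₁ : Does c b e b₁ e₁ N₁) (h₂ : Does d b₁ e₁ b₂ e₂ N₂) :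
    Does (c.seq d) b e b₂ e₂ (N₁ + N₂) := by
  intro i v hv
  obtain ⟨v₁, hv₁, t₁, ht₁, hr₁⟩ := h₁ i v hv
  obtain ⟨v₂, hv₂, t₂, ht₂, hr₂⟩ := h₂ i v₁ hv₁
  exact ⟨v₂, hv₂, t₁ + t₂, add_le_add ht₁ ht₂, hr₁.seq hr₂⟩

/-- Branch on the flag. -/
def ifFlag (c d : Prog Γ T (Mem T)) : Prog Γ T (Mem T) := .ite (fun v => v.1) c d

theorem Does.ifFlag_true (h : Does c true e b₁ e₁ N) :
    Does (ifFlag c d) true e b₁ e₁ (N + 1) := by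
  intro i v hv
  obtain ⟨v', hv', t, ht, hr⟩ := h i v hv
  exact ⟨v', hv', 1 + t, by omega, .ite_true hv hr⟩

theorem Does.ifFlag_false (h : Does d false e b₁ e₁ N) :
    Does (ifFlag c d) false e b₁ e₁ (N + 1) := by
  intro i v hv
  obtain ⟨v', hv', t, ht, hr⟩ := h i v hv
  exact ⟨v', hv', 1 + t, by omega, .ite_false hv hr⟩

/-- Change the flag. -/
def setFlag (f : Bool → Bool) : Prog Γ T (Mem T) := .load fun v => (f v.1, v.2)

theorem does_setFlag (f : Bool → Bool) (b : Bool) (e : ℕ → List T) :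
    Does (setFlag f : Prog Γ T (Mem T)) b e (f b) e 1 := by
  intro i v hv
  exact ⟨(f v.1, v.2), by rw [hv], 1, le_rfl, .load _ _ _ _⟩

/-- Do nothing. -/
def skip : Prog Γ T (Mem T) := setFlag id

theorem does_skip (b : Bool) (e : ℕ → List T) : Does (skip : Prog Γ T (Mem T)) b e b e 1 :=
  does_setFlag id b e

/-- Push a constant. -/
def pushConst (r : ℕ) (x : T) : Prog Γ T (Mem T) := .push r fun _ => x

theorem does_pushConst (r : ℕ) (x : T) (b : Bool) (e : ℕ → List T) :
    Does (pushConst r x : Prog Γ T (Mem T)) b e b (Function.update e r (x :: e r)) 1 := by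
  intro i v hv
  exact ⟨v, hv, 1, le_rfl, .push _ _ _ _ _⟩

/-- Remove a symbol, and update the flag. -/
def absorb (r : ℕ) (f : Bool → Option T → Bool) : Prog Γ T (Mem T) :=
  .pop r fun v o => (f v.1 o, v.2)

theorem does_absorb (r : ℕ) (f : Bool → Option T → Bool) (b : Bool) (e : ℕ → List T) :
    Does (absorb r f : Prog Γ T (Mem T)) b e (f b (e r).head?)
      (Function.update e r (e r).tail) 1 := by
  intro i v hv
  exact ⟨_, by rw [← hv], 1, le_rfl, .pop r _ v i e⟩

/-- Remove a symbol. -/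
def popDrop (r : ℕ) : Prog Γ T (Mem T) := absorb r fun b _ => b

/-- Read a symbol into the memory. -/
def popCur (r : ℕ) : Prog Γ T (Mem T) := .pop r fun v o => (v.1, o, v.2.2)

/-- Write the symbol in the memory. -/
def pushCur [Inhabited T] (r : ℕ) : Prog Γ T (Mem T) := .push r fun v => v.2.1.getD default

/-- Inspect the top of a register. -/
def peekCur [Inhabited T] (r : ℕ) : Prog Γ T (Mem T) :=
  (popCur r).seq (.ite (fun v => v.2.1.isSome) (pushCur r) (.load id))

/-- The symbol is popped and pushed back. Popping an empty register changes nothing, so that branch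
only has to idle. -/
theorem run_peekCur [Inhabited T] (r : ℕ) (i : List Γ) (v : Mem T) (e : ℕ → List T) :
    ∃ t ≤ 3, Run (peekCur r) ⟨v, i, e⟩ ⟨(v.1, (e r).head?, v.2.2), i, e⟩ t := by
  have h := Run.pop r (fun (v : Mem T) o => (v.1, o, v.2.2)) v i e
  rcases he : e r with _ | ⟨x, l⟩
  · rw [he] at h
    have hu : Function.update e r [].tail = e := by
      rw [List.tail_nil, ← he, Function.update_eq_self]
    rw [hu] at h
    exact ⟨_, le_rfl, h.seq (.ite_false rfl (.load _ _ _ _))⟩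
  · rw [he] at h
    have h2 := Run.push r (fun v : Mem T => v.2.1.getD default) (v.1, some x, v.2.2) i
      (Function.update e r l)
    simp only [Option.getD_some, Function.update_self, Function.update_idem] at h2
    rw [← he, Function.update_eq_self] at h2
    exact ⟨_, le_rfl, h.seq (.ite_true rfl h2)⟩

/-- Repeat as long as the register is not empty and its top symbol satisfies the guard. -/
def whileHead [Inhabited T] (r : ℕ) (g : Bool → T → Bool) (c : Prog Γ T (Mem T)) :
    Prog Γ T (Mem T) :=
  (peekCur r).seq (.loop (fun v => v.2.1.elim false (g v.1)) (c.seq (peekCur r)))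

theorem does_whileHead_stop [Inhabited T] {r : ℕ} {g : Bool → T → Bool}
    (h : ∀ x ∈ (e r).head?, g b x = false) :
    Does (whileHead r g c) b e b e 4 := by
  intro i v hv
  obtain ⟨t, ht, hr⟩ := run_peekCur r i v e
  refine ⟨_, ?_, _, ?_, hr.seq (.loop_false ?_)⟩
  · exact hv
  · omega
  · change (e r).head?.elim false (g v.1) = false
    rw [hv]
    cases hh : (e r).head? with
    | none => rfl
    | some x => exact h x hh

/-- One unrolling of the loop. The peek that ends the body is the peek with which the remaining
`whileHead` begins, so the run of the latter is taken apart and its two pieces are regrouped. The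
overhead 4 is the first peek and one loop test. -/
theorem Does.whileHead_step [Inhabited T] {r : ℕ} {g : Bool → T → Bool} {x : T}
    (hx : (e r).head? = some x) (hg : g b x = true) (h₁ : Does c b e b₁ e₁ N₁)
    (h₂ : Does (whileHead r g c) b₁ e₁ b₂ e₂ N₂) :
    Does (whileHead r g c) b e b₂ e₂ (N₁ + N₂ + 4) := by
  intro i v hv
  obtain ⟨t, ht, hr⟩ := run_peekCur r i v e
  obtain ⟨v₁, hv₁, t₁, ht₁, hr₁⟩ := h₁ i (v.1, (e r).head?, v.2.2) hv
  obtain ⟨v₂, hv₂, t₂, ht₂, hr₂⟩ := h₂ i v₁ hv₁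
  cases hr₂ with
  | @seq _ _ _ s _ t₃ t₄ hr₃ hr₄ =>
    refine ⟨v₂, hv₂, _, ?_, hr.seq (.loop_true ?_ (hr₁.seq hr₃) hr₄)⟩
    · omega
    · change (e r).head?.elim false (g v.1) = true
      rw [hx, hv]
      exact hg

/-- Move a symbol from a register to another one. -/
def xfer [Inhabited T] (r s : ℕ) : Prog Γ T (Mem T) := (popCur r).seq (pushCur s)

theorem does_xfer [Inhabited T] {r s : ℕ} (hrs : r ≠ s) {x : T} {l : List T} (hx : e r = x :: l) :
    Does (xfer r s : Prog Γ T (Mem T)) b e b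
      (Function.update (Function.update e r l) s (x :: e s)) 2 := by
  intro i v hv
  have h := Run.pop r (fun (v : Mem T) o => (v.1, o, v.2.2)) v i e
  rw [hx] at h
  have h2 := Run.push s (fun v : Mem T => v.2.1.getD default) (v.1, some x, v.2.2) i
      (Function.update e r l)
  rw [Function.update_of_ne hrs.symm] at h2
  exact ⟨(v.1, some x, v.2.2), hv, _, le_rfl, h.seq h2⟩

/-- Move a symbol from a register to two other ones. -/
def xfer₂ [Inhabited T] (r s s' : ℕ) : Prog Γ T (Mem T) :=
  (popCur r).seq ((pushCur s).seq (pushCur s'))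

theorem does_xfer₂ [Inhabited T] {r s s' : ℕ} (hrs : r ≠ s) (hrs' : r ≠ s') (hss : s ≠ s')
    {x : T} {l : List T} (hx : e r = x :: l) :
    Does (xfer₂ r s s' : Prog Γ T (Mem T)) b e b
      (Function.update (Function.update (Function.update e r l) s (x :: e s)) s' (x :: e s')) 3 := by
  intro i v hv
  have h := Run.pop r (fun (v : Mem T) o => (v.1, o, v.2.2)) v i e
  rw [hx] at h
  have h2 := Run.push s (fun v : Mem T => v.2.1.getD default) (v.1, some x, v.2.2) i
      (Function.update e r l)
  rw [Function.update_of_ne hrs.symm] at h2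
  have h3 := Run.push s' (fun v : Mem T => v.2.1.getD default) (v.1, some x, v.2.2) i
      (Function.update (Function.update e r l) s (x :: e s))
  rw [Function.update_of_ne hss.symm, Function.update_of_ne hrs'.symm] at h3
  exact ⟨(v.1, some x, v.2.2), hv, _, le_rfl, h.seq (h2.seq h3)⟩

/-- Remove the top symbols of two registers; the flag tells whether they agree. -/
def compareTops [DecidableEq T] (r s : ℕ) : Prog Γ T (Mem T) :=
  (popCur r).seq (.pop s fun v o => (decide (v.2.1 = o), v.2))

theorem does_compareTops [DecidableEq T] {r s : ℕ} (hrs : r ≠ s) :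
    Does (compareTops r s : Prog Γ T (Mem T)) b e (decide ((e r).head? = (e s).head?))
      (Function.update (Function.update e r (e r).tail) s (e s).tail) 2 := by
  intro i v hv
  have h := Run.pop r (fun (v : Mem T) o => (v.1, o, v.2.2)) v i e
  have h2 := Run.pop s (fun (v : Mem T) o => (decide (v.2.1 = o), v.2)) (v.1, (e r).head?, v.2.2) i
      (Function.update e r (e r).tail)
  rw [Function.update_of_ne hrs.symm] at h2
  exact ⟨_, rfl, _, le_rfl, h.seq h2⟩

end Basic

section Derived

theorem foldl_const_false (l : List T) (b : Bool) :
    l.foldl (fun _ _ => false) b = (b && l.isEmpty) := by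
  induction l generalizing b with
  | nil => simp
  | cons x l ih => rw [List.foldl_cons, ih]; simp

variable [Inhabited T] {b : Bool}

/-- Move the contents of a register to another one, in reverse order. -/
def move (r s : ℕ) : Prog Γ T (Mem T) := whileHead r (fun _ _ => true) (xfer r s)

/-- Each symbol costs two steps for the transfer and four for the loop, and leaving the loop costs
four. The constants of the other loops arise in the same way. -/
theorem does_move {r s : ℕ} (hrs : r ≠ s) (e : ℕ → List T) :
    Does (move r s : Prog Γ T (Mem T)) b e b
      (Function.update (Function.update e r []) s ((e r).reverse ++ e s))
      (6 * (e r).length + 4) := by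
  generalize hl : e r = l
  induction l generalizing e with
  | nil =>
    have : Function.update (Function.update e r []) s ([].reverse ++ e s) = e := by
      have h₀ : Function.update e r [] = e := by simp [hl]
      simp [h₀]
    rw [this]
    exact (does_whileHead_stop (by simp [hl])).mono (by simp)
  | cons x l ih =>
    have h := (does_xfer (Γ := Γ) (b := b) hrs hl).whileHead_step (g := fun _ _ => true)
      (by rw [hl]; rfl) rfl (ih (Function.update (Function.update e r l) s (x :: e s))
        (by rw [Function.update_of_ne hrs, Function.update_self]))
    have he : Function.update (Function.update (Function.update (Function.update e r l) s
          (x :: e s)) r []) s (l.reverse ++ Function.update (Function.update e r l) s (x :: e s) s) =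
        Function.update (Function.update e r []) s ((x :: l).reverse ++ e s) := by
      funext k
      simp only [Function.update_apply]
      split_ifs <;> simp_all
    rw [he] at h
    exact h.mono (by simp only [List.length_cons]; omega)

/-- Move the contents of a register to two other ones, in reverse order. -/
def move₂ (r s s' : ℕ) : Prog Γ T (Mem T) := whileHead r (fun _ _ => true) (xfer₂ r s s')

theorem does_move₂ {r s s' : ℕ} (hrs : r ≠ s) (hrs' : r ≠ s') (hss : s ≠ s') (e : ℕ → List T) :
    Does (move₂ r s s' : Prog Γ T (Mem T)) b e b
      (Function.update (Function.update (Function.update e r []) s ((e r).reverse ++ e s)) s'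
        ((e r).reverse ++ e s')) (7 * (e r).length + 4) := by
  generalize hl : e r = l
  induction l generalizing e with
  | nil =>
    have : Function.update (Function.update (Function.update e r []) s ([].reverse ++ e s)) s'
        ([].reverse ++ e s') = e := by
      have h₀ : Function.update e r [] = e := by simp [hl]
      simp [h₀]
    rw [this]
    exact (does_whileHead_stop (by simp [hl])).mono (by simp)
  | cons x l ih =>
    have h := (does_xfer₂ (Γ := Γ) (b := b) hrs hrs' hss hl).whileHead_step
      (g := fun _ _ => true) (by rw [hl]; rfl) rfl (ih _
        (by rw [Function.update_of_ne hrs', Function.update_of_ne hrs, Function.update_self]))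
    refine h.of_eq ?_ (by simp only [List.length_cons]; omega)
    funext k
    simp only [Function.update_apply]
    split_ifs <;> simp_all

/-- Empty a register. -/
def clear (r : ℕ) : Prog Γ T (Mem T) := whileHead r (fun _ _ => true) (popDrop r)

theorem does_clear (r : ℕ) (e : ℕ → List T) :
    Does (clear r : Prog Γ T (Mem T)) b e b (Function.update e r []) (5 * (e r).length + 4) := by
  generalize hl : e r = l
  induction l generalizing e with
  | nil =>
    have : Function.update e r [] = e := by
      rw [← hl]; simp
    rw [this]
    exact (does_whileHead_stop (by simp [hl])).mono (by simp)
  | cons x l ih =>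
    have h := (does_absorb (Γ := Γ) r (fun b _ => b) b e).whileHead_step
      (g := fun _ _ => true) (by rw [hl]; rfl) rfl (ih _ (by rw [Function.update_self, hl]; rfl))
    rw [Function.update_idem] at h
    exact h.mono (by simp only [List.length_cons]; omega)

/-- Copy a register to a register, with the help of a third one. -/
def copy (r s h : ℕ) : Prog Γ T (Mem T) := (move r h).seq (move₂ h r s)

theorem does_copy {r s h : ℕ} (hrs : r ≠ s) (hrh : r ≠ h) (hsh : s ≠ h) (e : ℕ → List T)
    (hs : e s = []) (hh : e h = []) :
    Does (copy r s h : Prog Γ T (Mem T)) b e b (Function.update e s (e r))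
      (13 * (e r).length + 8) := by
  have h1 := does_move (Γ := Γ) (b := b) hrh e
  have h2 := does_move₂ (Γ := Γ) (b := b) hrh.symm hsh.symm hrs
    (Function.update (Function.update e r []) h ((e r).reverse ++ e h))
  refine (h1.seq h2).of_eq ?_ ?_
  · funext k
    simp only [Function.update_apply]
    split_ifs <;> simp_all
  · simp [hh]; omega

/-- Cut the register `r` behind the first symbol `x`: the part before this symbol is put into the
register `s`, the part behind it stays. -/
def cut [DecidableEq T] (x : T) (r s h : ℕ) : Prog Γ T (Mem T) :=
  (whileHead r (fun _ y => decide (y ≠ x)) (xfer r h)).seq ((popDrop r).seq (move h s))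

theorem does_cut_aux [DecidableEq T] (x : T) {r h : ℕ} (hrh : r ≠ h) (e : ℕ → List T) :
    Does (whileHead r (fun _ y => decide (y ≠ x)) (xfer r h) : Prog Γ T (Mem T)) b e b
      (Function.update (Function.update e r ((e r).dropWhile (· ≠ x))) h
        (((e r).takeWhile (· ≠ x)).reverse ++ e h)) (6 * (e r).length + 4) := by
  generalize hl : e r = l
  induction l generalizing e with
  | nil =>
    refine (does_whileHead_stop (b := b) (e := e) (by simp [hl])).of_eq ?_ (by simp)
    funext k
    simp only [Function.update_apply]
    split_ifs <;> simp_all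
  | cons y l ih =>
    by_cases hy : y = x
    · refine (does_whileHead_stop (b := b) (e := e) (by simp [hl, hy])).of_eq ?_ (by simp)
      funext k
      simp only [Function.update_apply]
      split_ifs <;> simp_all
    · have h := (does_xfer (Γ := Γ) (b := b) hrh hl).whileHead_step
        (g := fun _ y => decide (y ≠ x)) (by rw [hl]; rfl) (by simpa using hy) (ih _
        (by rw [Function.update_of_ne hrh, Function.update_self]))
      refine h.of_eq ?_ (by simp only [List.length_cons]; omega)
      funext k
      simp only [Function.update_apply]
      split_ifs <;> simp_all

theorem does_cut [DecidableEq T] (x : T) {r s h : ℕ} (hrs : r ≠ s) (hrh : r ≠ h) (hsh : s ≠ h)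
    (e : ℕ → List T) (hs : e s = []) (hh : e h = []) :
    Does (cut x r s h : Prog Γ T (Mem T)) b e b
      (Function.update (Function.update e r ((e r).dropWhile (· ≠ x)).tail) s
        ((e r).takeWhile (· ≠ x))) (12 * (e r).length + 9) := by
  have h1 := does_cut_aux (Γ := Γ) (b := b) x hrh e
  have h2 := does_absorb (Γ := Γ) r (fun b _ => b) b
    (Function.update (Function.update e r ((e r).dropWhile (· ≠ x))) h
        (((e r).takeWhile (· ≠ x)).reverse ++ e h))
  have h3 := h1.seq (h2.seq (does_move (Γ := Γ) hsh.symm _))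
  refine h3.of_eq ?_ ?_
  · funext k
    simp only [Function.update_apply]
    split_ifs <;> simp_all
  · have := (List.takeWhile_sublist (· ≠ x) (l := e r)).length_le
    simp only [Function.update_apply, hrh.symm, hh, if_true, if_false, List.append_nil,
      List.length_reverse]
    simp only [ne_eq, decide_not] at *
    omega

/-- Read a register to its end, updating the flag. -/
def scan (r : ℕ) (f : Bool → T → Bool) : Prog Γ T (Mem T) :=
  whileHead r (fun _ _ => true) (absorb r fun b o => o.elim b (f b))

theorem does_scan (r : ℕ) (f : Bool → T → Bool) (b : Bool) (e : ℕ → List T) :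
    Does (scan r f : Prog Γ T (Mem T)) b e ((e r).foldl f b) (Function.update e r [])
      (5 * (e r).length + 4) := by
  generalize hl : e r = l
  induction l generalizing e b with
  | nil =>
    have : Function.update e r [] = e := by
      rw [← hl]; simp
    rw [this]
    exact (does_whileHead_stop (by simp [hl])).mono (by simp)
  | cons x l ih =>
    have h := (does_absorb (Γ := Γ) r (fun b o => o.elim b (f b)) b e).whileHead_step
      (g := fun _ _ => true) (by rw [hl]; rfl) rfl
      (ih _ _ (by rw [Function.update_self, hl]; rfl))
    rw [Function.update_idem, hl] at h
    exact h.mono (by simp only [List.length_cons]; omega)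

/-- Compare two registers, and empty them. -/
def compare [DecidableEq T] (r s : ℕ) : Prog Γ T (Mem T) :=
  (setFlag fun _ => true).seq
    ((whileHead r (fun b _ => b) (compareTops r s)).seq
      ((clear r).seq (scan s fun _ _ => false)))

/-- The loop ends at the first mismatch or when `r` is exhausted, leaving remainders `k` and `k'`.
If `r` outlasts `s`, a symbol is compared with `none` and the flag drops. Thus a surviving flag
means that `r` was a prefix of `s`, and only emptiness of `k'` remains to be tested; `compare` does
this by scanning `s` with the constant `false`. -/
theorem does_compare_aux [DecidableEq T] {r s : ℕ} (hrs : r ≠ s) (b : Bool) (e : ℕ → List T) :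
    ∃ (b' : Bool) (k k' : List T), (b' = true ∧ k' = [] ↔ b = true ∧ e r = e s) ∧
      k.length ≤ (e r).length ∧ k'.length ≤ (e s).length ∧
      Does (whileHead r (fun b _ => b) (compareTops r s) : Prog Γ T (Mem T)) b e b'
        (Function.update (Function.update e r k) s k') (6 * (e r).length + 4) := by
  generalize hl : e r = l
  induction l generalizing e b with
  | nil =>
    refine ⟨b, [], e s, ?_, le_rfl, le_rfl, ?_⟩
    · rw [eq_comm (a := e s)]
    · rw [Function.update_eq_self_iff.2 (by rw [Function.update_of_ne hrs.symm]), ← hl,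
        Function.update_eq_self]
      exact (does_whileHead_stop (by simp [hl])).mono (by simp)
  | cons x l ih =>
    cases b with
    | false =>
      refine ⟨false, e r, e s, by simp, by rw [hl], le_rfl, ?_⟩
      rw [Function.update_eq_self_iff.2 (by rw [Function.update_of_ne hrs.symm]),
        Function.update_eq_self]
      exact (does_whileHead_stop (by simp)).mono (by simp)
    | true =>
      have h := does_compareTops (Γ := Γ) (b := true) (e := e) hrs
      obtain ⟨b', k, k', hb, hk, hk', hd⟩ := ih (decide ((e r).head? = (e s).head?))
        (Function.update (Function.update e r (e r).tail) s (e s).tail)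
        (by rw [Function.update_of_ne hrs, Function.update_self, hl]; rfl)
      refine ⟨b', k, k', ?_, ?_, ?_, ?_⟩
      · rw [hb, Function.update_self, hl]
        rcases e s with _ | ⟨y, l'⟩ <;> simp
      · exact hk.trans (by simp)
      · rw [Function.update_self] at hk'
        exact hk'.trans (by simp)
      · refine (h.whileHead_step (g := fun b _ => b) (by rw [hl]; rfl) rfl hd).of_eq ?_ ?_
        · funext k
          simp only [Function.update_apply]
          split_ifs <;> simp_all
        · simp only [List.length_cons]; omega

theorem does_compare [DecidableEq T] {r s : ℕ} (hrs : r ≠ s) (b : Bool) (e : ℕ → List T) :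
    Does (compare r s : Prog Γ T (Mem T)) b e (decide (e r = e s))
      (Function.update (Function.update e r []) s [])
      (11 * (e r).length + 5 * (e s).length + 13) := by
  obtain ⟨b', k, k', hb, hk, hk', hd⟩ := does_compare_aux (Γ := Γ) hrs true e
  have h := (does_setFlag (Γ := Γ) (fun _ => true) b e).seq (hd.seq ((does_clear (Γ := Γ) r _).seq
    (does_scan (Γ := Γ) s (fun _ _ => false) b' _)))
  have hs : Function.update (Function.update (Function.update e r k) s k') r [] s = k' := by
    rw [Function.update_of_ne hrs.symm, Function.update_self]
  have hr : Function.update (Function.update e r k) s k' r = k := by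
    rw [Function.update_of_ne hrs, Function.update_self]
  rw [hs, hr, foldl_const_false] at h
  have hbool : (b' && k'.isEmpty) = decide (e r = e s) := by
    rw [Bool.eq_iff_iff]
    simpa using hb
  rw [hbool] at h
  refine h.of_eq ?_ ?_
  · funext k
    simp only [Function.update_apply]
    split_ifs <;> simp_all
  · omega

end Derived

end Prog

/-! ### Variables in registers; polynomial-time predicates and functions -/

namespace Prog

/-- A context describes how a value of type `α` is stored as a tuple of words. -/
structure Ctx (Γ T α : Type) where
  arity : ℕ
  get : α → ℕ → List T

variable {Γ T α β γ : Type}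

namespace Ctx

/-- Add a variable to a context, stored as a word by means of `f`. -/
def push (C : Ctx Γ T α) (f : β → List T) : Ctx Γ T (α × β) where
  arity := C.arity + 1
  get p i := if i = C.arity then f p.2 else C.get p.1 i

/-- The registers `e` hold the value `a`, the variables being placed according to `ρ`; the words are
not longer than `n`, and the registers from `m` on are free. -/
structure Holds (C : Ctx Γ T α) (ρ : ℕ → ℕ) (m n : ℕ) (e : ℕ → List T) (a : α) : Prop where
  get_eq : ∀ i < C.arity, e (ρ i) = C.get a i
  length_le : ∀ i < C.arity, (C.get a i).length ≤ n
  free : ∀ r, m ≤ r → e r = []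

/-- The registers assigned to the variables are smaller than `m`. -/
def Below (C : Ctx Γ T α) (ρ : ℕ → ℕ) (m : ℕ) : Prop := ∀ i < C.arity, ρ i < m

theorem Below.push {C : Ctx Γ T α} {ρ : ℕ → ℕ} {m : ℕ} (h : C.Below ρ m) (f : β → List T)
    {r m' : ℕ} (hr : r < m') (hm : m ≤ m') :
    (C.push f).Below (Function.update ρ C.arity r) m' := by
  intro i hi
  by_cases h' : i = C.arity
  · rw [h', Function.update_self]; exact hr
  · rw [Function.update_of_ne h']
    exact (h i (by have : i < C.arity + 1 := hi; omega)).trans_le hm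

/-- Old variables live below `m`, where `e'` agrees with `e`. In this way a freshly computed word
becomes a variable of the next program. -/
theorem Holds.push {C : Ctx Γ T α} {ρ : ℕ → ℕ} {m n : ℕ} {e : ℕ → List T} {a : α}
    (h : C.Holds ρ m n e a) (hρ : C.Below ρ m) {f : β → List T} {b : β} {e' : ℕ → List T}
    {r m' n' : ℕ} (he : ∀ s < m, e' s = e s) (hr : e' r = f b) (hl : (f b).length ≤ n')
    (hn : n ≤ n') (hm : ∀ s, m' ≤ s → e' s = []) :
    (C.push f).Holds (Function.update ρ C.arity r) m' n' e' (a, b) := by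
  refine ⟨fun i hi => ?_, fun i hi => ?_, hm⟩
  · by_cases h' : i = C.arity
    · simp [Ctx.push, h', hr]
    · have hi' : i < C.arity := by have : i < C.arity + 1 := hi; omega
      rw [Function.update_of_ne h', he _ (hρ i hi'), h.get_eq i hi']
      simp [Ctx.push, h']
  · by_cases h' : i = C.arity
    · simpa [Ctx.push, h'] using hl
    · have hi' : i < C.arity := by have : i < C.arity + 1 := hi; omega
      simpa [Ctx.push, h'] using (h.length_le i hi').trans hn

/-- The variables of `C` at `h a` are among those of `D` at `a`. -/
def Map (D : Ctx Γ T β) (C : Ctx Γ T α) (h : β → α) : Prop :=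
  ∀ i < C.arity, ∃ j < D.arity, ∀ b, D.get b j = C.get (h b) i

/-- A word-valued function that is a variable of the context. -/
def IsVar (C : Ctx Γ T α) (f : α → List T) : Prop := ∃ j < C.arity, ∀ a, C.get a j = f a

theorem isVar_snd (C : Ctx Γ T α) (f : β → List T) : (C.push f).IsVar (fun p => f p.2) :=
  ⟨C.arity, Nat.lt_succ_self _, fun _ => if_pos rfl⟩

theorem IsVar.fst {C : Ctx Γ T α} {g : α → List T} (h : C.IsVar g) (f : β → List T) :
    (C.push f).IsVar (fun p => g p.1) := by
  obtain ⟨j, hj, hg⟩ := h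
  exact ⟨j, Nat.lt_succ_of_lt hj, fun p => (if_neg hj.ne).trans (hg p.1)⟩

theorem map_fst (C : Ctx Γ T α) (f : β → List T) : (C.push f).Map C Prod.fst :=
  fun i hi => ⟨i, Nat.lt_succ_of_lt hi, fun _ => if_neg hi.ne⟩

theorem Map.comp {C : Ctx Γ T α} {D : Ctx Γ T β} {E : Ctx Γ T γ} {h : β → α} {k : γ → β}
    (hk : E.Map D k) (hh : D.Map C h) : E.Map C (fun c => h (k c)) := by
  intro i hi
  obtain ⟨j, hj, hj'⟩ := hh i hi
  obtain ⟨l, hl, hl'⟩ := hk j hj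
  exact ⟨l, hl, fun c => (hl' c).trans (hj' _)⟩

theorem Map.push {C : Ctx Γ T α} {D : Ctx Γ T β} {h : β → α} (hh : D.Map C h) {f : γ → List T}
    {g : β → γ} (hg : D.IsVar (fun b => f (g b))) : D.Map (C.push f) (fun b => (h b, g b)) := by
  intro i hi
  by_cases h' : i = C.arity
  · obtain ⟨j, hj, hj'⟩ := hg
    exact ⟨j, hj, fun b => (hj' b).trans (if_pos h').symm⟩
  · obtain ⟨j, hj, hj'⟩ := hh i (by have : i < C.arity + 1 := hi; omega)
    exact ⟨j, hj, fun b => (hj' b).trans (if_neg h').symm⟩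

end Ctx

/-- The predicate is decided in polynomial time by a program that works in any placement of the
variables, restores all registers, and returns the answer in the flag. -/
def PolyPred (C : Ctx Γ T α) (P : α → Prop) : Prop :=
  ∀ (ρ : ℕ → ℕ) (m : ℕ), C.Below ρ m → ∃ (c : Prog Γ T (Mem T)) (p : Polynomial ℕ),
    ∀ a e n b b', C.Holds ρ m n e a → (b' = true ↔ P a) → Does c b e b' e (p.eval n)

/-- The word-valued function is computed in polynomial time by a program that works in any placement
of the variables, and writes its result into the first free register. -/
def PolyFun (C : Ctx Γ T α) (f : α → List T) : Prop :=
  ∀ (ρ : ℕ → ℕ) (m : ℕ), C.Below ρ m → ∃ (c : Prog Γ T (Mem T)) (p : Polynomial ℕ),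
    ∀ a e n b, C.Holds ρ m n e a → (f a).length ≤ p.eval n ∧
      ∃ b', Does c b e b' (Function.update e m (f a)) (p.eval n)

section Closure

/-- The part of a word before the first occurrence of `x`. -/
def before [DecidableEq T] (x : T) (l : List T) : List T := l.takeWhile (· ≠ x)

/-- The part of a word behind the first occurrence of `x`. -/
def after [DecidableEq T] (x : T) (l : List T) : List T := (l.dropWhile (· ≠ x)).tail

theorem length_before_le [DecidableEq T] (x : T) (l : List T) :
    (before x l).length ≤ l.length :=
  (List.takeWhile_sublist _).length_le

theorem length_after_le [DecidableEq T] (x : T) (l : List T) :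
    (after x l).length ≤ l.length :=
  ((List.tail_sublist _).trans (List.dropWhile_sublist _)).length_le

variable {C : Ctx Γ T α} {D : Ctx Γ T β}

/-- Composing the placement for `D` with the reindexing places the variables of `C` in the same
registers. Nothing is copied, since programs exist for arbitrary placements, even ones that identify
variables. -/
theorem Ctx.Map.holds {h : β → α} (hh : D.Map C h) (ρ : ℕ → ℕ) (m : ℕ) (hρ : D.Below ρ m) :
    ∃ σ : ℕ → ℕ, C.Below σ m ∧ ∀ n e b, D.Holds ρ m n e b → C.Holds σ m n e (h b) := by
  choose! j hj hj' using hh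
  refine ⟨fun i => ρ (j i), fun i hi => hρ _ (hj i hi), fun n e b hb => ⟨?_, ?_, hb.free⟩⟩
  · intro i hi
    rw [hb.get_eq _ (hj i hi), hj' i hi]
  · intro i hi
    rw [← hj' i hi]
    exact hb.length_le _ (hj i hi)

theorem PolyPred.comap {P : α → Prop} {h : β → α} (hP : PolyPred C P) (hh : D.Map C h) :
    PolyPred D (fun b => P (h b)) := by
  intro ρ m hρ
  obtain ⟨σ, hσ, hσ'⟩ := hh.holds ρ m hρ
  obtain ⟨c, p, hc⟩ := hP σ m hσ
  exact ⟨c, p, fun a e n b b' ha hb' => hc _ e n b b' (hσ' n e a ha) hb'⟩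

theorem PolyFun.comap {f : α → List T} {h : β → α} (hf : PolyFun C f) (hh : D.Map C h) :
    PolyFun D (fun b => f (h b)) := by
  intro ρ m hρ
  obtain ⟨σ, hσ, hσ'⟩ := hh.holds ρ m hρ
  obtain ⟨c, p, hc⟩ := hf σ m hσ
  exact ⟨c, p, fun a e n b ha => hc _ e n b (hσ' n e a ha)⟩

theorem PolyFun.fst {g : α → List T} (hg : PolyFun C g) (f : β → List T) :
    PolyFun (C.push f) (fun p => g p.1) :=
  hg.comap (C.map_fst f)

theorem PolyPred.congr {P Q : α → Prop} (hP : PolyPred C P) (h : ∀ a, P a ↔ Q a) :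
    PolyPred C Q := by
  have : P = Q := funext fun a => propext (h a)
  exact this ▸ hP

theorem PolyFun.congr {f g : α → List T} (hf : PolyFun C f) (h : ∀ a, f a = g a) :
    PolyFun C g := by
  have : f = g := funext h
  exact this ▸ hf

theorem PolyPred.not {P : α → Prop} (hP : PolyPred C P) : PolyPred C (fun a => ¬ P a) := by
  intro ρ m hρ
  obtain ⟨c, p, hc⟩ := hP ρ m hρ
  refine ⟨c.seq (setFlag Bool.not), p + 1, fun a e n b b' ha hb' => ?_⟩
  have h := (hc a e n b (!b') ha (by cases b' <;> simp_all)).seq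
    (does_setFlag (Γ := Γ) Bool.not (!b') e)
  rw [Bool.not_not] at h
  simpa using h

theorem PolyPred.and {P Q : α → Prop} (hP : PolyPred C P) (hQ : PolyPred C Q) :
    PolyPred C (fun a => P a ∧ Q a) := by
  classical
  intro ρ m hρ
  obtain ⟨c, p, hc⟩ := hP ρ m hρ
  obtain ⟨d, q, hd⟩ := hQ ρ m hρ
  refine ⟨c.seq (ifFlag d skip), p + q + 2, fun a e n b b' ha hb' => ?_⟩
  have h1 := hc a e n b (decide (P a)) ha (by simp)
  by_cases h : P a
  · rw [decide_eq_true h] at h1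
    have h2 := hd a e n true b' ha (by simpa [h] using hb')
    exact (h1.seq h2.ifFlag_true).mono (by simp; omega)
  · rw [decide_eq_false h] at h1
    have hb : b' = false := by simpa [h] using hb'
    rw [hb]
    exact (h1.seq (does_skip false e).ifFlag_false).mono (by simp)

theorem PolyPred.or {P Q : α → Prop} (hP : PolyPred C P) (hQ : PolyPred C Q) :
    PolyPred C (fun a => P a ∨ Q a) :=
  (hP.not.and hQ.not).not.congr fun a => by tauto

theorem PolyPred.imp {P Q : α → Prop} (hP : PolyPred C P) (hQ : PolyPred C Q) :
    PolyPred C (fun a => P a → Q a) :=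
  (hP.and hQ.not).not.congr fun a => by tauto

variable [Inhabited T]

theorem Ctx.IsVar.polyFun {f : α → List T} (h : C.IsVar f) : PolyFun C f := by
  obtain ⟨j, hj, hf⟩ := h
  intro ρ m hρ
  refine ⟨copy (ρ j) m (m + 1), 13 * Polynomial.X + 8, fun a e n b ha => ?_⟩
  have h1 := ha.get_eq j hj
  have h2 := ha.length_le j hj
  rw [hf] at h1 h2
  have h3 := hρ j hj
  have h4 := does_copy (Γ := Γ) (b := b) (r := ρ j) (s := m) (h := m + 1) (by omega) (by omega)
    (by omega) e (ha.free _ le_rfl) (ha.free _ (by omega))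
  rw [h1] at h4
  refine ⟨?_, b, h4.mono ?_⟩ <;> simp <;> omega

theorem PolyFun.snd (C : Ctx Γ T α) (f : β → List T) : PolyFun (C.push f) (fun p => f p.2) :=
  (C.isVar_snd f).polyFun

theorem PolyFun.after [DecidableEq T] {f : α → List T} (hf : PolyFun C f) (x : T) :
    PolyFun C (fun a => after x (f a)) := by
  intro ρ m hρ
  obtain ⟨c, p, hc⟩ := hf ρ m hρ
  refine ⟨c.seq ((cut x m (m + 1) (m + 2)).seq (clear (m + 1))), 18 * p + 13,
    fun a e n b ha => ?_⟩
  obtain ⟨h1, b', h2⟩ := hc a e n b ha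
  have hl := length_after_le x (f a)
  have hl' := length_before_le x (f a)
  have h3 := does_cut (Γ := Γ) (b := b') x (r := m) (s := m + 1) (h := m + 2) (by omega) (by omega)
    (by omega) (Function.update e m (f a))
    (by rw [Function.update_of_ne (by omega), ha.free _ (by omega)])
    (by rw [Function.update_of_ne (by omega), ha.free _ (by omega)])
  have h4 := h2.seq (h3.seq (does_clear (Γ := Γ) (m + 1) _))
  have hm := ha.free (m + 1) (by omega)
  simp only [Function.update_self] at h4
  refine ⟨?_, b', h4.of_eq ?_ ?_⟩
  · simp; omega
  · funext k
    simp only [Function.update_apply]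
    split_ifs <;> simp_all [Prog.after]
  · change _ + (_ + (5 * (Prog.before x (f a)).length + 4)) ≤ _
    simp; omega

theorem PolyFun.before [DecidableEq T] {f : α → List T} (hf : PolyFun C f) (x : T) :
    PolyFun C (fun a => before x (f a)) := by
  intro ρ m hρ
  obtain ⟨c, p, hc⟩ := hf ρ m hρ
  -- The wanted part lands in `m + 1`; each move reverses it, so it returns to `m` by way of `m +
  -- 2`.
  refine ⟨c.seq ((cut x m (m + 1) (m + 2)).seq ((clear m).seq
    ((move (m + 1) (m + 2)).seq (move (m + 2) m)))), 30 * p + 21, fun a e n b ha => ?_⟩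
  obtain ⟨h1, b', h2⟩ := hc a e n b ha
  have hl := length_after_le x (f a)
  have hl' := length_before_le x (f a)
  have hm := ha.free (m + 1) (by omega)
  have hm' := ha.free (m + 2) (by omega)
  have h3 := does_cut (Γ := Γ) (b := b') x (r := m) (s := m + 1) (h := m + 2) (by omega) (by omega)
    (by omega) (Function.update e m (f a))
    (by rw [Function.update_of_ne (by omega), hm])
    (by rw [Function.update_of_ne (by omega), hm'])
  have h4 := h2.seq (h3.seq ((does_clear (Γ := Γ) m _).seq
    ((does_move (Γ := Γ) (r := m + 1) (s := m + 2) (by omega) _).seq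
    (does_move (Γ := Γ) (r := m + 2) (s := m) (by omega) _))))
  simp only [Function.update_apply, hm', if_true, left_eq_add, OfNat.ofNat_ne_zero, if_false,
    Nat.add_left_cancel_iff, OfNat.ofNat_ne_one, Nat.add_eq_left, one_ne_zero,
    List.append_nil, List.reverse_reverse, List.length_reverse] at h4
  refine ⟨?_, b', h4.of_eq ?_ ?_⟩
  · simp; omega
  · funext k
    simp only [Function.update_apply]
    split_ifs <;> simp_all [Prog.before]
  · change _ + (_ + (5 * (Prog.after x (f a)).length + 4 +
      (6 * (Prog.before x (f a)).length + 4 + (6 * (Prog.before x (f a)).length + 4)))) ≤ _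
    simp; omega

/-- Covers everything a two-state automaton checks in one pass: emptiness, occurrence of a symbol, a
final end marker, absence of markers. -/
theorem PolyPred.foldl {f : α → List T} (hf : PolyFun C f) (g : Bool → T → Bool) (b₀ : Bool) :
    PolyPred C (fun a => (f a).foldl g b₀ = true) := by
  intro ρ m hρ
  obtain ⟨c, p, hc⟩ := hf ρ m hρ
  refine ⟨c.seq ((setFlag fun _ => b₀).seq (scan m g)), 6 * p + 5, fun a e n b b' ha hb' => ?_⟩
  obtain ⟨h1, b₁, h2⟩ := hc a e n b ha
  have h3 := h2.seq ((does_setFlag (Γ := Γ) (fun _ => b₀) b₁ _).seq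
    (does_scan (Γ := Γ) m g b₀ (Function.update e m (f a))))
  simp only [Function.update_self, Function.update_idem] at h3
  rw [← Bool.eq_iff_iff] at hb'
  rw [hb']
  refine h3.of_eq ?_ ?_
  · rw [Function.update_eq_self_iff, ha.free m le_rfl]
  · simp; omega

theorem PolyPred.isEmpty {f : α → List T} (hf : PolyFun C f) : PolyPred C (fun a => f a = []) :=
  (PolyPred.foldl hf (fun _ _ => false) true).congr fun a => by
    rw [foldl_const_false]; simp

/-- The value of `f`, kept in register `m`, is treated as one more variable, so the program for `g`
works from `m + 1` on. Its words are now bounded by `n + p(n)`, whence `q.comp (X + p)`; the same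
composition recurs in all loops below. -/
theorem PolyPred.eq [DecidableEq T] {f g : α → List T} (hf : PolyFun C f) (hg : PolyFun C g) :
    PolyPred C (fun a => f a = g a) := by
  intro ρ m hρ
  obtain ⟨c, p, hc⟩ := hf ρ m hρ
  obtain ⟨d, q, hd⟩ := (hg.fst (id : List T → List T)) (Function.update ρ C.arity m) (m + 1)
    (hρ.push id (Nat.lt_succ_self m) (Nat.le_succ m))
  refine ⟨c.seq (d.seq (compare m (m + 1))),
    p + q.comp (Polynomial.X + p) + 11 * p + 5 * q.comp (Polynomial.X + p) + 13,
    fun a e n b b' ha hb' => ?_⟩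
  obtain ⟨h1, b₁, h2⟩ := hc a e n b ha
  obtain ⟨h3, b₂, h4⟩ := hd (a, f a) (Function.update e m (f a)) (n + p.eval n) b₁
    (ha.push hρ (fun s hs => Function.update_of_ne hs.ne _ _) (Function.update_self _ _ _)
      (by simp only [id]; omega) (by omega)
      (fun s hs => by rw [Function.update_of_ne (by omega), ha.free s (by omega)]))
  have h5 := h2.seq (h4.seq (does_compare (Γ := Γ) (r := m) (s := m + 1) (by omega) b₂ _))
  have hm := ha.free m le_rfl
  have hm' := ha.free (m + 1) (by omega)
  simp only [Function.update_self] at h5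
  rw [Function.update_of_ne (by omega : m ≠ m + 1), Function.update_self] at h5
  have hb : decide (f a = g a) = b' := by
    rw [Bool.eq_iff_iff, hb', decide_eq_true_iff]
  rw [hb] at h5
  refine h5.of_eq ?_ ?_
  · funext k
    simp only [Function.update_apply]
    split_ifs <;> simp_all
  · simp only at h3
    simp; omega

end Closure

end Prog

/-! ### Lists with end markers and quantifiers over their members -/

namespace Prog

variable {Γ T α β γ : Type}

/-- The encoding of a list whose items are encoded by `f` and followed by the marker `x`. -/
def sep (x : T) (f : β → List T) (l : List β) : List T := l.flatMap fun b => f b ++ [x]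

@[simp] theorem sep_nil (x : T) (f : β → List T) : sep x f [] = [] := rfl

@[simp] theorem sep_cons (x : T) (f : β → List T) (b : β) (l : List β) :
    sep x f (b :: l) = f b ++ x :: sep x f l := by
  simp [sep]

theorem before_append [DecidableEq T] {x : T} {l : List T} (h : x ∉ l) (k : List T) :
    before x (l ++ x :: k) = l := by
  unfold before
  rw [List.takeWhile_append_of_pos]
  · simp
  · intro y hy
    have : y ≠ x := fun h' => h (h' ▸ hy)
    simpa using this

theorem after_append [DecidableEq T] {x : T} {l : List T} (h : x ∉ l) (k : List T) :
    after x (l ++ x :: k) = k := by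
  unfold after
  rw [List.dropWhile_append_of_pos]
  · simp
  · intro y hy
    have : y ≠ x := fun h' => h (h' ▸ hy)
    simpa using this

theorem length_le_length_sep (x : T) (f : β → List T) (l : List β) :
    l.length ≤ (sep x f l).length := by
  induction l with
  | nil => simp
  | cons b l ih => simp; omega

theorem length_le_length_sep_of_mem (x : T) (f : β → List T) {l : List β} {b : β} (h : b ∈ l) :
    (f b).length ≤ (sep x f l).length := by
  induction l with
  | nil => simp at h
  | cons c l ih =>
    rcases List.mem_cons.1 h with rfl | h
    · simp
    · have := ih h
      simp; omega

theorem length_sep_le_of_sublist (x : T) (f : β → List T) {l k : List β} (h : l.Sublist k) :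
    (sep x f l).length ≤ (sep x f k).length :=
  (List.Sublist.flatMap h _).length_le

section

variable [Inhabited T] [DecidableEq T] {C : Ctx Γ T α}

/-- Since `x` does not occur in the code of an item, cutting at the first `x` removes exactly one
item. The loop cuts off items until one passes the test. During the test the item sits in `m + 1`
and the rest of the list in `m`, both as variables; access to the rest is what `PolyPred.nodup`
needs. -/
theorem PolyPred.exists_split {x : T} {f : β → List T} (hx : ∀ b, x ∉ f b) {l : α → List β}
    (hl : PolyFun C (fun a => sep x f (l a))) {P : α → List β → β → Prop}
    (hP : PolyPred ((C.push (sep x f)).push f) (fun p => P p.1.1 p.1.2 p.2)) :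
    PolyPred C (fun a => ∃ b t, (b :: t) <:+ l a ∧ P a t b) := by
  classical
  intro ρ m hρ
  obtain ⟨c, p, hc⟩ := hl ρ m hρ
  have hρ₁ : (C.push (sep x f)).Below (Function.update ρ C.arity m) (m + 1) :=
    hρ.push _ (Nat.lt_succ_self m) (Nat.le_succ m)
  obtain ⟨d, q, hd⟩ := hP _ (m + 2) (hρ₁.push f (Nat.lt_succ_self (m + 1)) (Nat.le_succ (m + 1)))
  set body : Prog Γ T (Mem T) := (cut x m (m + 1) (m + 2)).seq (d.seq (clear (m + 1))) with hbody
  refine ⟨c.seq ((setFlag fun _ => false).seq ((whileHead m (fun b _ => !b) body).seq (clear m))),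
    p + 1 + (p * (17 * p + q.comp (Polynomial.X + p) + 17) + 4) + (5 * p + 4),
    fun a e n b b' ha hb' => ?_⟩
  obtain ⟨h1, b₁, h2⟩ := hc a e n b ha
  -- Cost of one round: `12p + 9` for the cut, `q(n + p)` for the test, `5p + 4` for clearing the
  -- item, 4 for the loop.
  set B := 17 * p.eval n + q.eval (n + p.eval n) + 17 with hB
  -- The loop may stop early, so the remainder `w` of the list is left unspecified; it is cleared
  -- afterwards.
  have key : ∀ (k : List β) (e' : ℕ → List T), (sep x f k).length ≤ p.eval n →
      (∀ s, s ≠ m → e' s = e s) → e' m = sep x f k →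
      ∃ (b₂ : Bool) (w : List T), (b₂ = true ↔ ∃ b t, (b :: t) <:+ k ∧ P a t b) ∧
        w.length ≤ p.eval n ∧
        Does (whileHead m (fun b _ => !b) body) false e' b₂ (Function.update e' m w)
          (k.length * B + 4) := by
    intro k
    induction k with
    | nil =>
      intro e' _ _ hm
      refine ⟨false, [], by simp, by simp, ?_⟩
      have : Function.update e' m [] = e' := by rw [Function.update_eq_self_iff, hm]; rfl
      rw [this]
      exact (does_whileHead_stop (by simp [hm])).mono (by omega)
    | cons b₀ k ih =>
      intro e' hk he' hm
      have hf : (f b₀).length ≤ p.eval n :=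
        le_trans (length_le_length_sep_of_mem x f List.mem_cons_self) hk
      have hk' : (sep x f k).length ≤ p.eval n :=
        le_trans (length_sep_le_of_sublist x f (List.sublist_cons_self b₀ k)) hk
      have hm1 : e' (m + 1) = [] := by rw [he' _ (by omega), ha.free _ (by omega)]
      have hm2 : e' (m + 2) = [] := by rw [he' _ (by omega), ha.free _ (by omega)]
      have h3 := does_cut (Γ := Γ) (b := false) x (r := m) (s := m + 1) (h := m + 2) (by omega)
        (by omega) (by omega) e' hm1 hm2
      have hbef : (e' m).takeWhile (· ≠ x) = f b₀ := by
        rw [hm, sep_cons]; exact before_append (hx b₀) _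
      have haft : ((e' m).dropWhile (· ≠ x)).tail = sep x f k := by
        rw [hm, sep_cons]; exact after_append (hx b₀) _
      rw [hbef, haft] at h3
      set e₁ := Function.update (Function.update e' m (sep x f k)) (m + 1) (f b₀) with he₁
      have hh₁ : (C.push (sep x f)).Holds (Function.update ρ C.arity m) (m + 1) (n + p.eval n)
          (Function.update e' m (sep x f k)) (a, k) :=
        ha.push hρ (fun s hs => by rw [Function.update_of_ne hs.ne, he' _ hs.ne])
          (Function.update_self _ _ _) (by omega) (by omega)
          (fun s hs => by rw [Function.update_of_ne (by omega), he' _ (by omega),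
            ha.free s (by omega)])
      have hh₂ := hh₁.push hρ₁ (f := f) (b := b₀) (e' := e₁) (r := m + 1) (m' := m + 2)
        (n' := n + p.eval n)
        (fun s hs => Function.update_of_ne hs.ne _ _) (Function.update_self _ _ _) (by omega) le_rfl
        (fun s hs => by rw [he₁, Function.update_of_ne (by omega), Function.update_of_ne (by omega),
          he' _ (by omega), ha.free s (by omega)])
      have h4 := hd ((a, k), b₀) e₁ (n + p.eval n) false (decide (P a k b₀)) hh₂ (by simp)
      have h5 := h3.seq (h4.seq (does_clear (Γ := Γ) (m + 1) e₁))
      have he₂ : Function.update e₁ (m + 1) [] = Function.update e' m (sep x f k) := by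
        funext s
        simp only [he₁, Function.update_apply]
        split_ifs <;> simp_all
      have he₁' : e₁ (m + 1) = f b₀ := Function.update_self _ _ _
      rw [he₂, he₁'] at h5
      have hlen : (e' m).length ≤ p.eval n := by rw [hm]; exact hk
      have hhead : ∃ y, (e' m).head? = some y := by
        rw [hm, sep_cons]
        rcases f b₀ with _ | ⟨y, l⟩ <;> simp
      obtain ⟨y, hy⟩ := hhead
      by_cases hPb : P a k b₀
      · rw [decide_eq_true hPb] at h5
        refine ⟨true, sep x f k, ?_, hk', ?_⟩
        · simp only [true_iff]
          exact ⟨b₀, k, List.suffix_rfl, hPb⟩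
        · refine (h5.whileHead_step (g := fun b _ => !b) hy rfl
            (does_whileHead_stop (by simp))).mono ?_
          simp only [List.length_cons, Nat.add_mul, one_mul, hB]
          omega
      · rw [decide_eq_false hPb] at h5
        obtain ⟨b₂, w, hb₂, hw, hdo⟩ := ih (Function.update e' m (sep x f k)) hk'
          (fun s hs => by rw [Function.update_of_ne hs, he' s hs]) (Function.update_self _ _ _)
        refine ⟨b₂, w, ?_, hw, ?_⟩
        · rw [hb₂]
          constructor
          · rintro ⟨b, t, hs, hp⟩
            exact ⟨b, t, hs.trans (List.suffix_cons _ _), hp⟩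
          · rintro ⟨b, t, hs, hp⟩
            rcases List.suffix_cons_iff.1 hs with hs | hs
            · obtain ⟨rfl, rfl⟩ := List.cons.inj hs
              exact absurd hp hPb
            · exact ⟨b, t, hs, hp⟩
        · rw [Function.update_idem] at hdo
          refine (h5.whileHead_step (g := fun b _ => !b) hy rfl hdo).mono ?_
          simp only [List.length_cons, Nat.add_mul, one_mul, hB]
          omega
  obtain ⟨b₂, w, hb₂, hw, hdo⟩ := key (l a) (Function.update e m (sep x f (l a))) h1
    (fun s hs => Function.update_of_ne hs _ _) (Function.update_self _ _ _)
  have hbb : b₂ = b' := by rw [Bool.eq_iff_iff, hb₂, hb']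
  rw [hbb, Function.update_idem] at hdo
  have h6 := h2.seq ((does_setFlag (Γ := Γ) (fun _ => false) b₁ _).seq (hdo.seq
    (does_clear (Γ := Γ) m _)))
  rw [Function.update_self, Function.update_idem] at h6
  refine h6.of_eq ?_ ?_
  · rw [Function.update_eq_self_iff, ha.free m le_rfl]
  · have hlen : (l a).length * B ≤ p.eval n * B :=
      Nat.mul_le_mul_right _ ((length_le_length_sep x f (l a)).trans h1)
    simp only [Polynomial.eval_add, Polynomial.eval_mul, Polynomial.eval_comp, Polynomial.eval_X,
      Polynomial.eval_one, Polynomial.eval_ofNat, ← hB]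
    omega

theorem PolyPred.exists_mem {x : T} {f : β → List T} (hx : ∀ b, x ∉ f b) {l : α → List β}
    (hl : PolyFun C (fun a => sep x f (l a))) {P : α → β → Prop}
    (hP : PolyPred (C.push f) (fun p => P p.1 p.2)) :
    PolyPred C (fun a => ∃ b ∈ l a, P a b) := by
  have h := hP.comap (((C.push (sep x f)).map_fst f).comp (C.map_fst (sep x f)) |>.push
    ((C.push (sep x f)).isVar_snd f))
  refine (PolyPred.exists_split hx hl (P := fun a _ b => P a b) h).congr fun a => ?_
  constructor
  · rintro ⟨b, t, hs, hp⟩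
    exact ⟨b, hs.subset List.mem_cons_self, hp⟩
  · rintro ⟨b, hb, hp⟩
    obtain ⟨s, t, ht⟩ := List.append_of_mem hb
    exact ⟨b, t, ⟨s, ht.symm⟩, hp⟩

theorem PolyPred.forall_mem {x : T} {f : β → List T} (hx : ∀ b, x ∉ f b) {l : α → List β}
    (hl : PolyFun C (fun a => sep x f (l a))) {P : α → β → Prop}
    (hP : PolyPred (C.push f) (fun p => P p.1 p.2)) :
    PolyPred C (fun a => ∀ b ∈ l a, P a b) :=
  (PolyPred.exists_mem hx hl (P := fun a b => ¬ P a b) hP.not).not.congr fun _ => by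
    push Not; rfl

theorem PolyPred.mem {x : T} {f : β → List T} (hx : ∀ b, x ∉ f b) (hf : Function.Injective f)
    {l : α → List β} (hl : PolyFun C (fun a => sep x f (l a))) {g : α → β}
    (hg : PolyFun C (fun a => f (g a))) : PolyPred C (fun a => g a ∈ l a) :=
  (PolyPred.exists_mem hx hl (P := fun a b => f b = f (g a))
    (PolyPred.eq (PolyFun.snd C f) (hg.fst f))).congr fun _ =>
      ⟨fun ⟨_, hb, h⟩ => hf h ▸ hb, fun h => ⟨_, h, rfl⟩⟩

/-- A repetition is an item that occurs again in the part of the list behind it. -/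
theorem PolyPred.nodup {x : T} {f : β → List T} (hx : ∀ b, x ∉ f b) (hf : Function.Injective f)
    {l : α → List β} (hl : PolyFun C (fun a => sep x f (l a))) :
    PolyPred C (fun a => (l a).Nodup) := by
  refine (PolyPred.exists_split hx hl (P := fun _ t b => b ∈ t)
    (PolyPred.mem hx hf ((PolyFun.snd C (sep x f)).fst f) (PolyFun.snd _ f))).not.congr fun a => ?_
  generalize l a = l
  induction l with
  | nil => simp
  | cons b l ih =>
    rw [List.nodup_cons, ← ih]
    constructor
    · intro h
      exact ⟨fun hb => h ⟨b, l, List.suffix_rfl, hb⟩,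
        fun ⟨c, t, hs, hc⟩ => h ⟨c, t, hs.trans (List.suffix_cons _ _), hc⟩⟩
    · rintro ⟨h1, h2⟩ ⟨c, t, hs, hc⟩
      rcases List.suffix_cons_iff.1 hs with hs | hs
      · obtain ⟨rfl, rfl⟩ := List.cons.inj hs
        exact h1 hc
      · exact h2 ⟨c, t, hs, hc⟩

end

end Prog

/-! ### Bounded iteration and filtering -/

namespace Prog

variable {Γ T α β γ : Type} [Inhabited T] {C : Ctx Γ T α}

/-- Iterate a function as often as a word is long, if this word bounds the size of the results. -/
theorem PolyFun.iterate {f : α → List T} (hf : PolyFun C f) {u : β → List T} {g : α → β → β}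
    (hg : PolyFun (C.push u) (fun p => u (g p.1 p.2))) {z : β} (hz : u z = [])
    (hle : ∀ a k, (u ((g a)^[k] z)).length ≤ (f a).length) :
    PolyFun C (fun a => u ((g a)^[(f a).length] z)) := by
  intro ρ m hρ
  obtain ⟨c, p, hc⟩ := hf ρ m hρ
  obtain ⟨d, q, hd⟩ := hg (Function.update ρ C.arity (m + 1)) (m + 2)
    (hρ.push u (by omega) (by omega))
  -- Register `m` is a unary counter and `m + 1` holds the current value. The new value appears in
  -- `m + 2` and replaces the old one after two order-reversing moves.
  set body : Prog Γ T (Mem T) := (popDrop m).seq (d.seq ((clear (m + 1)).seq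
    ((move (m + 2) (m + 3)).seq (move (m + 3) (m + 1))))) with hbody
  refine ⟨c.seq ((whileHead m (fun _ _ => true) body).seq ((move (m + 1) (m + 2)).seq
      (move (m + 2) m))),
    p + (p * (17 * p + q.comp (Polynomial.X + p) + 17) + 4) + (12 * p + 8),
    fun a e n b ha => ?_⟩
  obtain ⟨h1, b₁, h2⟩ := hc a e n b ha
  set B := 17 * p.eval n + q.eval (n + p.eval n) + 17 with hB
  have key : ∀ (w : List T) (k : ℕ) (b : Bool) (e' : ℕ → List T),
      (∀ s, s ≠ m → s ≠ m + 1 → e' s = e s) → e' m = w → e' (m + 1) = u ((g a)^[k] z) →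
      ∃ b₂ : Bool, Does (whileHead m (fun _ _ => true) body) b e' b₂
        (Function.update (Function.update e' m []) (m + 1) (u ((g a)^[w.length + k] z)))
          (w.length * B + 4) := by
    intro w
    induction w with
    | nil =>
      intro k b e' _ hm hm1
      refine ⟨b, (does_whileHead_stop (by simp [hm])).of_eq ?_ (by omega)⟩
      funext s
      simp only [Function.update_apply]
      split_ifs <;> simp_all
    | cons y w ih =>
      intro k b e' he' hm hm1
      have hm2 : e' (m + 2) = [] := by rw [he' _ (by omega) (by omega), ha.free _ (by omega)]
      have hm3 : e' (m + 3) = [] := by rw [he' _ (by omega) (by omega), ha.free _ (by omega)]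
      have h3 := does_absorb (Γ := Γ) m (fun b _ => b) b e'
      have hw : (e' m).tail = w := by rw [hm]; rfl
      rw [hw] at h3
      have hlk := (hle a k).trans h1
      have hlk' := (hle a (k + 1)).trans h1
      obtain ⟨-, b₃, h4⟩ := hd (a, (g a)^[k] z) (Function.update e' m w) (n + p.eval n) b
        (ha.push hρ (fun s hs => by rw [Function.update_of_ne hs.ne, he' _ hs.ne (by omega)])
          (by rw [Function.update_of_ne (by omega), hm1]) (by omega) (by omega)
          (fun s hs => by rw [Function.update_of_ne (by omega), he' _ (by omega) (by omega),
            ha.free s (by omega)]))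
      simp only [← Function.iterate_succ_apply' (g a) k z] at h4
      have h5 := h3.seq (h4.seq ((does_clear (Γ := Γ) (m + 1) _).seq
        ((does_move (Γ := Γ) (r := m + 2) (s := m + 3) (by omega) _).seq
          (does_move (Γ := Γ) (r := m + 3) (s := m + 1) (by omega) _))))
      simp only [Function.update_apply, hm1, hm3, if_true, OfNat.ofNat_ne_zero,
        if_false, Nat.add_left_cancel_iff, OfNat.ofNat_ne_one, Nat.add_eq_left,
        OfNat.one_ne_ofNat, List.append_nil, List.reverse_reverse, List.length_reverse,
        Nat.succ_ne_self] at h5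
      obtain ⟨b₂, hdo⟩ := ih (k + 1) b₃
        (Function.update (Function.update e' m w) (m + 1) (u ((g a)^[k + 1] z)))
        (fun s hs hs' => by
          rw [Function.update_of_ne hs', Function.update_of_ne hs, he' s hs hs'])
        (by rw [Function.update_of_ne (by omega), Function.update_self])
        (Function.update_self _ _ _)
      refine ⟨b₂, (Does.whileHead_step (g := fun _ _ => true) (x := y) (by rw [hm]; rfl) rfl
        (h5.of_eq (N := B - 4) ?_ ?_) hdo).of_eq ?_ ?_⟩
      · funext s
        simp only [Function.update_apply]
        split_ifs <;> simp_all
      · simp only [Nat.succ_eq_add_one]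
        omega
      · have : w.length + (k + 1) = (y :: w).length + k := by simp; omega
        rw [this]
        funext s
        simp only [Function.update_apply]
        split_ifs <;> simp_all
      · simp only [List.length_cons, Nat.add_mul, one_mul]
        omega
  -- No initialization is needed: `m + 1` is free, hence empty, and the start value is encoded by
  -- the empty word.
  obtain ⟨b₂, hdo⟩ := key (f a) 0 b₁ (Function.update e m (f a))
    (fun s hs _ => Function.update_of_ne hs _ _) (Function.update_self _ _ _)
    (by rw [Function.update_of_ne (by omega), ha.free _ (by omega)]; exact hz.symm)
  have h6 := h2.seq (hdo.seq ((does_move (Γ := Γ) (r := m + 1) (s := m + 2) (by omega) _).seq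
    (does_move (Γ := Γ) (r := m + 2) (s := m) (by omega) _)))
  have hlf := (hle a (f a).length).trans h1
  have hm1 := ha.free (m + 1) (by omega)
  have hm2 := ha.free (m + 2) (by omega)
  simp only [Function.update_apply, hm1, hm2, if_true, left_eq_add, OfNat.ofNat_ne_zero,
    if_false, Nat.add_eq_left, one_ne_zero,
    List.append_nil, List.reverse_reverse, List.length_reverse,
    Nat.succ_ne_self, add_zero] at h6
  refine ⟨?_, b₂, h6.of_eq ?_ ?_⟩
  · simp; omega
  · funext s
    simp only [Function.update_apply]
    split_ifs <;> simp_all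
  · have hlen : (f a).length * B ≤ p.eval n * B := Nat.mul_le_mul_right _ h1
    simp only [Polynomial.eval_add, Polynomial.eval_mul, Polynomial.eval_comp, Polynomial.eval_X,
      Polynomial.eval_ofNat, ← hB]
    omega

variable [DecidableEq T]

-- Items that pass the test are stacked in `m + 1`, which reverses their concatenated code; the
-- final move to `m` restores the order.
open scoped Classical in
theorem PolyFun.filter {x : T} {f : β → List T} (hx : ∀ b, x ∉ f b) {l : α → List β}
    (hl : PolyFun C (fun a => sep x f (l a))) {P : α → β → Prop}
    (hP : PolyPred (C.push f) (fun p => P p.1 p.2)) :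
    PolyFun C (fun a => sep x f ((l a).filter fun b => decide (P a b))) := by
  intro ρ m hρ
  obtain ⟨c, p, hc⟩ := hl ρ m hρ
  obtain ⟨d, q, hd⟩ := hP (Function.update ρ C.arity (m + 2)) (m + 3)
    (hρ.push f (by omega) (by omega))
  set body : Prog Γ T (Mem T) := (cut x m (m + 2) (m + 3)).seq (d.seq
    (ifFlag ((move (m + 2) (m + 1)).seq (pushConst (m + 1) x)) (clear (m + 2)))) with hbody
  refine ⟨c.seq ((whileHead m (fun _ _ => true) body).seq (move (m + 1) m)),
    p + (p * (18 * p + q.comp (Polynomial.X + p) + 20) + 4) + (6 * p + 4),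
    fun a e n b ha => ?_⟩
  obtain ⟨h1, b₁, h2⟩ := hc a e n b ha
  set B := 18 * p.eval n + q.eval (n + p.eval n) + 20 with hB
  have key : ∀ (k : List β) (b : Bool) (e' : ℕ → List T), (sep x f k).length ≤ p.eval n →
      (∀ s, s ≠ m → s ≠ m + 1 → e' s = e s) → e' m = sep x f k →
      ∃ b₂ : Bool, Does (whileHead m (fun _ _ => true) body) b e' b₂
        (Function.update (Function.update e' m []) (m + 1)
          ((sep x f (k.filter fun b => decide (P a b))).reverse ++ e' (m + 1)))
          (k.length * B + 4) := by
    intro k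
    induction k with
    | nil =>
      intro b e' _ _ hm
      refine ⟨b, (does_whileHead_stop (by simp [hm])).of_eq ?_ (by omega)⟩
      funext s
      simp only [Function.update_apply]
      split_ifs <;> simp_all
    | cons b₀ k ih =>
      intro b e' hk he' hm
      have hf : (f b₀).length ≤ p.eval n :=
        le_trans (length_le_length_sep_of_mem x f List.mem_cons_self) hk
      have hk' : (sep x f k).length ≤ p.eval n :=
        le_trans (length_sep_le_of_sublist x f (List.sublist_cons_self b₀ k)) hk
      have hm2 : e' (m + 2) = [] := by rw [he' _ (by omega) (by omega), ha.free _ (by omega)]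
      have hm3 : e' (m + 3) = [] := by rw [he' _ (by omega) (by omega), ha.free _ (by omega)]
      have h3 := does_cut (Γ := Γ) (b := b) x (r := m) (s := m + 2) (h := m + 3) (by omega)
        (by omega) (by omega) e' hm2 hm3
      have hbef : (e' m).takeWhile (· ≠ x) = f b₀ := by
        rw [hm, sep_cons]; exact before_append (hx b₀) _
      have haft : ((e' m).dropWhile (· ≠ x)).tail = sep x f k := by
        rw [hm, sep_cons]; exact after_append (hx b₀) _
      rw [hbef, haft] at h3
      set e₁ := Function.update (Function.update e' m (sep x f k)) (m + 2) (f b₀) with he₁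
      have hh₂ : (C.push f).Holds (Function.update ρ C.arity (m + 2)) (m + 3) (n + p.eval n)
          e₁ (a, b₀) :=
        ha.push hρ (fun s hs => by rw [he₁, Function.update_of_ne (by omega),
            Function.update_of_ne hs.ne, he' _ hs.ne (by omega)])
          (Function.update_self _ _ _) (by omega) (by omega)
          (fun s hs => by rw [he₁, Function.update_of_ne (by omega),
            Function.update_of_ne (by omega), he' _ (by omega) (by omega), ha.free s (by omega)])
      have h4 := hd (a, b₀) e₁ (n + p.eval n) b (decide (P a b₀)) hh₂ (by simp)
      have hlen : (e' m).length ≤ p.eval n := by rw [hm]; exact hk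
      have hhead : ∃ y, (e' m).head? = some y := by
        rw [hm, sep_cons]
        rcases f b₀ with _ | ⟨y, l⟩ <;> simp
      obtain ⟨y, hy⟩ := hhead
      have he₁2 : e₁ (m + 2) = f b₀ := Function.update_self _ _ _
      have he₁1 : e₁ (m + 1) = e' (m + 1) := by
        rw [he₁, Function.update_of_ne (by omega), Function.update_of_ne (by omega)]
      by_cases hPb : P a b₀
      · rw [decide_eq_true hPb] at h4
        have h5 := h3.seq (h4.seq ((((does_move (Γ := Γ) (b := true) (r := m + 2) (s := m + 1)
          (by omega) e₁).seq (does_pushConst (m + 1) x true _)).ifFlag_true (d := clear (m + 2)))))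
        rw [Function.update_idem, Function.update_self, he₁1, he₁2] at h5
        obtain ⟨b₂, hdo⟩ := ih true (Function.update (Function.update e₁ (m + 2) []) (m + 1)
          (x :: ((f b₀).reverse ++ e' (m + 1)))) hk'
          (fun s hs hs' => by
            rw [Function.update_of_ne hs']
            by_cases hs2 : s = m + 2
            · rw [hs2, Function.update_self, ha.free _ (by omega)]
            · rw [Function.update_of_ne hs2, he₁, Function.update_of_ne hs2,
                Function.update_of_ne hs, he' s hs hs'])
          (by rw [Function.update_of_ne (by omega), Function.update_of_ne (by omega), he₁,
            Function.update_of_ne (by omega), Function.update_self])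
        refine ⟨b₂, (h5.whileHead_step (g := fun _ _ => true) hy rfl hdo).of_eq ?_ ?_⟩
        · rw [List.filter_cons_of_pos (by simpa using hPb), sep_cons]
          funext s
          simp only [he₁, Function.update_apply]
          split_ifs <;> simp_all
        · simp only [List.length_cons, Nat.add_mul, one_mul, hB]
          omega
      · rw [decide_eq_false hPb] at h4
        have h5 := h3.seq (h4.seq ((does_clear (Γ := Γ) (b := false) (m + 2) e₁).ifFlag_false
          (c := (move (m + 2) (m + 1)).seq (pushConst (m + 1) x))))
        rw [he₁2] at h5
        obtain ⟨b₂, hdo⟩ := ih false (Function.update e₁ (m + 2) []) hk'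
          (fun s hs hs' => by
            by_cases hs2 : s = m + 2
            · rw [hs2, Function.update_self, ha.free _ (by omega)]
            · rw [Function.update_of_ne hs2, he₁, Function.update_of_ne hs2,
                Function.update_of_ne hs, he' s hs hs'])
          (by rw [Function.update_of_ne (by omega), he₁,
            Function.update_of_ne (by omega), Function.update_self])
        refine ⟨b₂, (h5.whileHead_step (g := fun _ _ => true) hy rfl hdo).of_eq ?_ ?_⟩
        · rw [List.filter_cons_of_neg (by simpa using hPb)]
          funext s
          simp only [he₁, Function.update_apply]
          grind
        · simp only [List.length_cons, Nat.add_mul, one_mul, hB]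
          omega
  obtain ⟨b₂, hdo⟩ := key (l a) b₁ (Function.update e m (sep x f (l a))) h1
    (fun s hs _ => Function.update_of_ne hs _ _) (Function.update_self _ _ _)
  have h6 := h2.seq (hdo.seq (does_move (Γ := Γ) (r := m + 1) (s := m) (by omega) _))
  have hle : (sep x f ((l a).filter fun b => decide (P a b))).length ≤ p.eval n :=
    (length_sep_le_of_sublist x f List.filter_sublist).trans h1
  have hm1 := ha.free (m + 1) (by omega)
  rw [Function.update_self, Function.update_of_ne (by omega : m + 1 ≠ m), hm1,
    List.append_nil, List.reverse_reverse, List.length_reverse] at h6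
  refine ⟨?_, b₂, h6.of_eq ?_ ?_⟩
  · simp; omega
  · funext s
    simp only [Function.update_apply]
    grind
  · have hlen : (l a).length * B ≤ p.eval n * B :=
      Nat.mul_le_mul_right _ ((length_le_length_sep x f (l a)).trans h1)
    simp only [Polynomial.eval_add, Polynomial.eval_mul, Polynomial.eval_comp, Polynomial.eval_X,
      Polynomial.eval_ofNat, ← hB]
    omega

end Prog

/-! ### Reachability by saturation -/

namespace Prog

variable {Γ T α β : Type}

section Saturation

variable (l : List β) (I : β → Prop) (R : β → β → Prop)

open scoped Classical in
/-- One step in the computation of the members of `l` that are reachable from `I` by `R`. -/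
noncomputable def reachStep (X : List β) : List β :=
  l.filter fun b => decide (I b ∨ ∃ b' ∈ X, R b' b)

theorem mem_reachStep {X : List β} {b : β} :
    b ∈ reachStep l I R X ↔ b ∈ l ∧ (I b ∨ ∃ b' ∈ X, R b' b) := by
  simp [reachStep]

theorem reachStep_sublist (X : List β) : (reachStep l I R X).Sublist l := List.filter_sublist

theorem iterate_reachStep_sublist (k : ℕ) : ((reachStep l I R)^[k] []).Sublist l := by
  cases k with
  | zero => exact List.nil_sublist l
  | succ k => rw [Function.iterate_succ_apply']; exact reachStep_sublist l I R _

/-- `reachStep` is monotone in `X` and the iteration starts from the empty list. All iterates filter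
the same list `l`, so the inclusion is one of sublists. -/
theorem iterate_reachStep_mono (k : ℕ) :
    ((reachStep l I R)^[k] []).Sublist ((reachStep l I R)^[k + 1] []) := by
  induction k with
  | zero => exact List.nil_sublist _
  | succ k ih =>
    rw [Function.iterate_succ_apply' _ k, Function.iterate_succ_apply' _ (k + 1)]
    refine List.monotone_filter_right _ fun b hb => ?_
    simp only [decide_eq_true_eq] at hb ⊢
    exact hb.imp_right fun ⟨b', h, h'⟩ => ⟨b', ih.subset h, h'⟩

/-- An increasing chain of sublists either has become stationary or gains an item at each step. In
the second case, after `l.length` steps it is all of `l` and cannot grow any more. -/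
theorem iterate_reachStep_fixed {k : ℕ} (hk : l.length ≤ k) :
    reachStep l I R ((reachStep l I R)^[k] []) = (reachStep l I R)^[k] [] := by
  have key : ∀ j, reachStep l I R ((reachStep l I R)^[j] []) = (reachStep l I R)^[j] [] ∨
      j ≤ ((reachStep l I R)^[j] []).length := by
    intro j
    induction j with
    | zero => exact Or.inr (Nat.zero_le _)
    | succ j ih =>
      rcases ih with ih | ih
      · left
        rw [Function.iterate_succ_apply', ih, ih]
      · have hs := iterate_reachStep_mono l I R j
        by_cases h : (reachStep l I R)^[j] [] = (reachStep l I R)^[j + 1] []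
        · left
          rw [← h, ← Function.iterate_succ_apply' (reachStep l I R) j, ← h]
        · right
          have h1 := hs.length_le
          have h2 : ((reachStep l I R)^[j] []).length ≠ ((reachStep l I R)^[j + 1] []).length :=
            fun h' => h (hs.eq_of_length h')
          omega
  rcases key k with h | h
  · exact h
  · have h1 := (iterate_reachStep_sublist l I R k).eq_of_length_le (hk.trans h)
    have h2 := (iterate_reachStep_mono l I R k)
    rw [Function.iterate_succ_apply', h1] at h2
    rw [h1]
    exact ((reachStep_sublist l I R l).antisymm h2)

/-- Each iterate contains only reachable items. Conversely, a fixed point contains the initial items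
of `l` and is closed under `R`-steps inside `l`. -/
theorem mem_iterate_reachStep {k : ℕ} (hk : l.length ≤ k) (b : β) :
    b ∈ (reachStep l I R)^[k] [] ↔ ∃ b₀ ∈ l, I b₀ ∧
      Relation.ReflTransGen (fun c d => R c d ∧ d ∈ l) b₀ b := by
  constructor
  · clear hk
    intro h
    induction k generalizing b with
    | zero => simp at h
    | succ k ih =>
      rw [Function.iterate_succ_apply', mem_reachStep] at h
      obtain ⟨hb, h | ⟨b', hb', h⟩⟩ := h
      · exact ⟨b, hb, h, .refl⟩
      · obtain ⟨b₀, h0, hI, hr⟩ := ih b' hb'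
        exact ⟨b₀, h0, hI, hr.tail ⟨h, hb⟩⟩
  · rintro ⟨b₀, h0, hI, hr⟩
    have hfix := iterate_reachStep_fixed l I R hk
    induction hr with
    | refl => rw [← hfix, mem_reachStep]; exact ⟨h0, Or.inl hI⟩
    | tail _ h ih => rw [← hfix, mem_reachStep]; exact ⟨h.2, Or.inr ⟨_, ih, h.1⟩⟩

end Saturation

variable [Inhabited T] [DecidableEq T] {C : Ctx Γ T α}

/-- Reachability among the members of a list is decidable in polynomial time. -/
theorem PolyPred.reach {x : T} {f : β → List T} (hx : ∀ b, x ∉ f b) {l : α → List β}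
    (hl : PolyFun C (fun a => sep x f (l a))) {I F : α → β → Prop} {R : α → β → β → Prop}
    (hI : PolyPred (C.push f) (fun p => I p.1 p.2)) (hF : PolyPred (C.push f) (fun p => F p.1 p.2))
    (hR : PolyPred ((C.push f).push f) (fun p => R p.1.1 p.1.2 p.2)) :
    PolyPred C (fun a => ∃ b b₀, F a b ∧ b₀ ∈ l a ∧ I a b₀ ∧
      Relation.ReflTransGen (fun c d => R a c d ∧ d ∈ l a) b₀ b) := by
  have hI' := hI.comap (((C.push (sep x f)).map_fst f).comp (C.map_fst (sep x f)) |>.push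
    ((C.push (sep x f)).isVar_snd f))
  have hR' := hR.comap ((((((C.push (sep x f)).push f).map_fst f).comp
    (((C.push (sep x f)).map_fst f).comp (C.map_fst (sep x f)))).push
    (((C.push (sep x f)).push f).isVar_snd f)).push
    (((C.push (sep x f)).isVar_snd f).fst f))
  have hstep : PolyFun (C.push (sep x f))
      (fun p => sep x f (reachStep (l p.1) (I p.1) (R p.1) p.2)) :=
    (PolyFun.filter hx (hl.fst _) (P := fun p b => I p.1 b ∨ ∃ b' ∈ p.2, R p.1 b' b)
      (hI'.or (PolyPred.exists_mem hx ((PolyFun.snd C (sep x f)).fst f)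
        (P := fun q b' => R q.1.1 b' q.2) hR'))).congr fun p => by
          unfold reachStep; congr!
  -- The code of `l` plays both roles required of the counter: it is at least as long as `l` has
  -- items, and every iterate, being a sublist, has a code no longer than it.
  have hiter := PolyFun.iterate hl (u := sep x f)
    (g := fun a X => reachStep (l a) (I a) (R a) X) (z := []) hstep rfl
    (fun a k => length_sep_le_of_sublist x f (iterate_reachStep_sublist _ _ _ k))
  refine (PolyPred.exists_mem hx hiter hF).congr fun a => ?_
  constructor
  · rintro ⟨b, hb, hf⟩
    obtain ⟨b₀, h⟩ := (mem_iterate_reachStep _ _ _ (length_le_length_sep x f (l a)) b).1 hb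
    exact ⟨b, b₀, hf, h⟩
  · rintro ⟨b, b₀, hf, h⟩
    exact ⟨b, (mem_iterate_reachStep _ _ _ (length_le_length_sep x f (l a)) b).2 ⟨b₀, h⟩, hf⟩

end Prog

/-! ### Reading the input of a pair language -/

namespace Prog

variable {T : Type}

/-- The context with a single word. -/
def wordCtx (Γ T : Type) : Ctx Γ T (List T) := ⟨1, fun w _ => w⟩

/-- The context with two words. -/
def pairCtx (Γ T : Type) : Ctx Γ T (List T × List T) := (wordCtx Γ T).push id

/-- The effect of an input symbol on the memory. The auxiliary bit records whether a symbol of the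
second alphabet has occurred; the flag is erased if it is followed by a symbol of the first one. -/
def readStep (v : Mem T) : Option (T ⊕ T) → Mem T
  | none => (v.1, none, v.2.2)
  | some (.inl t) => (v.1 && !v.2.2, some t, v.2.2)
  | some (.inr t) => (v.1, some t, true)

/-- Read an input symbol. -/
def readSymbol : Prog (T ⊕ T) T (Mem T) := .read readStep

/-- Distribute the input among the first two registers. -/
def readInput [Inhabited T] : Prog (T ⊕ T) T (Mem T) :=
  readSymbol.seq (.loop (fun v => v.2.1.isSome)
    ((Prog.ite (fun v => v.2.2) (pushCur 1) (pushCur 0)).seq readSymbol))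

/-- The effect of `readInput` on the flag, the auxiliary bit and the first two registers. -/
def splitInput : List (T ⊕ T) → Bool → Bool → List T → List T → Bool × List T × List T
  | [], b, _, l, r => (b, l, r)
  | .inl t :: w, _, true, l, r => splitInput w false true l (t :: r)
  | .inl t :: w, b, false, l, r => splitInput w b false (t :: l) r
  | .inr t :: w, b, _, l, r => splitInput w b true l (t :: r)

theorem splitInput_inr (y : List T) (b c : Bool) (l r : List T) :
    splitInput (y.map Sum.inr) b c l r = (b, l, y.reverse ++ r) := by
  induction y generalizing c r with
  | nil => rfl
  | cons t y ih => simp [splitInput, ih]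

theorem splitInput_pair (x y : List T) (b : Bool) (l r : List T) :
    splitInput (x.map Sum.inl ++ y.map Sum.inr) b false l r = (b, x.reverse ++ l, y.reverse ++ r) := by
  induction x generalizing l with
  | nil => exact splitInput_inr y b false l r
  | cons t x ih => simp [splitInput, ih]

/-- Once the auxiliary bit is set, a symbol of the first alphabet erases the flag for good, so a
surviving flag certifies the shape "first alphabet, then second". The hypothesis `hc` is the
invariant that the second register stays empty until that bit is set. -/
theorem eq_of_splitInput (w : List (T ⊕ T)) (b c : Bool) (l r : List T)
    (hc : c = false → r = []) (h : (splitInput w b c l r).1 = true) :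
    b = true ∧ ∃ x y : List T, l.reverse.map Sum.inl ++ r.reverse.map Sum.inr ++ w =
      x.map Sum.inl ++ y.map Sum.inr := by
  induction w generalizing b c l r with
  | nil => exact ⟨h, l.reverse, r.reverse, by simp⟩
  | cons t w ih =>
    rcases t with t | t
    · cases c with
      | true => exact absurd (ih false true l (t :: r) (by simp) h).1 (by simp)
      | false =>
        obtain ⟨hb, x, y, hxy⟩ := ih b false (t :: l) r hc h
        refine ⟨hb, x, y, ?_⟩
        rw [← hxy, hc rfl]
        simp
    · obtain ⟨hb, x, y, hxy⟩ := ih b true l (t :: r) (by simp) h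
      refine ⟨hb, x, y, ?_⟩
      rw [← hxy]
      simp

theorem length_splitInput (w : List (T ⊕ T)) (b c : Bool) (l r : List T) :
    (splitInput w b c l r).2.1.length + (splitInput w b c l r).2.2.length =
      l.length + r.length + w.length := by
  induction w generalizing b c l r with
  | nil => rfl
  | cons t w ih =>
    rcases t with t | t
    · cases c <;> simp only [splitInput, ih, List.length_cons] <;> omega
    · simp only [splitInput, ih, List.length_cons]; omega

/-- Registers with contents in the first two places only. -/
def twoRegs (l r : List T) : ℕ → List T
  | 0 => l
  | 1 => r
  | _ => []

theorem update_twoRegs_zero (l r l' : List T) :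
    Function.update (twoRegs l r) 0 l' = twoRegs l' r := by
  funext k
  rcases k with _ | _ | k <;> simp [twoRegs]

theorem update_twoRegs_one (l r r' : List T) :
    Function.update (twoRegs l r) 1 r' = twoRegs l r' := by
  funext k
  rcases k with _ | _ | k <;> simp [twoRegs]

/-- Per symbol: a loop test, a branch, a push and the next read. As in `Does.whileHead_step`, the
read that ends one round opens the run for the remaining input. -/
theorem run_readInput [Inhabited T] (w : List (T ⊕ T)) (b c : Bool) (o : Option T) (l r : List T) :
    ∃ v : Mem T, v.1 = (splitInput w b c l r).1 ∧ ∃ t ≤ 4 * w.length + 2,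
      Run readInput ⟨(b, o, c), w, twoRegs l r⟩
        ⟨v, [], twoRegs (splitInput w b c l r).2.1 (splitInput w b c l r).2.2⟩ t := by
  induction w generalizing b c o l r with
  | nil => exact ⟨(b, none, c), rfl, 2, by simp, (Run.read _ _ _ _).seq (.loop_false rfl)⟩
  | cons s w ih =>
    have step : ∀ b' c' t' l' r' (h : splitInput (s :: w) b c l r = splitInput w b' c' l' r'),
        Run readSymbol ⟨(b, o, c), s :: w, twoRegs l r⟩ ⟨(b', some t', c'), w, twoRegs l r⟩ 1 →
        Run (Prog.ite (fun v => v.2.2) (pushCur 1) (pushCur 0))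
          ⟨(b', some t', c'), w, twoRegs l r⟩ ⟨(b', some t', c'), w, twoRegs l' r'⟩ 2 →
        ∃ v : Mem T, v.1 = (splitInput (s :: w) b c l r).1 ∧ ∃ t ≤ 4 * (s :: w).length + 2,
          Run readInput ⟨(b, o, c), s :: w, twoRegs l r⟩
            ⟨v, [], twoRegs (splitInput (s :: w) b c l r).2.1
              (splitInput (s :: w) b c l r).2.2⟩ t := by
      intro b' c' t' l' r' h h1 h2
      obtain ⟨v, hv, t, ht, hr⟩ := ih b' c' (some t') l' r'
      rw [h]
      refine ⟨v, hv, ?_⟩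
      cases hr with
      | @seq _ _ _ _ _ t₁ t₂ hr₁ hr₂ =>
        exact ⟨_, by simp only [List.length_cons]; omega, h1.seq (.loop_true rfl (h2.seq hr₁) hr₂)⟩
    rcases s with s | s
    · cases c with
      | true =>
        refine step false true s l (s :: r) rfl ?_ ?_
        · have := Run.read (T := T) readStep (b, o, true) (.inl s :: w) (twoRegs l r)
          simpa [readStep, readSymbol] using this
        · have := Run.push (Γ := T ⊕ T) 1 (fun v : Mem T => v.2.1.getD default)
            (false, some s, true) w (twoRegs l r)
          rw [update_twoRegs_one] at this
          exact Run.ite_true rfl this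
      | false =>
        refine step b false s (s :: l) r rfl ?_ ?_
        · have := Run.read (T := T) readStep (b, o, false) (.inl s :: w) (twoRegs l r)
          simpa [readStep, readSymbol] using this
        · have := Run.push (Γ := T ⊕ T) 0 (fun v : Mem T => v.2.1.getD default)
            (b, some s, false) w (twoRegs l r)
          rw [update_twoRegs_zero] at this
          exact Run.ite_false rfl this
    · refine step b true s l (s :: r) (by cases c <;> rfl) ?_ ?_
      · exact Run.read _ _ _ _
      · have := Run.push (Γ := T ⊕ T) 1 (fun v : Mem T => v.2.1.getD default)
          (b, some s, true) w (twoRegs l r)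
        rw [update_twoRegs_one] at this
        exact Run.ite_true rfl this

/-- A relation between words that is decided by a program gives a language in P. -/
theorem inP_pairLanguage [Fintype T] [DecidableEq T] [Inhabited T] {R : List T → List T → Prop}
    (h : PolyPred (pairCtx (T ⊕ T) T) (fun p => R p.1 p.2)) : InP (pairLanguage R) := by
  classical
  -- Reading leaves the two words reversed in registers 0 and 1; moving them to 2 and 3 corrects the
  -- order, so the variables are placed there.
  obtain ⟨c, p, hc⟩ := h (fun i => i + 2) 4 (by
    intro i hi
    have : i < 2 := hi
    change i + 2 < 4
    omega)
  set main : Prog (T ⊕ T) T (Mem T) :=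
    ifFlag ((move 0 2).seq ((move 1 3).seq (c.seq ((clear 2).seq (clear 3)))))
      ((clear 0).seq (clear 1)) with hmain
  refine Prog.inP (readInput.seq main) (true, none, false) (fun v => v.1)
    (p + 30 * Polynomial.X + 30) _ fun w => ?_
  obtain ⟨v, hv, t, ht, hr⟩ := run_readInput w true false none [] []
  have hempty : twoRegs [] [] = fun _ : ℕ => ([] : List T) := by
    funext k
    rcases k with _ | _ | k <;> rfl
  rw [hempty] at hr
  have hlen := length_splitInput w true false [] []
  set A := (splitInput w true false [] []).2.1 with hA
  set B := (splitInput w true false [] []).2.2 with hB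
  simp only [List.length_nil, zero_add] at hlen
  suffices hs : ∃ b' : Bool, (b' = true ↔ w ∈ pairLanguage R) ∧
      Does main v.1 (twoRegs A B) b' (fun _ => []) (p.eval w.length + 26 * w.length + 26) by
    obtain ⟨b', hb', hd⟩ := hs
    obtain ⟨v', hv', t', ht', hr'⟩ := hd [] v rfl
    refine ⟨v', t + t', hr.seq hr', ?_, by rw [hv', hb']⟩
    simp only [Polynomial.eval_add, Polynomial.eval_mul, Polynomial.eval_X, Polynomial.eval_ofNat]
    omega
  by_cases hw : ∃ x y : List T, w = x.map Sum.inl ++ y.map Sum.inr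
  · obtain ⟨x, y, rfl⟩ := hw
    have hs := splitInput_pair x y true [] []
    have hA' : A = x.reverse := by rw [hA, hs]; simp
    have hB' : B = y.reverse := by rw [hB, hs]; simp
    have hv' : v.1 = true := by rw [hv, hs]
    rw [hv']
    refine ⟨decide (R x y), ?_, ?_⟩
    · rw [decide_eq_true_iff]
      constructor
      · exact fun hR => ⟨x, y, rfl, hR⟩
      · rintro ⟨x', y', hxy, hR⟩
        have hs' := splitInput_pair x' y' true [] []
        rw [← hxy, hs] at hs'
        simp only [List.append_nil, Prod.mk.injEq, List.reverse_inj, true_and] at hs'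
        rw [hs'.1, hs'.2]
        exact hR
    · rw [hA', hB'] at hlen ⊢
      simp only [List.length_reverse] at hlen
      have h1 := does_move (Γ := T ⊕ T) (b := true) (r := 0) (s := 2) (by omega)
        (twoRegs x.reverse y.reverse)
      have h2 := does_move (Γ := T ⊕ T) (b := true) (r := 1) (s := 3) (by omega)
        (Function.update (Function.update (twoRegs x.reverse y.reverse) 0 []) 2
          ((twoRegs x.reverse y.reverse 0).reverse ++ twoRegs x.reverse y.reverse 2))
      set e₂ := Function.update (Function.update (Function.update (Function.update
        (twoRegs x.reverse y.reverse) 0 []) 2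
          ((twoRegs x.reverse y.reverse 0).reverse ++ twoRegs x.reverse y.reverse 2)) 1 []) 3
          ((Function.update (Function.update (twoRegs x.reverse y.reverse) 0 []) 2
          ((twoRegs x.reverse y.reverse 0).reverse ++ twoRegs x.reverse y.reverse 2) 1).reverse ++
          Function.update (Function.update (twoRegs x.reverse y.reverse) 0 []) 2
          ((twoRegs x.reverse y.reverse 0).reverse ++ twoRegs x.reverse y.reverse 2) 3) with he₂
      have e2 : e₂ 2 = x := by simp [he₂, twoRegs]
      have e3 : e₂ 3 = y := by simp [he₂, twoRegs]
      have e0 : ∀ k, k ≠ 2 → k ≠ 3 → e₂ k = [] := by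
        intro k hk hk'
        rcases k with _ | _ | _ | _ | k
        · simp [he₂]
        · simp [he₂]
        · exact absurd rfl hk
        · exact absurd rfl hk'
        · simp [he₂, twoRegs]
      have h3 := hc (x, y) e₂ (x.map Sum.inl ++ y.map Sum.inr : List (T ⊕ T)).length true
        (decide (R x y)) ⟨?_, ?_, ?_⟩ (by simp)
      · have h4 := h1.seq (h2.seq (h3.seq ((does_clear (Γ := T ⊕ T) 2 e₂).seq
          (does_clear (Γ := T ⊕ T) 3 _))))
        refine (h4.ifFlag_true (d := (clear 0).seq (clear 1))).of_eq ?_ ?_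
        · funext k
          by_cases h2 : k = 2
          · simp [h2]
          · by_cases h3 : k = 3
            · simp [h3]
            · rw [Function.update_of_ne h3, Function.update_of_ne h2, e0 k h2 h3]
        · rw [Function.update_of_ne (by omega : 3 ≠ 2), e2, e3]
          simp only [twoRegs, List.length_reverse, ne_eq, not_false_eq_true,
            Function.update_of_ne, one_ne_zero, OfNat.one_ne_ofNat]
          omega
      · intro i hi
        have : i < 2 := hi
        interval_cases i
        · exact e2
        · exact e3
      · intro i hi
        have : i < 2 := hi
        interval_cases i
        · change x.length ≤ _
          omega
        · change y.length ≤ _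
          omega
      · intro k hk
        exact e0 k (by omega) (by omega)
  · have hv' : v.1 = false := by
      rw [hv, Bool.eq_false_iff]
      intro h'
      exact hw (by simpa using (eq_of_splitInput w true false [] [] (fun _ => rfl) h').2)
    rw [hv']
    refine ⟨false, ?_, ?_⟩
    · simp only [Bool.false_eq_true, false_iff]
      rintro ⟨x, y, hxy, -⟩
      exact hw ⟨x, y, hxy⟩
    · have h1 := (does_clear (Γ := T ⊕ T) (b := false) 0 (twoRegs A B)).seq
        (does_clear (Γ := T ⊕ T) 1 _)
      rw [update_twoRegs_zero, update_twoRegs_one] at h1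
      refine (h1.ifFlag_false (c := (move 0 2).seq ((move 1 3).seq (c.seq
        ((clear 2).seq (clear 3)))))).of_eq hempty ?_
      simp only [twoRegs]
      omega

end Prog

/-! ### Recognizing words that are encodings -/

namespace Prog

variable {Γ T α β : Type}

/-- The context for values of type `β` that are stored through their images under `h`. -/
def Ctx.comap (C : Ctx Γ T α) (h : β → α) : Ctx Γ T β := ⟨C.arity, fun b => C.get (h b)⟩

theorem Ctx.map_comap (C : Ctx Γ T α) (h : β → α) : (C.comap h).Map C h :=
  fun i hi => ⟨i, hi, fun _ => rfl⟩

/-- A property of preimages may be checked after the existence of a preimage. -/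
theorem PolyPred.exists_preimage {C : Ctx Γ T α} (h : β → α)
    (hP : PolyPred C (fun a => ∃ b, h b = a)) {Q : β → Prop} (hQ : PolyPred (C.comap h) Q) :
    PolyPred C (fun a => ∃ b, h b = a ∧ Q b) := by
  intro ρ m hρ
  obtain ⟨c, p, hc⟩ := hP ρ m hρ
  obtain ⟨d, q, hd⟩ := hQ ρ m hρ
  refine ⟨c.seq (ifFlag d skip), p + q + 2, fun a e n b b' ha hb' => ?_⟩
  by_cases h₁ : ∃ b, h b = a
  · have hb : ∃ x, h x = a ∧ (b' = true ↔ Q x) := by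
      by_cases h₂ : ∃ x, h x = a ∧ Q x
      · obtain ⟨x, hx, hQx⟩ := h₂
        exact ⟨x, hx, by rw [hb']; exact ⟨fun _ => hQx, fun _ => ⟨x, hx, hQx⟩⟩⟩
      · obtain ⟨x, hx⟩ := h₁
        exact ⟨x, hx, by rw [hb']; exact ⟨fun h' => absurd h' h₂, fun h' => ⟨x, hx, h'⟩⟩⟩
    obtain ⟨x, rfl, hx⟩ := hb
    have h2 := hd x e n true b' ⟨ha.get_eq, ha.length_le, ha.free⟩ hx
    exact ((hc _ e n b true ha (by simp)).seq h2.ifFlag_true).mono (by simp; omega)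
  · have hb : b' = false := by
      rw [Bool.eq_false_iff]
      intro h'
      obtain ⟨x, hx, -⟩ := hb'.1 h'
      exact h₁ ⟨x, hx⟩
    rw [hb]
    exact ((hc a e n b false ha (by simpa using h₁)).seq
      (does_skip false e).ifFlag_false).mono (by simp)

/-- The words that encode some value can be recognized in polynomial time. -/
def PolyRange (Γ : Type) (f : β → List T) : Prop :=
  ∀ {α : Type} {C : Ctx Γ T α} {g : α → List T}, PolyFun C g → PolyPred C (fun a => ∃ b, g a = f b)

theorem sep_eq_nil {x : T} {f : β → List T} {l : List β} : sep x f l = [] ↔ l = [] := by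
  cases l <;> simp

theorem sep_injective {x : T} {f : β → List T} (hx : ∀ b, x ∉ f b) (hf : Function.Injective f) :
    Function.Injective (sep x f) := by
  classical
  intro l k h
  induction l generalizing k with
  | nil => exact (sep_eq_nil.1 h.symm).symm
  | cons b l ih =>
    cases k with
    | nil => simp at h
    | cons c k =>
      rw [sep_cons, sep_cons] at h
      have h1 := congrArg (before x) h
      have h2 := congrArg (after x) h
      rw [before_append (hx _), before_append (hx _)] at h1
      rw [after_append (hx _), after_append (hx _)] at h2
      rw [hf h1, ih h2]

variable [DecidableEq T]

theorem foldl_sep (x : T) {f : β → List T} (l : List β) :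
    (sep x f l).foldl (fun _ c => decide (c = x)) true = true := by
  induction l with
  | nil => rfl
  | cons b l ih => simpa using ih

/-- A word splits into `x`-free pieces, each closed by `x`, as soon as it is empty or ends with `x`;
the fold remembers whether the last symbol was `x`. In the induction a symbol other than `x` joins
the first piece of the rest, which exists because otherwise the fold would end in `false`. -/
theorem exists_eq_sep (x : T) (s : List T) (b : Bool)
    (h : s.foldl (fun _ c => decide (c = x)) b = true) :
    ∃ l : List {w : List T // x ∉ w}, s = sep x Subtype.val l := by
  induction s generalizing b with
  | nil => exact ⟨[], rfl⟩
  | cons c s ih =>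
    rw [List.foldl_cons] at h
    obtain ⟨l, hl⟩ := ih _ h
    by_cases hc : c = x
    · exact ⟨⟨[], by simp⟩ :: l, by simp [hc, hl]⟩
    · rcases l with _ | ⟨⟨w, hw⟩, l⟩
      · rw [hl] at h
        simp [hc] at h
      · exact ⟨⟨c :: w, by simp [hw, Ne.symm hc]⟩ :: l, by simp [hl]⟩

theorem after_sep {x : T} {f : β → List T} (hx : ∀ b, x ∉ f b) (l : List β) :
    after x (sep x f l) = sep x f l.tail := by
  cases l with
  | nil => rfl
  | cons b l => rw [sep_cons, after_append (hx b)]; rfl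

theorem iterate_after_sep {x : T} {f : β → List T} (hx : ∀ b, x ∉ f b) (n : ℕ) (l : List β) :
    (after x)^[n] (sep x f l) = sep x f (l.drop n) := by
  induction n generalizing l with
  | zero => rfl
  | succ n ih => rw [Function.iterate_succ_apply, after_sep hx, ih, List.drop_tail]

theorem foldl_or_eq (x : T) (s : List T) (b : Bool) :
    s.foldl (fun b c => b || decide (c = x)) b = true ↔ b = true ∨ x ∈ s := by
  induction s generalizing b with
  | nil => simp
  | cons c s ih =>
    rw [List.foldl_cons, ih, List.mem_cons]
    simp only [Bool.or_eq_true, decide_eq_true_eq]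
    rw [or_assoc, eq_comm (a := c)]

theorem before_append_after {x : T} {s : List T} (h : x ∈ s) :
    before x s ++ x :: after x s = s := by
  obtain ⟨l, k, rfl, hl⟩ := List.eq_append_cons_of_mem h
  rw [before_append hl, after_append hl]

variable [Inhabited T]

theorem polyRange_sep_words (x : T) :
    PolyRange Γ (sep x (Subtype.val : {w : List T // x ∉ w} → List T)) := by
  intro α C g hg
  refine (PolyPred.foldl hg (fun _ c => decide (c = x)) true).congr fun a => ?_
  constructor
  · exact exists_eq_sep x _ _
  · rintro ⟨l, hl⟩
    rw [hl]
    exact foldl_sep x l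

/-- The word is first split into arbitrary `x`-free pieces, then each piece is tested. Quantifying
over pieces makes sense only after a successful split, so the second test is stated on pairs of a
value and its splitting, by `PolyPred.exists_preimage`. -/
theorem PolyRange.sep {x : T} {f : β → List T} (hx : ∀ b, x ∉ f b) (hf : PolyRange Γ f) :
    PolyRange Γ (sep x f) := by
  intro α C g hg
  let h : {p : α × List {w : List T // x ∉ w} // g p.1 = Prog.sep x Subtype.val p.2} → α :=
    fun p => p.1.1
  have h1 : PolyPred C (fun a => ∃ b, h b = a) :=
    (polyRange_sep_words x hg).congr fun a =>
      ⟨fun ⟨l, hl⟩ => ⟨⟨(a, l), hl⟩, rfl⟩, fun ⟨⟨⟨_, l⟩, hl⟩, ha⟩ => ⟨l, ha ▸ hl⟩⟩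
  have h2 : PolyFun (C.comap h) (fun p => Prog.sep x Subtype.val p.1.2) :=
    (hg.comap (C.map_comap h)).congr fun p => p.2
  have h3 : PolyPred (C.comap h) (fun p => ∀ w ∈ p.1.2, ∃ b, w.1 = f b) :=
    PolyPred.forall_mem (fun w => w.2) h2 (hf (PolyFun.snd _ _))
  refine (PolyPred.exists_preimage h h1 h3).congr fun a => ?_
  constructor
  · rintro ⟨⟨⟨a', l⟩, hl⟩, rfl, hw⟩
    simp only [h] at hl hw ⊢
    rw [hl]
    clear hl
    induction l with
    | nil => exact ⟨[], rfl⟩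
    | cons w l ih =>
      obtain ⟨b, hb⟩ := hw w List.mem_cons_self
      obtain ⟨k, hk⟩ := ih fun w' hw' => hw w' (List.mem_cons_of_mem _ hw')
      exact ⟨b :: k, by rw [sep_cons, sep_cons, hb, hk]⟩
  · rintro ⟨l, hl⟩
    refine ⟨⟨(a, l.map fun b => ⟨f b, hx b⟩), ?_⟩, rfl, ?_⟩
    · simp only [hl]
      clear hl
      induction l with
      | nil => rfl
      | cons b l ih => simp [ih]
    · intro w hw
      obtain ⟨b, -, rfl⟩ := List.mem_map.1 hw
      exact ⟨b, rfl⟩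

theorem PolyFun.iterate_after {C : Ctx Γ T α} {g : α → List T} (hg : PolyFun C g) (x : T) (n : ℕ) :
    PolyFun C (fun a => (Prog.after x)^[n] (g a)) := by
  induction n with
  | zero => exact hg
  | succ n ih => exact (ih.after x).congr fun a => (Function.iterate_succ_apply' _ _ _).symm

/-- Encoded lists of a given length can be recognized in polynomial time. -/
theorem PolyRange.sep_length {x : T} {f : β → List T} (hx : ∀ b, x ∉ f b)
    (hf : PolyRange Γ (Prog.sep x f)) {C : Ctx Γ T α} {g : α → List T} (hg : PolyFun C g) (n : ℕ) :
    PolyPred C (fun a => ∃ l, l.length = n + 1 ∧ g a = Prog.sep x f l) := by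
  -- There are exactly `n + 1` items if something is left after `n` cuts and nothing after `n + 1`.
  refine ((hf hg).and ((PolyPred.isEmpty (hg.iterate_after x n)).not.and
    (PolyPred.isEmpty (hg.iterate_after x (n + 1))))).congr fun a => ?_
  constructor
  · rintro ⟨⟨l, hl⟩, h1, h2⟩
    rw [hl, iterate_after_sep hx, sep_eq_nil, List.drop_eq_nil_iff] at h1 h2
    exact ⟨l, by omega, hl⟩
  · rintro ⟨l, hn, hl⟩
    refine ⟨⟨l, hl⟩, ?_, ?_⟩ <;> rw [hl, iterate_after_sep hx, sep_eq_nil, List.drop_eq_nil_iff] <;>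
      omega

theorem PolyPred.symbol_mem {C : Ctx Γ T α} {g : α → List T} (hg : PolyFun C g) (x : T) :
    PolyPred C (fun a => x ∈ g a) :=
  (PolyPred.foldl hg (fun b c => b || decide (c = x)) false).congr fun a => by
    rw [foldl_or_eq]; simp

end Prog

/-! ### Codes of names, edges, choice sets and product edges -/

namespace LGSCode

open Prog

/-- Triples of names: source, label, target. -/
abbrev Edge : Type := Name × Name × Name

/-- Edges of a product graph. -/
abbrev PairEdge : Type := (Name × Name) × Name × (Name × Name)

/-- The encoding of a name. -/
def nameCode (n : Name) : List Token := n.map Sum.inl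

/-- The encoding of an edge. -/
def edgeCode (e : Edge) : List Token := names [e.1, e.2.1, e.2.2]

/-- The encoding of a choice set together with its node. -/
def choiceCode (c : Name × List Edge) : List Token := closed 1 names [[c.1]] ++ edges c.2

/-- The encoding of a node of a product graph. -/
def pairCode (p : Name × Name) : List Token := names [p.1, p.2]

/-- The encoding of an edge of a product graph. -/
def pairEdgeCode (e : PairEdge) : List Token :=
  names [e.1.1, e.1.2, e.2.1, e.2.2.1, e.2.2.2]

theorem closed_eq_sep {α : Type} (k : Fin 4) (f : α → List Token) (l : List α) :
    closed k f l = sep (Sum.inr k) f l := rfl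

theorem marker_notMem_closed {α : Type} {k j : Fin 4} (h : k ≠ j) {f : α → List Token} {l : List α}
    (hf : ∀ b ∈ l, Sum.inr k ∉ f b) : Sum.inr k ∉ closed j f l := by
  intro hm
  obtain ⟨b, hb, h'⟩ := List.mem_flatMap.1 hm
  rcases List.mem_append.1 h' with h' | h'
  · exact hf b hb h'
  · simp only [List.mem_singleton, Sum.inr.injEq] at h'
    exact h h'

theorem marker_notMem_nameCode (k : Fin 4) (n : Name) : Sum.inr k ∉ nameCode n := by
  simp [nameCode]

theorem marker_notMem_names {k : Fin 4} (h : k ≠ 0) (l : List Name) : Sum.inr k ∉ names l :=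
  marker_notMem_closed h fun b _ => marker_notMem_nameCode k b

theorem marker_notMem_edgeCode {k : Fin 4} (h : k ≠ 0) (e : Edge) : Sum.inr k ∉ edgeCode e :=
  marker_notMem_names h _

theorem marker_notMem_pairCode {k : Fin 4} (h : k ≠ 0) (p : Name × Name) : Sum.inr k ∉ pairCode p :=
  marker_notMem_names h _

theorem marker_notMem_pairEdgeCode {k : Fin 4} (h : k ≠ 0) (e : PairEdge) :
    Sum.inr k ∉ pairEdgeCode e :=
  marker_notMem_names h _

theorem marker_notMem_edges {k : Fin 4} (h : k ≠ 0) (h' : k ≠ 1) (l : List Edge) :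
    Sum.inr k ∉ edges l :=
  marker_notMem_closed h' fun e _ => marker_notMem_edgeCode h e

theorem marker_notMem_choiceCode {k : Fin 4} (h : k ≠ 0) (h' : k ≠ 1) (c : Name × List Edge) :
    Sum.inr k ∉ choiceCode c := by
  intro hm
  rcases List.mem_append.1 hm with hm | hm
  · exact marker_notMem_closed h' (fun l _ => marker_notMem_names h l) hm
  · exact marker_notMem_edges h h' _ hm

theorem marker_notMem_choices (l : List (Name × List Edge)) : Sum.inr 3 ∉ choices l :=
  marker_notMem_closed (by decide) fun c _ =>
    marker_notMem_choiceCode (by decide) (by decide) c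

theorem marker_notMem_pairNodes (l : List (Name × Name)) : Sum.inr 3 ∉ pairNodes l :=
  marker_notMem_closed (by decide) fun p _ => marker_notMem_pairCode (by decide) p

theorem marker_notMem_pairEdges (l : List PairEdge) : Sum.inr 3 ∉ pairEdges l :=
  marker_notMem_closed (by decide) fun e _ => marker_notMem_pairEdgeCode (by decide) e

theorem nameCode_injective : Function.Injective nameCode :=
  List.map_injective_iff.2 Sum.inl_injective

theorem names_injective : Function.Injective names :=
  sep_injective (marker_notMem_nameCode 0) nameCode_injective

theorem pairCode_injective : Function.Injective pairCode := by
  rintro ⟨u, v⟩ ⟨u', v'⟩ h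
  simpa using names_injective h

theorem pairEdgeCode_injective : Function.Injective pairEdgeCode := by
  rintro ⟨⟨u, u'⟩, a, v, v'⟩ ⟨⟨x, x'⟩, b, y, y'⟩ h
  have := names_injective h
  simp only [List.cons.injEq, and_true] at this
  obtain ⟨rfl, rfl, rfl, rfl, rfl⟩ := this
  rfl

section Components

variable {Γ α : Type} {C : Ctx Γ Token α}

theorem polyFun_head {n : α → Name} {l : α → List Name} (h : PolyFun C (fun a => names (n a :: l a))) :
    PolyFun C (fun a => nameCode (n a)) :=
  (h.before (Sum.inr 0)).congr fun a => by
    rw [names, closed_eq_sep, sep_cons]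
    exact before_append (marker_notMem_nameCode 0 (n a)) _

theorem polyFun_tail {n : α → Name} {l : α → List Name} (h : PolyFun C (fun a => names (n a :: l a))) :
    PolyFun C (fun a => names (l a)) :=
  (h.after (Sum.inr 0)).congr fun a => by
    rw [names, closed_eq_sep, sep_cons]
    exact after_append (marker_notMem_nameCode 0 (n a)) _

theorem polyFun_source {e : α → Edge} (h : PolyFun C (fun a => edgeCode (e a))) :
    PolyFun C (fun a => nameCode (e a).1) :=
  polyFun_head h

theorem polyFun_label {e : α → Edge} (h : PolyFun C (fun a => edgeCode (e a))) :
    PolyFun C (fun a => nameCode (e a).2.1) :=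
  polyFun_head (polyFun_tail h)

theorem polyFun_target {e : α → Edge} (h : PolyFun C (fun a => edgeCode (e a))) :
    PolyFun C (fun a => nameCode (e a).2.2) :=
  polyFun_head (polyFun_tail (polyFun_tail h))

theorem polyFun_pair_fst {p : α → Name × Name} (h : PolyFun C (fun a => pairCode (p a))) :
    PolyFun C (fun a => nameCode (p a).1) :=
  polyFun_head h

theorem polyFun_pair_snd {p : α → Name × Name} (h : PolyFun C (fun a => pairCode (p a))) :
    PolyFun C (fun a => nameCode (p a).2) :=
  polyFun_head (polyFun_tail h)

theorem polyFun_pairEdge {e : α → PairEdge} (h : PolyFun C (fun a => pairEdgeCode (e a))) :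
    PolyFun C (fun a => nameCode (e a).1.1) ∧ PolyFun C (fun a => nameCode (e a).1.2) ∧
      PolyFun C (fun a => nameCode (e a).2.1) ∧ PolyFun C (fun a => nameCode (e a).2.2.1) ∧
      PolyFun C (fun a => nameCode (e a).2.2.2) :=
  ⟨polyFun_head h, polyFun_head (polyFun_tail h), polyFun_head (polyFun_tail (polyFun_tail h)),
    polyFun_head (polyFun_tail (polyFun_tail (polyFun_tail h))),
    polyFun_head (polyFun_tail (polyFun_tail (polyFun_tail (polyFun_tail h))))⟩

theorem choiceCode_eq (c : Name × List Edge) :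
    choiceCode c = names [c.1] ++ Sum.inr 1 :: edges c.2 := by
  simp [choiceCode, closed]

theorem polyFun_choice_node {c : α → Name × List Edge} (h : PolyFun C (fun a => choiceCode (c a))) :
    PolyFun C (fun a => nameCode (c a).1) := by
  have h1 : PolyFun C (fun a => names [(c a).1]) := (h.before (Sum.inr 1)).congr fun a => by
    rw [choiceCode_eq]
    exact before_append (marker_notMem_names (by decide) _) _
  exact polyFun_head h1

theorem polyFun_choice_set {c : α → Name × List Edge} (h : PolyFun C (fun a => choiceCode (c a))) :
    PolyFun C (fun a => edges (c a).2) :=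
  (h.after (Sum.inr 1)).congr fun a => by
    rw [choiceCode_eq]
    exact after_append (marker_notMem_names (by decide) _) _

theorem polyPred_eq {m n : α → Name} (hm : PolyFun C (fun a => nameCode (m a)))
    (hn : PolyFun C (fun a => nameCode (n a))) : PolyPred C (fun a => m a = n a) :=
  (PolyPred.eq hm hn).congr fun _ => nameCode_injective.eq_iff

theorem polyPred_mem {n : α → Name} {l : α → List Name} (hn : PolyFun C (fun a => nameCode (n a)))
    (hl : PolyFun C (fun a => names (l a))) : PolyPred C (fun a => n a ∈ l a) :=
  PolyPred.mem (marker_notMem_nameCode 0) nameCode_injective hl hn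

/-- The components of the triple are stored or computed separately. Comparing them one by one with
those of a listed edge avoids assembling a code for the triple. -/
theorem polyPred_mem_edges {u a v : α → Name} {l : α → List Edge}
    (hu : PolyFun C (fun x => nameCode (u x))) (ha : PolyFun C (fun x => nameCode (a x)))
    (hv : PolyFun C (fun x => nameCode (v x))) (hl : PolyFun C (fun x => edges (l x))) :
    PolyPred C (fun x => (u x, a x, v x) ∈ l x) := by
  have hs := PolyFun.snd C edgeCode
  refine (PolyPred.exists_mem (marker_notMem_edgeCode (by decide)) hl
    (P := fun x e => e.1 = u x ∧ e.2.1 = a x ∧ e.2.2 = v x)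
    ((polyPred_eq (polyFun_source hs) (hu.fst _)).and
      ((polyPred_eq (polyFun_label hs) (ha.fst _)).and
      (polyPred_eq (polyFun_target hs) (hv.fst _))))).congr fun x => ?_
  constructor
  · rintro ⟨⟨u', a', v'⟩, h, rfl, rfl, rfl⟩
    exact h
  · exact fun h => ⟨_, h, rfl, rfl, rfl⟩

theorem polyPred_mem_pairNodes {u v : α → Name} {l : α → List (Name × Name)}
    (hu : PolyFun C (fun x => nameCode (u x))) (hv : PolyFun C (fun x => nameCode (v x)))
    (hl : PolyFun C (fun x => pairNodes (l x))) : PolyPred C (fun x => (u x, v x) ∈ l x) := by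
  have hs := PolyFun.snd C pairCode
  refine (PolyPred.exists_mem (marker_notMem_pairCode (by decide)) hl
    (P := fun x p => p.1 = u x ∧ p.2 = v x)
    ((polyPred_eq (polyFun_pair_fst hs) (hu.fst _)).and
      (polyPred_eq (polyFun_pair_snd hs) (hv.fst _)))).congr fun x => ?_
  constructor
  · rintro ⟨⟨u', v'⟩, h, rfl, rfl⟩
    exact h
  · exact fun h => ⟨_, h, rfl, rfl⟩

end Components

section Recognition

variable {Γ α : Type}

theorem foldl_and_isLeft (s : List Token) (b : Bool) :
    s.foldl (fun b c => b && c.isLeft) b = true ↔ b = true ∧ ∃ n, s = nameCode n := by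
  induction s generalizing b with
  | nil => simp [nameCode]
  | cons c s ih =>
    rw [List.foldl_cons, ih, Bool.and_eq_true, and_assoc]
    refine and_congr_right fun _ => ?_
    constructor
    · rintro ⟨hc, n, rfl⟩
      obtain ⟨t, rfl⟩ := Sum.isLeft_iff.1 hc
      exact ⟨t :: n, rfl⟩
    · rintro ⟨n, hn⟩
      cases n with
      | nil => simp [nameCode] at hn
      | cons t n =>
        simp only [nameCode, List.map_cons, List.cons.injEq] at hn
        exact ⟨by rw [hn.1]; rfl, n, hn.2⟩

theorem polyRange_nameCode : PolyRange Γ nameCode := by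
  intro α C g hg
  exact (PolyPred.foldl hg (fun b c => b && c.isLeft) true).congr fun a => by
    rw [foldl_and_isLeft]; simp

theorem polyRange_names : PolyRange Γ names :=
  PolyRange.sep (marker_notMem_nameCode 0) polyRange_nameCode

theorem polyRange_edgeCode : PolyRange Γ edgeCode := by
  intro α C g hg
  refine (PolyRange.sep_length (marker_notMem_nameCode 0) polyRange_names hg 2).congr fun a => ?_
  constructor
  · rintro ⟨l, hl, h⟩
    obtain ⟨u, b, v, rfl⟩ := List.length_eq_three.1 hl
    exact ⟨(u, b, v), h⟩
  · rintro ⟨e, h⟩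
    exact ⟨_, rfl, h⟩

theorem polyRange_pairCode : PolyRange Γ pairCode := by
  intro α C g hg
  refine (PolyRange.sep_length (marker_notMem_nameCode 0) polyRange_names hg 1).congr fun a => ?_
  constructor
  · rintro ⟨l, hl, h⟩
    obtain ⟨u, v, rfl⟩ := List.length_eq_two.1 hl
    exact ⟨(u, v), h⟩
  · rintro ⟨e, h⟩
    exact ⟨_, rfl, h⟩

theorem polyRange_pairEdgeCode : PolyRange Γ pairEdgeCode := by
  intro α C g hg
  refine (PolyRange.sep_length (marker_notMem_nameCode 0) polyRange_names hg 4).congr fun a => ?_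
  constructor
  · rintro ⟨l, hl, h⟩
    rcases l with _ | ⟨u, _ | ⟨u', l⟩⟩
    · simp at hl
    · simp at hl
    · obtain ⟨b, v, v', rfl⟩ := List.length_eq_three.1 (by simpa using hl : l.length = 3)
      exact ⟨((u, u'), b, (v, v')), h⟩
  · rintro ⟨e, h⟩
    exact ⟨_, rfl, h⟩

theorem polyRange_edges : PolyRange Γ edges :=
  PolyRange.sep (marker_notMem_edgeCode (by decide)) polyRange_edgeCode

theorem polyRange_pairNodes : PolyRange Γ pairNodes :=
  PolyRange.sep (marker_notMem_pairCode (by decide)) polyRange_pairCode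

theorem polyRange_pairEdges : PolyRange Γ pairEdges :=
  PolyRange.sep (marker_notMem_pairEdgeCode (by decide)) polyRange_pairEdgeCode

/-- The first marker `1` separates the node from its choice set. Its presence must be tested:
without it, `before` returns the whole word and `after` the empty one, and a bare node would be
accepted. -/
theorem polyRange_choiceCode : PolyRange Γ choiceCode := by
  intro α C g hg
  refine ((PolyPred.symbol_mem hg (Sum.inr 1)).and ((PolyRange.sep_length
    (marker_notMem_nameCode 0) polyRange_names (hg.before (Sum.inr 1)) 0).and
    (polyRange_edges (hg.after (Sum.inr 1))))).congr fun a => ?_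
  constructor
  · rintro ⟨hm, ⟨l, hl, h⟩, k, hk⟩
    obtain ⟨v, rfl⟩ := List.length_eq_one_iff.1 hl
    refine ⟨(v, k), ?_⟩
    rw [choiceCode_eq, ← before_append_after hm, h, hk]
    rfl
  · rintro ⟨c, h⟩
    rw [h, choiceCode_eq]
    exact ⟨by simp, ⟨[c.1], rfl, before_append (marker_notMem_names (by decide) _) _⟩, c.2,
      after_append (marker_notMem_names (by decide) _) _⟩

theorem polyRange_choices : PolyRange Γ choices :=
  PolyRange.sep (marker_notMem_choiceCode (by decide) (by decide)) polyRange_choiceCode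

end Recognition

end LGSCode

/-! ### Parsing an instance and a candidate into lists -/

namespace LGSCode

open Prog

/-- The lists in the description of a guest, a host, and a candidate. -/
structure Data where
  guestAlphabet : List Name
  guestNodes : List Name
  guestEdges : List Edge
  must : List Name
  unique : List Name
  exclusive : List Name
  choice : List (Name × List Edge)
  hostAlphabet : List Name
  hostNodes : List Name
  hostEdges : List Edge
  nodes : List (Name × Name)
  pairs : List PairEdge

namespace Data

/-- The description of the guest and the host. -/
def instanceCode (d : Data) : List Token :=
  closed 3 id [names d.guestAlphabet, names d.guestNodes, edges d.guestEdges, names d.must,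
    names d.unique, names d.exclusive, choices d.choice, names d.hostAlphabet, names d.hostNodes,
    edges d.hostEdges]

/-- The description of the candidate. -/
def candidateCode (d : Data) : List Token :=
  closed 3 id [pairNodes d.nodes, pairEdges d.pairs]

/-- The description of the instance and the candidate. -/
def code (d : Data) : List Token × List Token := (d.instanceCode, d.candidateCode)

end Data

theorem polyFun_fst (Γ : Type) : PolyFun (pairCtx Γ Token) Prod.fst :=
  (Ctx.IsVar.fst (C := wordCtx Γ Token) (g := fun w => w) ⟨0, Nat.zero_lt_one, fun _ => rfl⟩
    id).polyFun

theorem polyFun_snd (Γ : Type) : PolyFun (pairCtx Γ Token) Prod.snd :=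
  PolyFun.snd (wordCtx Γ Token) id

theorem polyFun_section {Γ α : Type} {C : Ctx Γ Token α} {s : α → List Token}
    {l : α → List (List Token)} (hs : ∀ a, Sum.inr 3 ∉ s a)
    (h : PolyFun C (fun a => closed 3 id (s a :: l a))) :
    PolyFun C s ∧ PolyFun C (fun a => closed 3 id (l a)) := by
  constructor
  · exact (h.before (Sum.inr 3)).congr fun a => by
      rw [closed_eq_sep, sep_cons]; exact before_append (hs a) _
  · exact (h.after (Sum.inr 3)).congr fun a => by
      rw [closed_eq_sep, sep_cons]; exact after_append (hs a) _

/-- The context whose values are the lists of an instance and a candidate. -/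
def dataCtx (Γ : Type) : Ctx Γ Token Data := (pairCtx Γ Token).comap Data.code

/-- In `dataCtx` the stored words are codes of lists by construction, so peeling off section after
section yields each list without any check of form. -/
theorem polyFun_instance (Γ : Type) :
    PolyFun (dataCtx Γ) (fun d => names d.guestAlphabet) ∧
    PolyFun (dataCtx Γ) (fun d => names d.guestNodes) ∧
    PolyFun (dataCtx Γ) (fun d => edges d.guestEdges) ∧
    PolyFun (dataCtx Γ) (fun d => names d.must) ∧
    PolyFun (dataCtx Γ) (fun d => names d.unique) ∧
    PolyFun (dataCtx Γ) (fun d => names d.exclusive) ∧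
    PolyFun (dataCtx Γ) (fun d => choices d.choice) ∧
    PolyFun (dataCtx Γ) (fun d => names d.hostAlphabet) ∧
    PolyFun (dataCtx Γ) (fun d => names d.hostNodes) ∧
    PolyFun (dataCtx Γ) (fun d => edges d.hostEdges) := by
  have hn : ∀ l : List Name, Sum.inr 3 ∉ names l := marker_notMem_names (by decide)
  have he : ∀ l : List Edge, Sum.inr 3 ∉ edges l := marker_notMem_edges (by decide) (by decide)
  have h : PolyFun (dataCtx Γ) Data.instanceCode :=
    (polyFun_fst Γ).comap (Ctx.map_comap _ Data.code)
  unfold Data.instanceCode at h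
  obtain ⟨h1, h⟩ := polyFun_section (fun _ => hn _) h
  obtain ⟨h2, h⟩ := polyFun_section (fun _ => hn _) h
  obtain ⟨h3, h⟩ := polyFun_section (fun _ => he _) h
  obtain ⟨h4, h⟩ := polyFun_section (fun _ => hn _) h
  obtain ⟨h5, h⟩ := polyFun_section (fun _ => hn _) h
  obtain ⟨h6, h⟩ := polyFun_section (fun _ => hn _) h
  obtain ⟨h7, h⟩ := polyFun_section (fun _ => marker_notMem_choices _) h
  obtain ⟨h8, h⟩ := polyFun_section (fun _ => hn _) h
  obtain ⟨h9, h⟩ := polyFun_section (fun _ => hn _) h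
  obtain ⟨h10, -⟩ := polyFun_section (fun _ => he _) h
  exact ⟨h1, h2, h3, h4, h5, h6, h7, h8, h9, h10⟩

theorem polyFun_candidate (Γ : Type) :
    PolyFun (dataCtx Γ) (fun d => pairNodes d.nodes) ∧
    PolyFun (dataCtx Γ) (fun d => pairEdges d.pairs) := by
  have h : PolyFun (dataCtx Γ) Data.candidateCode :=
    (polyFun_snd Γ).comap (Ctx.map_comap _ Data.code)
  unfold Data.candidateCode at h
  obtain ⟨h1, h⟩ := polyFun_section (fun _ => marker_notMem_pairNodes _) h
  exact ⟨h1, (polyFun_section (fun _ => marker_notMem_pairEdges _) h).1⟩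

/-- The section with a given number. -/
def sectionAt (i : ℕ) (s : List Token) : List Token :=
  before (Sum.inr 3) ((after (Sum.inr 3))^[i] s)

theorem polyFun_sectionAt {Γ α : Type} {C : Ctx Γ Token α} {g : α → List Token}
    (hg : PolyFun C g) (i : ℕ) : PolyFun C (fun a => sectionAt i (g a)) :=
  (hg.iterate_after _ i).before _

theorem sectionAt_sep {β : Type} {f : β → List Token} (hf : ∀ b, Sum.inr 3 ∉ f b) {i : ℕ}
    {l : List β} (h : i < l.length) : sectionAt i (sep (Sum.inr 3) f l) = f l[i] := by
  unfold sectionAt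
  rw [iterate_after_sep hf, List.drop_eq_getElem_cons h, sep_cons]
  exact before_append (hf _) _

/-- The words with a given number of sections. -/
theorem polyPred_sections {Γ α : Type} {C : Ctx Γ Token α} {g : α → List Token}
    (hg : PolyFun C g) (n : ℕ) :
    PolyPred C (fun a => ∃ l : List {w : List Token // Sum.inr 3 ∉ w},
      l.length = n + 1 ∧ g a = sep (Sum.inr 3) Subtype.val l) :=
  PolyRange.sep_length (fun w => w.2) (polyRange_sep_words _) hg n

theorem eq_closed_sections {s : List Token} {n : ℕ}
    (h : ∃ l : List {w : List Token // Sum.inr 3 ∉ w},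
      l.length = n ∧ s = sep (Sum.inr 3) Subtype.val l) :
    s = closed 3 id ((List.range n).map fun i => sectionAt i s) := by
  obtain ⟨l, rfl, hl⟩ := h
  have h1 : ∀ k : List {w : List Token // Sum.inr 3 ∉ w},
      sep (Sum.inr 3) Subtype.val k = closed 3 id (k.map Subtype.val) := by
    intro k
    induction k with
    | nil => rfl
    | cons w k ih => rw [List.map_cons, closed_eq_sep, sep_cons, sep_cons, ih]; rfl
  conv_lhs => rw [hl, h1]
  congr 1
  apply List.ext_getElem
  · simp
  · intro i hi hi'
    have : i < l.length := by simpa using hi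
    simp only [List.getElem_map, List.getElem_range]
    rw [hl, sectionAt_sep (fun w => w.2) this]

theorem sections_of_eq_closed {k : List (List Token)} (hk : ∀ w ∈ k, Sum.inr 3 ∉ w) :
    (∃ l : List {w : List Token // Sum.inr 3 ∉ w},
      l.length = k.length ∧ closed 3 id k = sep (Sum.inr 3) Subtype.val l) ∧
    ∀ (i : ℕ) (h : i < k.length), sectionAt i (closed 3 id k) = k[i] := by
  have h1 : closed 3 id k = sep (Sum.inr 3) Subtype.val (k.attach.map fun w =>
      (⟨w.1, hk w.1 w.2⟩ : {w : List Token // Sum.inr 3 ∉ w})) := by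
    rw [sep, List.flatMap_map]
    conv_lhs => rw [← List.attach_map_subtype_val k]
    rw [closed, List.flatMap_map]
    rfl
  refine ⟨⟨_, by simp, h1⟩, fun i hi => ?_⟩
  rw [h1, sectionAt_sep (fun w => w.2) (by simpa using hi)]
  simp

/-- The pairs of words that have the form of a description are recognized in polynomial time. -/
theorem polyPred_exists_code (Γ : Type) :
    PolyPred (pairCtx Γ Token) (fun p => ∃ d : Data, d.code = p) := by
  have hx := polyFun_fst Γ
  have hy := polyFun_snd Γ
  -- The arguments 9 and 1 mean ten and two sections. Since `sectionAt` is defined on every word,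
  -- the sections can be tested independently of these counts.
  refine ((polyPred_sections hx 9).and ((polyPred_sections hy 1).and
    ((polyRange_names (polyFun_sectionAt hx 0)).and ((polyRange_names (polyFun_sectionAt hx 1)).and
    ((polyRange_edges (polyFun_sectionAt hx 2)).and ((polyRange_names (polyFun_sectionAt hx 3)).and
    ((polyRange_names (polyFun_sectionAt hx 4)).and ((polyRange_names (polyFun_sectionAt hx 5)).and
    ((polyRange_choices (polyFun_sectionAt hx 6)).and
    ((polyRange_names (polyFun_sectionAt hx 7)).and ((polyRange_names (polyFun_sectionAt hx 8)).and
    ((polyRange_edges (polyFun_sectionAt hx 9)).and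
    ((polyRange_pairNodes (polyFun_sectionAt hy 0)).and
    (polyRange_pairEdges (polyFun_sectionAt hy 1))))))))))))))).congr ?_
  rintro ⟨x, y⟩
  constructor
  · rintro ⟨hx, hy, ⟨l₀, h₀⟩, ⟨l₁, h₁⟩, ⟨l₂, h₂⟩, ⟨l₃, h₃⟩, ⟨l₄, h₄⟩, ⟨l₅, h₅⟩, ⟨l₆, h₆⟩, ⟨l₇, h₇⟩,
      ⟨l₈, h₈⟩, ⟨l₉, h₉⟩, ⟨k₀, g₀⟩, ⟨k₁, g₁⟩⟩
    have hx' := eq_closed_sections hx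
    have hy' := eq_closed_sections hy
    simp only [List.range_succ, List.range_zero, List.nil_append, List.map_cons,
      List.map_nil, Nat.reduceAdd, List.cons_append] at hx' hy' h₀ h₁ h₂ h₃ h₄ h₅ h₆ h₇ h₈ h₉ g₀ g₁
    rw [h₀, h₁, h₂, h₃, h₄, h₅, h₆, h₇, h₈, h₉] at hx'
    rw [g₀, g₁] at hy'
    exact ⟨⟨l₀, l₁, l₂, l₃, l₄, l₅, l₆, l₇, l₈, l₉, k₀, k₁⟩, Prod.ext hx'.symm hy'.symm⟩
  · rintro ⟨d, hd⟩
    obtain ⟨rfl, rfl⟩ := Prod.mk.inj hd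
    have hn : ∀ l : List Name, Sum.inr 3 ∉ names l := marker_notMem_names (by decide)
    have he : ∀ l : List Edge, Sum.inr 3 ∉ edges l := marker_notMem_edges (by decide) (by decide)
    obtain ⟨h1, h2⟩ := sections_of_eq_closed (k := [names d.guestAlphabet, names d.guestNodes,
      edges d.guestEdges, names d.must, names d.unique, names d.exclusive, choices d.choice,
      names d.hostAlphabet, names d.hostNodes, edges d.hostEdges])
      (by simp [hn, he, marker_notMem_choices])
    obtain ⟨h3, h4⟩ := sections_of_eq_closed (k := [pairNodes d.nodes, pairEdges d.pairs])
      (by simp [marker_notMem_pairNodes, marker_notMem_pairEdges])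
    exact ⟨h1, h3, ⟨_, h2 0 (by simp)⟩, ⟨_, h2 1 (by simp)⟩, ⟨_, h2 2 (by simp)⟩,
      ⟨_, h2 3 (by simp)⟩, ⟨_, h2 4 (by simp)⟩, ⟨_, h2 5 (by simp)⟩, ⟨_, h2 6 (by simp)⟩,
      ⟨_, h2 7 (by simp)⟩, ⟨_, h2 8 (by simp)⟩, ⟨_, h2 9 (by simp)⟩, ⟨_, h4 0 (by simp)⟩,
      ⟨_, h4 1 (by simp)⟩⟩

end LGSCode

/-! ### The conditions on lists and their polynomial-time tests -/

namespace LGSCode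

open Prog

/-- The lists describe a graph. -/
def GraphLists (A V : List Name) (E : List Edge) : Prop :=
  ∀ e ∈ E, e.1 ∈ V ∧ e.2.1 ∈ A ∧ e.2.2 ∈ V

/-- Some `R`-chain of elements of the list leads from an element satisfying `I` to one
satisfying `F`. -/
def Reaches {β : Type} (l : List β) (R : β → β → Prop) (I F : β → Prop) : Prop :=
  ∃ b b₀, F b ∧ b₀ ∈ l ∧ I b₀ ∧ Relation.ReflTransGen (fun c d => R c d ∧ d ∈ l) b₀ b

namespace Data

variable (d : Data)

/-- The lists describe a guest and a host. -/
def IsInstance : Prop :=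
  GraphLists d.guestAlphabet d.guestNodes d.guestEdges ∧
  GraphLists d.hostAlphabet d.hostNodes d.hostEdges ∧
  (∀ u ∈ d.must, u ∈ d.guestNodes) ∧ (∀ u ∈ d.unique, u ∈ d.guestNodes) ∧
  (∀ u ∈ d.exclusive, u ∈ d.guestNodes) ∧
  (∀ c ∈ d.choice, c.1 ∈ d.guestNodes ∧
    ∀ e ∈ c.2, (e.1, e.2.1, e.2.2) ∈ d.guestEdges ∧ e.1 = c.1) ∧
  ∀ e ∈ d.guestEdges, ∃ c ∈ d.choice, c.1 = e.1 ∧ (e.1, e.2.1, e.2.2) ∈ c.2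

/-- The lists describe a subgraph of the product of guest and host. -/
def IsCandidate : Prop :=
  d.nodes.Nodup ∧ d.pairs.Nodup ∧
  (∀ p ∈ d.nodes, p.1 ∈ d.guestNodes ∧ p.2 ∈ d.hostNodes) ∧
  ∀ f ∈ d.pairs, (f.1.1, f.1.2) ∈ d.nodes ∧ (f.2.2.1, f.2.2.2) ∈ d.nodes ∧
    (f.1.1, f.2.1, f.2.2.1) ∈ d.guestEdges ∧ (f.1.2, f.2.1, f.2.2.2) ∈ d.hostEdges

/-- Must, unique and exclusive nodes are treated as required. -/
def NodeConditions : Prop :=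
  (∀ u ∈ d.must, ∃ p ∈ d.nodes, p.1 = u) ∧
  (∀ u ∈ d.unique, ∀ p ∈ d.nodes, ∀ q ∈ d.nodes, p.1 = u → q.1 = u → p.2 = q.2) ∧
  ∀ u ∈ d.exclusive, ∀ p ∈ d.nodes, ∀ q ∈ d.nodes, p.1 = u → p.2 = q.2 → u = q.1

/-- All edges of the list `l` are realized by product edges from `(u, u')`. -/
def Realized (l : List Edge) (u u' : Name) : Prop :=
  ∀ e ∈ l, ∃ f ∈ d.pairs, f.1.1 = u ∧ f.1.2 = u' ∧ f.2.1 = e.2.1 ∧ f.2.2.1 = e.2.2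

/-- Outgoing edges follow the choice function. -/
def ChoiceConditions : Prop :=
  (∀ p ∈ d.nodes, ∃ c ∈ d.choice, c.1 = p.1 ∧ d.Realized c.2 p.1 p.2) ∧
  ∀ f ∈ d.pairs, ∃ c ∈ d.choice, c.1 = f.1.1 ∧ (f.1.1, f.2.1, f.2.2.1) ∈ c.2 ∧
    d.Realized c.2 f.1.1 f.1.2

/-- Reachability of must nodes is preserved. -/
def PathConditions : Prop :=
  ∀ p ∈ d.nodes, ∀ v ∈ d.must,
    Reaches d.guestEdges (fun c e => c.2.2 = e.1) (fun e => e.1 = p.1) (fun e => e.2.2 = v) →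
    Reaches d.pairs (fun c e => c.2.2.1 = e.1.1 ∧ c.2.2.2 = e.1.2)
      (fun f => f.1.1 = p.1 ∧ f.1.2 = p.2) (fun f => f.2.2.1 = v)

/-- The lists describe a guest, a host, and a loose graph simulation. -/
def Valid : Prop :=
  d.IsInstance ∧ d.IsCandidate ∧ d.NodeConditions ∧ d.ChoiceConditions ∧ d.PathConditions

end Data

section Quantifiers

variable {Γ α : Type} {C : Ctx Γ Token α}

theorem polyPred_forall_name {l : α → List Name} (hl : PolyFun C (fun a => names (l a)))
    {P : α → Name → Prop} (hP : PolyPred (C.push nameCode) (fun p => P p.1 p.2)) :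
    PolyPred C (fun a => ∀ b ∈ l a, P a b) :=
  PolyPred.forall_mem (marker_notMem_nameCode 0) hl hP

theorem polyPred_forall_edge {l : α → List Edge} (hl : PolyFun C (fun a => edges (l a)))
    {P : α → Edge → Prop} (hP : PolyPred (C.push edgeCode) (fun p => P p.1 p.2)) :
    PolyPred C (fun a => ∀ b ∈ l a, P a b) :=
  PolyPred.forall_mem (marker_notMem_edgeCode (by decide)) hl hP

theorem polyPred_forall_choice {l : α → List (Name × List Edge)}
    (hl : PolyFun C (fun a => choices (l a))) {P : α → Name × List Edge → Prop}
    (hP : PolyPred (C.push choiceCode) (fun p => P p.1 p.2)) :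
    PolyPred C (fun a => ∀ b ∈ l a, P a b) :=
  PolyPred.forall_mem (marker_notMem_choiceCode (by decide) (by decide)) hl hP

theorem polyPred_exists_choice {l : α → List (Name × List Edge)}
    (hl : PolyFun C (fun a => choices (l a))) {P : α → Name × List Edge → Prop}
    (hP : PolyPred (C.push choiceCode) (fun p => P p.1 p.2)) :
    PolyPred C (fun a => ∃ b ∈ l a, P a b) :=
  PolyPred.exists_mem (marker_notMem_choiceCode (by decide) (by decide)) hl hP

theorem polyPred_forall_pairNode {l : α → List (Name × Name)}
    (hl : PolyFun C (fun a => pairNodes (l a))) {P : α → Name × Name → Prop}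
    (hP : PolyPred (C.push pairCode) (fun p => P p.1 p.2)) :
    PolyPred C (fun a => ∀ b ∈ l a, P a b) :=
  PolyPred.forall_mem (marker_notMem_pairCode (by decide)) hl hP

theorem polyPred_exists_pairNode {l : α → List (Name × Name)}
    (hl : PolyFun C (fun a => pairNodes (l a))) {P : α → Name × Name → Prop}
    (hP : PolyPred (C.push pairCode) (fun p => P p.1 p.2)) :
    PolyPred C (fun a => ∃ b ∈ l a, P a b) :=
  PolyPred.exists_mem (marker_notMem_pairCode (by decide)) hl hP

theorem polyPred_forall_pairEdge {l : α → List PairEdge}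
    (hl : PolyFun C (fun a => pairEdges (l a))) {P : α → PairEdge → Prop}
    (hP : PolyPred (C.push pairEdgeCode) (fun p => P p.1 p.2)) :
    PolyPred C (fun a => ∀ b ∈ l a, P a b) :=
  PolyPred.forall_mem (marker_notMem_pairEdgeCode (by decide)) hl hP

theorem polyPred_exists_pairEdge {l : α → List PairEdge}
    (hl : PolyFun C (fun a => pairEdges (l a))) {P : α → PairEdge → Prop}
    (hP : PolyPred (C.push pairEdgeCode) (fun p => P p.1 p.2)) :
    PolyPred C (fun a => ∃ b ∈ l a, P a b) :=
  PolyPred.exists_mem (marker_notMem_pairEdgeCode (by decide)) hl hP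

theorem polyPred_graphLists {A V : α → List Name} {E : α → List Edge}
    (hA : PolyFun C (fun a => names (A a))) (hV : PolyFun C (fun a => names (V a)))
    (hE : PolyFun C (fun a => edges (E a))) : PolyPred C (fun a => GraphLists (A a) (V a) (E a)) := by
  have h := PolyFun.snd C edgeCode
  exact polyPred_forall_edge hE ((polyPred_mem (polyFun_source h) (hV.fst _)).and
    ((polyPred_mem (polyFun_label h) (hA.fst _)).and (polyPred_mem (polyFun_target h) (hV.fst _))))

theorem polyPred_subset {l k : α → List Name} (hl : PolyFun C (fun a => names (l a)))
    (hk : PolyFun C (fun a => names (k a))) : PolyPred C (fun a => ∀ u ∈ l a, u ∈ k a) :=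
  polyPred_forall_name hl (polyPred_mem (PolyFun.snd C nameCode) (hk.fst _))

end Quantifiers

variable (Γ : Type)

/-- Here and in the following tests the term mirrors the formula: one quantifier lemma per bounded
quantifier, with `fst` carrying earlier variables past each newly bound one. -/
theorem polyPred_isInstance : PolyPred (dataCtx Γ) Data.IsInstance := by
  obtain ⟨hA, hV, hE, hM, hU, hX, hC, hA', hV', hE'⟩ := polyFun_instance Γ
  have hc := PolyFun.snd (dataCtx Γ) choiceCode
  have he := PolyFun.snd (dataCtx Γ) edgeCode
  have hce := PolyFun.snd ((dataCtx Γ).push choiceCode) edgeCode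
  have hec := PolyFun.snd ((dataCtx Γ).push edgeCode) choiceCode
  have he' := he.fst choiceCode
  refine (polyPred_graphLists hA hV hE).and ((polyPred_graphLists hA' hV' hE').and
    ((polyPred_subset hM hV).and ((polyPred_subset hU hV).and ((polyPred_subset hX hV).and
    (PolyPred.and ?_ ?_)))))
  · exact polyPred_forall_choice hC ((polyPred_mem (polyFun_choice_node hc) (hV.fst _)).and
      (polyPred_forall_edge (polyFun_choice_set hc)
      ((polyPred_mem_edges (polyFun_source hce) (polyFun_label hce) (polyFun_target hce)
        ((hE.fst _).fst _)).and
      (polyPred_eq (polyFun_source hce) (polyFun_choice_node (hc.fst _))))))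
  · exact polyPred_forall_edge hE (polyPred_exists_choice (hC.fst _)
      ((polyPred_eq (polyFun_choice_node hec) (polyFun_source he')).and
      (polyPred_mem_edges (polyFun_source he') (polyFun_label he') (polyFun_target he')
        (polyFun_choice_set hec))))

theorem polyPred_isCandidate : PolyPred (dataCtx Γ) Data.IsCandidate := by
  obtain ⟨-, hV, hE, -, -, -, -, -, hV', hE'⟩ := polyFun_instance Γ
  obtain ⟨hN, hP⟩ := polyFun_candidate Γ
  have hp := PolyFun.snd (dataCtx Γ) pairCode
  obtain ⟨h1, h2, h3, h4, h5⟩ := polyFun_pairEdge (PolyFun.snd (dataCtx Γ) pairEdgeCode)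
  refine (PolyPred.nodup (marker_notMem_pairCode (by decide)) pairCode_injective hN).and
    ((PolyPred.nodup (marker_notMem_pairEdgeCode (by decide)) pairEdgeCode_injective hP).and
    (PolyPred.and ?_ ?_))
  · exact polyPred_forall_pairNode hN ((polyPred_mem (polyFun_pair_fst hp) (hV.fst _)).and
      (polyPred_mem (polyFun_pair_snd hp) (hV'.fst _)))
  · exact polyPred_forall_pairEdge hP ((polyPred_mem_pairNodes h1 h2 (hN.fst _)).and
      ((polyPred_mem_pairNodes h4 h5 (hN.fst _)).and
      ((polyPred_mem_edges h1 h3 h4 (hE.fst _)).and (polyPred_mem_edges h2 h3 h5 (hE'.fst _)))))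

theorem polyPred_nodeConditions : PolyPred (dataCtx Γ) Data.NodeConditions := by
  obtain ⟨-, -, -, hM, hU, hX, -⟩ := polyFun_instance Γ
  obtain ⟨hN, -⟩ := polyFun_candidate Γ
  have hu := PolyFun.snd (dataCtx Γ) nameCode
  have hp := PolyFun.snd ((dataCtx Γ).push nameCode) pairCode
  have hq := PolyFun.snd (((dataCtx Γ).push nameCode).push pairCode) pairCode
  have hp' := hp.fst pairCode
  have hu' := (hu.fst pairCode).fst pairCode
  refine PolyPred.and ?_ (PolyPred.and ?_ ?_)
  · exact polyPred_forall_name hM (polyPred_exists_pairNode (hN.fst _)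
      (polyPred_eq (polyFun_pair_fst hp) (hu.fst _)))
  · exact polyPred_forall_name hU (polyPred_forall_pairNode (hN.fst _)
      (polyPred_forall_pairNode ((hN.fst _).fst _)
      ((polyPred_eq (polyFun_pair_fst hp') hu').imp ((polyPred_eq (polyFun_pair_fst hq) hu').imp
      (polyPred_eq (polyFun_pair_snd hp') (polyFun_pair_snd hq))))))
  · exact polyPred_forall_name hX (polyPred_forall_pairNode (hN.fst _)
      (polyPred_forall_pairNode ((hN.fst _).fst _)
      ((polyPred_eq (polyFun_pair_fst hp') hu').imp
      ((polyPred_eq (polyFun_pair_snd hp') (polyFun_pair_snd hq)).imp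
      (polyPred_eq hu' (polyFun_pair_fst hq))))))

variable {Γ} in
theorem polyPred_realized {α : Type} {C : Ctx Γ Token α} {D : α → Data} {l : α → List Edge}
    {u u' : α → Name} (hP : PolyFun C (fun a => pairEdges (D a).pairs))
    (hl : PolyFun C (fun a => edges (l a))) (hu : PolyFun C (fun a => nameCode (u a)))
    (hu' : PolyFun C (fun a => nameCode (u' a))) :
    PolyPred C (fun a => (D a).Realized (l a) (u a) (u' a)) := by
  have he := (PolyFun.snd C edgeCode).fst pairEdgeCode
  obtain ⟨h1, h2, h3, h4, -⟩ := polyFun_pairEdge (PolyFun.snd (C.push edgeCode) pairEdgeCode)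
  exact polyPred_forall_edge hl (polyPred_exists_pairEdge (hP.fst _)
    ((polyPred_eq h1 ((hu.fst _).fst _)).and ((polyPred_eq h2 ((hu'.fst _).fst _)).and
    ((polyPred_eq h3 (polyFun_label he)).and (polyPred_eq h4 (polyFun_target he))))))

theorem polyPred_choiceConditions : PolyPred (dataCtx Γ) Data.ChoiceConditions := by
  obtain ⟨-, -, -, -, -, -, hC, -⟩ := polyFun_instance Γ
  obtain ⟨hN, hP⟩ := polyFun_candidate Γ
  have hp := (PolyFun.snd (dataCtx Γ) pairCode).fst choiceCode
  have hpc := PolyFun.snd ((dataCtx Γ).push pairCode) choiceCode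
  have hfc := PolyFun.snd ((dataCtx Γ).push pairEdgeCode) choiceCode
  obtain ⟨h1, h2, h3, h4, -⟩ :=
    polyFun_pairEdge ((PolyFun.snd (dataCtx Γ) pairEdgeCode).fst choiceCode)
  refine PolyPred.and ?_ ?_
  · exact polyPred_forall_pairNode hN (polyPred_exists_choice (hC.fst _)
      ((polyPred_eq (polyFun_choice_node hpc) (polyFun_pair_fst hp)).and
      (polyPred_realized ((hP.fst _).fst _) (polyFun_choice_set hpc) (polyFun_pair_fst hp)
        (polyFun_pair_snd hp))))
  · exact polyPred_forall_pairEdge hP (polyPred_exists_choice (hC.fst _)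
      ((polyPred_eq (polyFun_choice_node hfc) h1).and
      ((polyPred_mem_edges h1 h3 h4 (polyFun_choice_set hfc)).and
      (polyPred_realized ((hP.fst _).fst _) (polyFun_choice_set hfc) h1 h2))))

theorem polyPred_pathConditions : PolyPred (dataCtx Γ) Data.PathConditions := by
  obtain ⟨-, -, hE, hM, -⟩ := polyFun_instance Γ
  obtain ⟨hN, hP⟩ := polyFun_candidate Γ
  have hp := (PolyFun.snd (dataCtx Γ) pairCode).fst nameCode
  have hv := PolyFun.snd ((dataCtx Γ).push pairCode) nameCode
  have he := PolyFun.snd (((dataCtx Γ).push pairCode).push nameCode) edgeCode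
  have he' := PolyFun.snd ((((dataCtx Γ).push pairCode).push nameCode).push edgeCode) edgeCode
  have hf := PolyFun.snd (((dataCtx Γ).push pairCode).push nameCode) pairEdgeCode
  obtain ⟨h1, h2, -, h4, -⟩ := polyFun_pairEdge hf
  obtain ⟨-, -, -, k4, k5⟩ := polyFun_pairEdge (hf.fst pairEdgeCode)
  obtain ⟨k1, k2, -⟩ := polyFun_pairEdge
    (PolyFun.snd ((((dataCtx Γ).push pairCode).push nameCode).push pairEdgeCode) pairEdgeCode)
  refine polyPred_forall_pairNode hN (polyPred_forall_name (hM.fst _) (PolyPred.imp ?_ ?_))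
  · exact PolyPred.reach (marker_notMem_edgeCode (by decide)) ((hE.fst _).fst _)
      (polyPred_eq (polyFun_source he) (polyFun_pair_fst (hp.fst _)))
      (polyPred_eq (polyFun_target he) (hv.fst _))
      (polyPred_eq (polyFun_target (he.fst _)) (polyFun_source he'))
  · exact PolyPred.reach (marker_notMem_pairEdgeCode (by decide)) ((hP.fst _).fst _)
      ((polyPred_eq h1 (polyFun_pair_fst (hp.fst _))).and
        (polyPred_eq h2 (polyFun_pair_snd (hp.fst _))))
      (polyPred_eq h4 (hv.fst _))
      ((polyPred_eq k4 k1).and (polyPred_eq k5 k2))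

theorem polyPred_valid : PolyPred (dataCtx Γ) Data.Valid :=
  (polyPred_isInstance Γ).and ((polyPred_isCandidate Γ).and ((polyPred_nodeConditions Γ).and
    ((polyPred_choiceConditions Γ).and (polyPred_pathConditions Γ))))

end LGSCode

/-! ### Conditions on lists versus loose graph simulations -/

namespace LGSCode

open Prog

/-- A reflexive-transitive chain from `b₀` to `b` is the same as a nonempty list with these end
points. The first item needs its own membership hypothesis, because each link of the chain vouches
only for its target. -/
theorem reaches_iff {β : Type} {l : List β} {R : β → β → Prop} {I F : β → Prop} :
    Reaches l R I F ↔ ∃ ρ : List β, (∀ e ∈ ρ, e ∈ l) ∧ ρ.IsChain R ∧ (∃ e ∈ ρ.head?, I e) ∧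
      ∃ e ∈ ρ.getLast?, F e := by
  constructor
  · rintro ⟨b, b₀, hF, hb₀, hI, h⟩
    suffices H : b₀ ∈ l → ∃ t : List β, (∀ e ∈ b₀ :: t, e ∈ l) ∧ (b₀ :: t).IsChain R ∧
        b ∈ (b₀ :: t).getLast? by
      obtain ⟨t, h1, h2, h3⟩ := H hb₀
      exact ⟨b₀ :: t, h1, h2, ⟨b₀, rfl, hI⟩, b, h3, hF⟩
    clear hb₀ hI
    induction h using Relation.ReflTransGen.head_induction_on with
    | refl => exact fun hb => ⟨[], by simpa using hb, by simp, by simp⟩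
    | head hcd _ ih =>
      intro hc
      obtain ⟨t, h1, h2, h3⟩ := ih hcd.2
      refine ⟨_ :: t, List.forall_mem_cons.2 ⟨hc, h1⟩, List.isChain_cons_cons.2 ⟨hcd.1, h2⟩, ?_⟩
      rwa [List.getLast?_cons_cons]
  · rintro ⟨ρ, h1, h2, ⟨b₀, hb₀, hI⟩, b, hb, hF⟩
    cases ρ with
    | nil => simp at hb₀
    | cons a t =>
      obtain rfl : a = b₀ := by simpa using hb₀
      refine ⟨b, a, hF, h1 a (by simp), hI, ?_⟩
      clear hI hb₀
      induction t generalizing a with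
      | nil =>
        obtain rfl : a = b := by simpa using hb
        exact .refl
      | cons c t ih =>
        rw [List.isChain_cons_cons] at h2
        rw [List.getLast?_cons_cons] at hb
        have h1' := (List.forall_mem_cons.1 h1).2
        exact .head ⟨h2.1, h1' c (by simp)⟩ (ih c h1' h2.2 hb)

/-- Reachability is taken among edges rather than nodes, so paths are nonempty automatically, also
from a node to itself. -/
theorem paths_nonempty_iff {A N : Type} {M : HostGraph A N} {l : List (N × A × N)}
    (hl : ∀ e, e ∈ M.edges ↔ e ∈ l) {v v' : N} :
    (M.paths v v').Nonempty ↔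
      Reaches l (fun c e => c.2.2 = e.1) (fun e => e.1 = v) (fun e => e.2.2 = v') := by
  rw [reaches_iff]
  simp only [← hl]
  rfl

namespace Data

/-- The lists are lists of the parts of `G`, `H` and `S`. -/
structure Describes (d : Data) (G : Guest Name Name) (H : HostGraph Name Name)
    (S : HostGraph Name (Name × Name)) : Prop where
  guestAlphabet : d.guestAlphabet.toFinset = G.alphabet
  guestNodes : d.guestNodes.toFinset = G.nodes
  guestEdges : d.guestEdges.toFinset = G.edges
  must : d.must.toFinset = G.must
  unique : d.unique.toFinset = G.unique
  exclusive : d.exclusive.toFinset = G.exclusive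
  choice : ∀ v γ, γ ∈ G.choice v ↔ ∃ l, (v, l) ∈ d.choice ∧ l.toFinset = γ
  hostAlphabet : d.hostAlphabet.toFinset = H.alphabet
  hostNodes : d.hostNodes.toFinset = H.nodes
  hostEdges : d.hostEdges.toFinset = H.edges
  nodup_nodes : d.nodes.Nodup
  nodup_pairs : d.pairs.Nodup
  nodes : d.nodes.toFinset = S.nodes
  pairs : d.pairs.toFinset = S.edges

variable {d : Data} {G : Guest Name Name} {H : HostGraph Name Name}
  {S : HostGraph Name (Name × Name)}

theorem Describes.isInstance (h : d.Describes G H S) : d.IsInstance := by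
  refine ⟨?_, ?_, ?_, ?_, ?_, ?_, ?_⟩
  · simpa [GraphLists, ← h.guestAlphabet, ← h.guestNodes, ← h.guestEdges] using G.edges_mem
  · simpa [GraphLists, ← h.hostAlphabet, ← h.hostNodes, ← h.hostEdges] using H.edges_mem
  · intro u hu
    rw [← List.mem_toFinset, h.guestNodes]
    exact G.must_subset (h.must ▸ List.mem_toFinset.2 hu)
  · intro u hu
    rw [← List.mem_toFinset, h.guestNodes]
    exact G.unique_subset (h.unique ▸ List.mem_toFinset.2 hu)
  · intro u hu
    rw [← List.mem_toFinset, h.guestNodes]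
    exact G.exclusive_subset (h.exclusive ▸ List.mem_toFinset.2 hu)
  · rintro ⟨v, l⟩ hc
    have hγ : l.toFinset ∈ G.choice v := (h.choice _ _).2 ⟨l, hc, rfl⟩
    -- Outside the nodes the choice function is empty, so a listed pair can only belong to a node.
    have hv : v ∈ G.nodes := by
      by_contra hv
      simp [G.choice_of_notMem v hv] at hγ
    refine ⟨by rwa [← List.mem_toFinset, h.guestNodes], fun e he => ?_⟩
    have : e ∈ G.out v := by
      rw [← G.biUnion_choice v hv]
      exact Finset.mem_biUnion.2 ⟨_, hγ, List.mem_toFinset.2 he⟩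
    obtain ⟨h1, h2⟩ := Finset.mem_filter.1 this
    exact ⟨by rwa [← List.mem_toFinset, h.guestEdges], h2⟩
  · intro e he
    rw [← List.mem_toFinset, h.guestEdges] at he
    have : e ∈ G.out e.1 := Finset.mem_filter.2 ⟨he, rfl⟩
    rw [← G.biUnion_choice e.1 (G.edges_mem e he).1] at this
    obtain ⟨γ, hγ, heγ⟩ := Finset.mem_biUnion.1 this
    obtain ⟨l, hl, rfl⟩ := (h.choice _ _).1 hγ
    exact ⟨_, hl, rfl, List.mem_toFinset.1 heγ⟩

theorem Describes.isCandidate (h : d.Describes G H S)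
    (hS : S.IsSubgraph (G.toHostGraph.tensor H)) : d.IsCandidate := by
  refine ⟨h.nodup_nodes, h.nodup_pairs, fun p hp => ?_, ?_⟩
  · rw [← List.mem_toFinset, h.nodes] at hp
    have := Finset.mem_product.1 (hS.2.1 hp)
    rwa [← h.guestNodes, ← h.hostNodes, List.mem_toFinset, List.mem_toFinset] at this
  · rintro ⟨⟨u, u'⟩, a, v, v'⟩ hf
    rw [← List.mem_toFinset, h.pairs] at hf
    have h1 := S.edges_mem _ hf
    have h2 := (HostGraph.mem_tensor_edges _ _ _ _ _ _ _).1 (hS.2.2 hf)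
    rw [← h.guestEdges, ← h.hostEdges, List.mem_toFinset, List.mem_toFinset] at h2
    rw [← h.nodes, List.mem_toFinset, List.mem_toFinset] at h1
    exact ⟨h1.1, h1.2.2, h2⟩

/-- Lists that satisfy the conditions describe a guest, a host, and a subgraph of their product. -/
theorem exists_describes (hI : d.IsInstance) (hC : d.IsCandidate) :
    ∃ G H S, d.Describes G H S ∧ S.IsSubgraph (G.toHostGraph.tensor H) := by
  obtain ⟨hG, hH, hM, hU, hX, hc, he⟩ := hI
  obtain ⟨hN, hP, hn, hf⟩ := hC
  have mem_choice : ∀ v γ, γ ∈ ((d.choice.filter (fun c => c.1 = v)).map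
      fun c => c.2.toFinset).toFinset ↔ ∃ l, (v, l) ∈ d.choice ∧ l.toFinset = γ := by
    intro v γ
    simp only [List.mem_toFinset, List.mem_map, List.mem_filter, decide_eq_true_eq]
    constructor
    · rintro ⟨⟨w, l⟩, ⟨h1, rfl⟩, rfl⟩
      exact ⟨l, h1, rfl⟩
    · rintro ⟨l, h1, rfl⟩
      exact ⟨(v, l), ⟨h1, rfl⟩, rfl⟩
  let G : Guest Name Name :=
    { alphabet := d.guestAlphabet.toFinset
      nodes := d.guestNodes.toFinset
      edges := d.guestEdges.toFinset
      edges_mem := by simpa only [List.mem_toFinset, GraphLists] using hG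
      must := d.must.toFinset
      unique := d.unique.toFinset
      exclusive := d.exclusive.toFinset
      must_subset := fun u hu => by simpa using hM u (by simpa using hu)
      unique_subset := fun u hu => by simpa using hU u (by simpa using hu)
      exclusive_subset := fun u hu => by simpa using hX u (by simpa using hu)
      choice := fun v => ((d.choice.filter (fun c => c.1 = v)).map fun c => c.2.toFinset).toFinset
      biUnion_choice := fun v _ => by
        ext e
        simp only [Finset.mem_biUnion, mem_choice, HostGraph.out, Finset.mem_filter, id]
        constructor
        · rintro ⟨_, ⟨l, hl, rfl⟩, hel⟩
          obtain ⟨h1, h2⟩ := (hc _ hl).2 e (List.mem_toFinset.1 hel)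
          exact ⟨List.mem_toFinset.2 h1, h2⟩
        · rintro ⟨h1, rfl⟩
          obtain ⟨⟨w, l⟩, h2, h3, h4⟩ := he e (List.mem_toFinset.1 h1)
          obtain rfl : w = e.1 := h3
          exact ⟨_, ⟨l, h2, rfl⟩, List.mem_toFinset.2 h4⟩
      choice_of_notMem := fun v hv => by
        refine Finset.eq_empty_of_forall_notMem fun γ hγ => hv ?_
        obtain ⟨l, hl, -⟩ := (mem_choice v γ).1 hγ
        exact List.mem_toFinset.2 (hc _ hl).1 }
  let H : HostGraph Name Name :=
    { alphabet := d.hostAlphabet.toFinset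
      nodes := d.hostNodes.toFinset
      edges := d.hostEdges.toFinset
      edges_mem := by simpa only [List.mem_toFinset, GraphLists] using hH }
  have hE : d.pairs.toFinset ⊆ (G.toHostGraph.tensor H).edges := by
    rintro ⟨⟨u, u'⟩, a, v, v'⟩ h
    obtain ⟨-, -, h1, h2⟩ := hf _ (List.mem_toFinset.1 h)
    exact (HostGraph.mem_tensor_edges _ _ _ _ _ _ _).2
      ⟨List.mem_toFinset.2 h1, List.mem_toFinset.2 h2⟩
  -- The candidate word lists no symbols; the alphabet is the one that a subgraph of the product
  -- must have.
  let S : HostGraph Name (Name × Name) :=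
    { alphabet := (G.toHostGraph.tensor H).alphabet
      nodes := d.nodes.toFinset
      edges := d.pairs.toFinset
      edges_mem := fun e he => by
        obtain ⟨h1, h2, -⟩ := hf e (List.mem_toFinset.1 he)
        exact ⟨List.mem_toFinset.2 h1, ((G.toHostGraph.tensor H).edges_mem e (hE he)).2.1,
          List.mem_toFinset.2 h2⟩ }
  refine ⟨G, H, S, ⟨rfl, rfl, rfl, rfl, rfl, rfl, mem_choice, rfl, rfl, rfl, hN, hP, rfl, rfl⟩, rfl,
    fun p hp => ?_, hE⟩
  obtain ⟨h1, h2⟩ := hn p (List.mem_toFinset.1 hp)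
  exact Finset.mem_product.2 ⟨List.mem_toFinset.2 h1, List.mem_toFinset.2 h2⟩

/-- Nodes of `S` lie in the product, so quantifying over pairs listed for `S` and over host nodes
amounts to the same. -/
theorem Describes.nodeConditions_iff (h : d.Describes G H S)
    (hS : S.IsSubgraph (G.toHostGraph.tensor H)) :
    d.NodeConditions ↔ LGS1 G H S ∧ LGS2 G H S ∧ LGS3 G H S := by
  have hV : ∀ u u', (u, u') ∈ S.nodes → u ∈ G.nodes ∧ u' ∈ H.nodes := fun u u' hu =>
    Finset.mem_product.1 (hS.2.1 hu)
  simp only [NodeConditions, LGS1, LGS2, LGS3, ← List.mem_toFinset, h.must, h.unique, h.exclusive,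
    h.nodes]
  refine and_congr ?_ (and_congr ?_ ?_)
  · refine forall₂_congr fun u _ => ?_
    constructor
    · rintro ⟨⟨u, u'⟩, hp, rfl⟩
      exact ⟨u', (hV _ _ hp).2, hp⟩
    · rintro ⟨u', -, hp⟩
      exact ⟨_, hp, rfl⟩
  · refine forall₂_congr fun u _ => ?_
    constructor
    · exact fun H u' _ v' _ h1 h2 => H _ h1 _ h2 rfl rfl
    · rintro H ⟨u, u'⟩ h1 ⟨v, v'⟩ h2 rfl rfl
      exact H u' (hV _ _ h1).2 v' (hV _ _ h2).2 h1 h2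
  · refine forall₂_congr fun u _ => ?_
    constructor
    · exact fun H v _ u' _ h1 h2 => H _ h1 _ h2 rfl rfl
    · rintro H ⟨u, u'⟩ h1 ⟨v, v'⟩ h2 rfl rfl
      exact H v (hV _ _ h2).1 u' (hV _ _ h1).2 h1 h2

/-- `Realized` ignores the sources of the edges in `l`; hypothesis `hl`, true for choice sets of
`u`, supplies them. -/
theorem Describes.realized_iff (h : d.Describes G H S)
    (hS : S.IsSubgraph (G.toHostGraph.tensor H)) {u u' : Name} {l : List Edge}
    (hl : ∀ e ∈ l, e.1 = u) :
    d.Realized l u u' ↔ ∀ a v, (u, a, v) ∈ l.toFinset →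
      ∃ v' ∈ H.nodes, ((u, u'), a, (v, v')) ∈ S.edges := by
  simp only [Realized, ← List.mem_toFinset, h.pairs]
  constructor
  · intro H a v hv
    obtain ⟨⟨⟨u, u'⟩, a, v, v'⟩, hf, rfl, rfl, rfl, rfl⟩ := H _ hv
    exact ⟨v', (Finset.mem_product.1 (hS.2.1 (S.edges_mem _ hf).2.2)).2, hf⟩
  · rintro H ⟨w, a, v⟩ he
    obtain rfl : w = u := hl _ (List.mem_toFinset.1 he)
    obtain ⟨v', -, hv'⟩ := H a v he
    exact ⟨_, hv', rfl, rfl, rfl, rfl⟩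

theorem Describes.choiceConditions_iff (h : d.Describes G H S)
    (hS : S.IsSubgraph (G.toHostGraph.tensor H)) : d.ChoiceConditions ↔ LGS4 G H S := by
  have hC : ∀ c ∈ d.choice, ∀ e ∈ c.2, e.1 = c.1 := fun c hc e he =>
    ((h.isInstance.2.2.2.2.2.1 c hc).2 e he).2
  refine and_congr ?_ ?_
  · constructor
    · intro H u u' hu
      rw [← h.nodes, List.mem_toFinset] at hu
      obtain ⟨⟨w, l⟩, hc, hw, hr⟩ := H _ hu
      obtain rfl : w = u := hw
      exact ⟨_, (h.choice _ _).2 ⟨l, hc, rfl⟩, (h.realized_iff hS (hC _ hc)).1 hr⟩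
    · rintro H ⟨u, u'⟩ hu
      rw [← List.mem_toFinset, h.nodes] at hu
      obtain ⟨γ, hγ, hr⟩ := H _ _ hu
      obtain ⟨l, hc, rfl⟩ := (h.choice _ _).1 hγ
      exact ⟨_, hc, rfl, (h.realized_iff hS (hC _ hc)).2 hr⟩
  · constructor
    · intro H u u' a v v' hu
      rw [← h.pairs, List.mem_toFinset] at hu
      obtain ⟨⟨w, l⟩, hc, hw, hm, hr⟩ := H _ hu
      obtain rfl : w = u := hw
      exact ⟨_, (h.choice _ _).2 ⟨l, hc, rfl⟩, List.mem_toFinset.2 hm,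
        (h.realized_iff hS (hC _ hc)).1 hr⟩
    · rintro H ⟨⟨u, u'⟩, a, v, v'⟩ hu
      rw [← List.mem_toFinset, h.pairs] at hu
      obtain ⟨γ, hγ, hm, hr⟩ := H _ _ _ _ _ hu
      obtain ⟨l, hc, rfl⟩ := (h.choice _ _).1 hγ
      exact ⟨_, hc, rfl, List.mem_toFinset.1 hm, (h.realized_iff hS (hC _ hc)).2 hr⟩

/-- The search in `S` leaves the host end point free; it is read off the last edge and is a host
node because `S` is a subgraph. Splitting equalities of pairs into components makes the two chain
conditions literally equal. -/
theorem Describes.pathConditions_iff (h : d.Describes G H S)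
    (hS : S.IsSubgraph (G.toHostGraph.tensor H)) : d.PathConditions ↔ LGS5 G H S := by
  have hG : ∀ e, e ∈ G.edges ↔ e ∈ d.guestEdges := fun e => by
    rw [← h.guestEdges, List.mem_toFinset]
  have hE : ∀ e, e ∈ S.edges ↔ e ∈ d.pairs := fun e => by rw [← h.pairs, List.mem_toFinset]
  have key : ∀ u u' v, Reaches d.pairs (fun c e => c.2.2.1 = e.1.1 ∧ c.2.2.2 = e.1.2)
      (fun f => f.1.1 = u ∧ f.1.2 = u') (fun f => f.2.2.1 = v) ↔
      ∃ v' ∈ H.nodes, (S.paths (u, u') (v, v')).Nonempty := by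
    intro u u' v
    simp only [paths_nonempty_iff hE, reaches_iff, ← hE, Prod.ext_iff (x := Prod.snd (Prod.snd _)),
      Prod.ext_iff (x := Prod.fst _)]
    constructor
    · rintro ⟨ρ, h1, h2, h3, f, hf, hv⟩
      exact ⟨f.2.2.2, (Finset.mem_product.1
        (hS.2.1 (S.edges_mem _ (h1 f (List.mem_of_mem_getLast? hf))).2.2)).2, ρ, h1, h2, h3, f, hf,
        hv, rfl⟩
    · rintro ⟨v', -, ρ, h1, h2, h3, f, hf, hv, -⟩
      exact ⟨ρ, h1, h2, h3, f, hf, hv⟩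
  simp only [PathConditions, LGS5, key, paths_nonempty_iff hG, ← List.mem_toFinset, h.nodes, h.must]
  exact Prod.forall

theorem Describes.valid_iff (h : d.Describes G H S)
    (hS : S.IsSubgraph (G.toHostGraph.tensor H)) :
    d.Valid ↔ S ∈ looseGraphSimulations G H := by
  simp only [Valid, h.isInstance, h.isCandidate hS, h.nodeConditions_iff hS,
    h.choiceConditions_iff hS, h.pathConditions_iff hS, looseGraphSimulations, Set.mem_ofPred_eq, hS,
    true_and, and_assoc]

/-- `Valid` mentions only the lists, so it agrees with the definition for whichever `G`, `H`, `S`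
they describe; `exists_describes` provides such a triple. -/
theorem valid_iff_exists : d.Valid ↔ ∃ G H S, d.Describes G H S ∧ S ∈ looseGraphSimulations G H := by
  constructor
  · intro hd
    obtain ⟨G, H, S, h, hS⟩ := exists_describes hd.1 hd.2.1
    exact ⟨G, H, S, h, (h.valid_iff hS).1 hd⟩
  · rintro ⟨G, H, S, h, hS⟩
    exact (h.valid_iff hS.1).2 hS

end Data

theorem exists_describes_iff {x y : List Token} {G : Guest Name Name} {H : HostGraph Name Name}
    {S : HostGraph Name (Name × Name)} :
    DescribesInstance x G H ∧ DescribesCandidate y S ↔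
      ∃ d : Data, d.code = (x, y) ∧ d.Describes G H S := by
  constructor
  · rintro ⟨⟨_, _, ⟨_, lM, lU, lX, lC, ⟨lA, lV, lE, h1, h2, h3, rfl⟩, h4, h5, h6, h7, rfl⟩,
      ⟨lA', lV', lE', h8, h9, h10, rfl⟩, rfl⟩, lN, lP, h11, h12, h13, h14, rfl⟩
    refine ⟨⟨lA, lV, lE, lM, lU, lX, lC, lA', lV', lE', lN, lP⟩, ?_,
      ⟨h1, h2, h3, h4, h5, h6, h7, h8, h9, h10, h11, h12, h13, h14⟩⟩
    simp [Data.code, Data.instanceCode, Data.candidateCode, closed]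
  · rintro ⟨d, hd, h⟩
    obtain ⟨rfl, rfl⟩ := Prod.mk.inj hd
    refine ⟨⟨_, _, ⟨_, d.must, d.unique, d.exclusive, d.choice, ⟨d.guestAlphabet, d.guestNodes,
      d.guestEdges, h.guestAlphabet, h.guestNodes, h.guestEdges, rfl⟩, h.must, h.unique,
      h.exclusive, h.choice, rfl⟩, ⟨d.hostAlphabet, d.hostNodes, d.hostEdges, h.hostAlphabet,
      h.hostNodes, h.hostEdges, rfl⟩, ?_⟩, d.nodes, d.pairs, h.nodup_nodes, h.nodup_pairs, h.nodes,
      h.pairs, rfl⟩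
    simp [Data.instanceCode, closed]

theorem lgsRelation_iff {x y : List Token} :
    LGSRelation x y ↔ ∃ d : Data, d.code = (x, y) ∧ d.Valid := by
  simp only [LGSRelation, ← and_assoc, exists_describes_iff, Data.valid_iff_exists]
  constructor
  · rintro ⟨G, H, S, ⟨d, hd, h⟩, hS⟩
    exact ⟨d, hd, G, H, S, h, hS⟩
  · rintro ⟨d, hd, G, H, S, h, hS⟩
    exact ⟨G, H, S, ⟨d, hd, h⟩, hS⟩

/-- Parsing, then testing the parsed lists: the two stages are joined by `PolyPred.exists_preimage`.
-/
theorem inP_pairLanguage_lgsRelation : InP (pairLanguage LGSRelation) :=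
  Prog.inP_pairLanguage ((PolyPred.exists_preimage Data.code (polyPred_exists_code _)
    (polyPred_valid _)).congr fun _ => lgsRelation_iff.symm)

/-- Every candidate can be described. -/
theorem exists_describesCandidate (S : HostGraph Name (Name × Name)) :
    ∃ y, DescribesCandidate y S :=
  ⟨_, S.nodes.toList, S.edges.toList, S.nodes.nodup_toList, S.edges.nodup_toList,
    S.nodes.toList_toFinset, S.edges.toList_toFinset, rfl⟩

/-- Each simulation has a description, which is the certificate; enumerating its finite sets gives
lists without repetition. -/
theorem mem_lgsNonemptiness_iff {x : List Token} :
    x ∈ LGSNonemptiness ↔ ∃ y, LGSRelation x y := by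
  constructor
  · rintro ⟨G, H, hx, S, hS⟩
    obtain ⟨y, hy⟩ := exists_describesCandidate S
    exact ⟨y, G, H, S, hx, hy, hS⟩
  · rintro ⟨y, G, H, S, hx, -, hS⟩
    exact ⟨G, H, hx, S, hS⟩

end LGSCode

/-! ### Polynomial length of solutions -/

namespace LGSCode

section Length

variable {α : Type} {k : Fin 4} {f : α → List Token} {l : List α}

theorem length_closed : (closed k f l).length = (l.map fun b => (f b).length + 1).sum := by
  simp [closed, List.length_flatMap]

theorem length_lt_length_closed {b : α} (hb : b ∈ l) : (f b).length < (closed k f l).length := by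
  rw [length_closed]
  exact Nat.succ_le_iff.1 (List.le_sum_of_mem (List.mem_map.2 ⟨b, hb, rfl⟩))

theorem length_le_length_closed : l.length ≤ (closed k f l).length := by
  rw [length_closed]
  simp

theorem length_closed_le {B : ℕ} (h : ∀ b ∈ l, (f b).length ≤ B) :
    (closed k f l).length ≤ l.length * (B + 1) := by
  rw [length_closed]
  simpa using List.sum_le_card_nsmul (l.map fun b => (f b).length + 1) (B + 1) (by simpa using h)

theorem length_le_of_mem {n : Name} {l : List Name} (h : n ∈ l) :
    n.length ≤ (names l).length := by
  simpa [names] using (length_lt_length_closed (k := 0) (f := List.map Sum.inl) h).le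

end Length

namespace Data

variable {d : Data}

theorem length_section_le {s : List Token}
    (hs : s ∈ [names d.guestAlphabet, names d.guestNodes, edges d.guestEdges, names d.must,
      names d.unique, names d.exclusive, choices d.choice, names d.hostAlphabet, names d.hostNodes,
      edges d.hostEdges]) : s.length ≤ d.instanceCode.length :=
  (length_lt_length_closed (k := 3) (f := id) hs).le

/-- Absence of repetitions bounds the length of the list by the number of pairs of a guest and a
host node; each factor is at most the length of the instance. -/
theorem length_nodes_le (h : d.IsCandidate) : d.nodes.length ≤ d.instanceCode.length ^ 2 := by
  obtain ⟨hN, -, hn, -⟩ := h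
  rw [← List.toFinset_card_of_nodup hN]
  calc d.nodes.toFinset.card
      ≤ (d.guestNodes.toFinset ×ˢ d.hostNodes.toFinset).card :=
        Finset.card_le_card fun p hp => by
          simpa using hn p (List.mem_toFinset.1 hp)
    _ ≤ d.instanceCode.length * d.instanceCode.length := by
        rw [Finset.card_product]
        exact Nat.mul_le_mul
          ((List.toFinset_card_le _).trans (length_le_length_closed.trans
            (length_section_le (s := names d.guestNodes) (by simp))))
          ((List.toFinset_card_le _).trans (length_le_length_closed.trans
            (length_section_le (s := names d.hostNodes) (by simp))))
    _ = _ := (sq _).symm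

theorem label_mem (hI : d.IsInstance) (h : d.IsCandidate) {f : PairEdge} (hf : f ∈ d.pairs) :
    f.2.1 ∈ d.guestAlphabet :=
  (hI.1 _ (h.2.2.2 f hf).2.2.1).2.1

/-- An edge is given by two nodes of `S` and a guest symbol, whence the exponent `2 + 1 + 2`. -/
theorem length_pairs_le (hI : d.IsInstance) (h : d.IsCandidate) :
    d.pairs.length ≤ d.instanceCode.length ^ 5 := by
  rw [← List.toFinset_card_of_nodup h.2.1]
  have hN := (List.toFinset_card_le d.nodes).trans (length_nodes_le h)
  calc d.pairs.toFinset.card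
      ≤ (d.nodes.toFinset ×ˢ d.guestAlphabet.toFinset ×ˢ d.nodes.toFinset).card :=
        Finset.card_le_card fun f hf => by
          rw [List.mem_toFinset] at hf
          simpa using ⟨(h.2.2.2 f hf).1, label_mem hI h hf, (h.2.2.2 f hf).2.1⟩
    _ ≤ d.instanceCode.length ^ 2 * (d.instanceCode.length * d.instanceCode.length ^ 2) := by
        rw [Finset.card_product, Finset.card_product]
        exact Nat.mul_le_mul hN (Nat.mul_le_mul
          ((List.toFinset_card_le _).trans (length_le_length_closed.trans
            (length_section_le (s := names d.guestAlphabet) (by simp)))) hN)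
    _ = _ := by ring

/-- All names in a candidate are names of the instance, hence no longer than it. With `L` the
instance length, an entry made of `j` names has at most `j * L` bits, `j` markers `0` and one marker
`1`, with `j = 2` for nodes and `j = 5` for edges; the final 2 counts the section markers. -/
theorem length_candidateCode_le (hI : d.IsInstance) (h : d.IsCandidate) :
    d.candidateCode.length ≤ d.instanceCode.length ^ 2 * (2 * d.instanceCode.length + 3) +
      d.instanceCode.length ^ 5 * (5 * d.instanceCode.length + 6) + 2 := by
  have hG : ∀ p ∈ d.nodes, p.1.length ≤ d.instanceCode.length := fun p hp =>
    (length_le_of_mem (h.2.2.1 p hp).1).trans (length_section_le (by simp))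
  have hH : ∀ p ∈ d.nodes, p.2.length ≤ d.instanceCode.length := fun p hp =>
    (length_le_of_mem (h.2.2.1 p hp).2).trans (length_section_le (by simp))
  have hA : ∀ f ∈ d.pairs, f.2.1.length ≤ d.instanceCode.length := fun f hf =>
    (length_le_of_mem (label_mem hI h hf)).trans (length_section_le (by simp))
  have h1 : (pairNodes d.nodes).length ≤
      d.nodes.length * (2 * d.instanceCode.length + 2 + 1) := by
    refine length_closed_le fun p hp => ?_
    have h1 := hG p hp
    have h2 := hH p hp
    simp only [names, length_closed, List.length_map, List.map_cons, List.map_nil, List.sum_cons,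
      List.sum_nil]
    lia
  have h2 : (pairEdges d.pairs).length ≤
      d.pairs.length * (5 * d.instanceCode.length + 5 + 1) := by
    refine length_closed_le fun f hf => ?_
    obtain ⟨hs, ht, -⟩ := h.2.2.2 f hf
    have h1 := hG _ hs
    have h2 := hH _ hs
    have h3 := hG _ ht
    have h4 := hH _ ht
    have h5 := hA f hf
    simp only [names, length_closed, List.length_map, List.map_cons, List.map_nil, List.sum_cons,
      List.sum_nil]
    lia
  have h3 := h1.trans (Nat.mul_le_mul_right _ (length_nodes_le h))
  have h4 := h2.trans (Nat.mul_le_mul_right _ (length_pairs_le hI h))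
  have h5 : d.candidateCode.length = (pairNodes d.nodes).length + (pairEdges d.pairs).length + 2 := by
    simp only [candidateCode, length_closed, List.map_cons, List.map_nil, List.sum_cons,
      List.sum_nil, id]
    ring
  rw [h5]
  exact Nat.add_le_add_right (Nat.add_le_add h3 h4) 2

end Data

theorem inFNP_lgsRelation : InFNP LGSRelation := by
  refine ⟨inP_pairLanguage_lgsRelation, Polynomial.X ^ 2 * (2 * Polynomial.X + 3) +
    Polynomial.X ^ 5 * (5 * Polynomial.X + 6) + 2, fun x y hxy => ?_⟩
  obtain ⟨d, hd, hv⟩ := lgsRelation_iff.1 hxy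
  obtain ⟨rfl, rfl⟩ := Prod.mk.inj hd
  simpa using Data.length_candidateCode_le hv.1 hv.2.1

end LGSCode

/-! ### The three complexity statements -/

theorem mainTheorem8 :
    -- checking whether a given candidate is a loose graph simulation is in P
    InP (pairLanguage LGSRelation) ∧
    -- computing loose graph simulations is an NP search problem
    InFNP LGSRelation ∧
    -- deciding whether a loose graph simulation exists is in NP
    InNP LGSNonemptiness :=
  ⟨LGSCode.inP_pairLanguage_lgsRelation, LGSCode.inFNP_lgsRelation, LGSCode.Token, inferInstance,
    LGSRelation, LGSCode.inFNP_lgsRelation, fun _ => LGSCode.mem_lgsNonemptiness_iff⟩
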